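/- **Setting.** Let $y\in\mathbb R$, let $H:\mathbb R\to\mathbb R$, let $p>0$ be an everywhere positive probability density on $\mathbb R$, and put $U=yH+\log p$. Assume that $H$ and $U$ are infinitely differentiable with bounded derivatives of every order $\ge 1$, that $H$ is bounded, and that $U(x)\to-\infty$ as $|x|\to\infty$. For $N\ge1$ let $\pi_N$ be the probability measure on $\mathbb R^N$ with Lebesgue density (also denoted $\pi_N$) $$\pi_N(x)\propto\exp\Big(\sum_{i=1}^N U(x_i)-\frac1{2N}\sum_{i,j=1}^N H(x_i)H(x_j)\Big).$$ For $\sigma>0$ and $x,w\in\mathbb R^N$ define the Langevin proposal $Y_\sigma(x,w)\in\mathbb R^N$ by $$Y_{\sigma,i}(x,w)=x_i+\sigma w_i+\frac{\sigma^2}{2}\Big(U'(x_i)-H'(x_i)\frac1N\sum_{j=1}^N H(x_j)\Big),$$ let $q_N(x,\cdot)$ be the Lebesgue density of $Y_\sigma(x,W)$, where $W$ is a standard Gaussian vector on $\mathbb R^N$, and let $$G_{\sigma,N}(x,w)=\log\frac{\pi_N(Y_\sigma(x,w))\,q_N(Y_\sigma(x,w),x)}{\pi_N(x)\,q_N(x,Y_\sigma(x,w))}$$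 be the log-acceptance ratio. **Proposition 2 (CLT for the acceptance ratio).** There is a unique probability measure $\pi$ on $\mathbb R$ whose Lebesgue density is proportional to $e^{\psi}$, where $\psi=U-H\int H\,d\pi$. With $X\sim\pi$ and $\pi(f(X))=\int f\,d\pi$, the constant $\tau\ge0$ defined by $$\begin{aligned}\tau^2=\tfrac1{144}\Big\{&9\pi(\psi''^2\psi'^2(X))+18\pi(\psi'\psi''\psi'''(X))+15\pi(\psi'''^2(X))\\&-18\,\pi\big((H''+H'\psi')(X)\big)\,\pi\big(H'(\psi'''+\psi'\psi'')(X)\big)\\&+9\,\pi(H'^2(X))\big(\pi(H''(X))+\pi(H'\psi'(X))\big)^2\Big\}\end{aligned}$$ is well defined and strictly positive. For every $\ell>0$, with $\sigma_N=\ell N^{-1/6}$, there exist measurable sets $F_N\subset\mathbb R^N$ such that $\pi_N(F_N^c)=o(N^{-t})$ for every $t>0$ and such that, with $$\Delta_N=\sup_{x\in F_N}\sup_{u\in\mathbb R}\left|\mathbb P\left(\frac{G_{\sigma_N,N}(x,W)}{\ell^3\tau}+\frac{\ell^3\tau}{2}\le u\right)-\Phi(u)\right|,$$ where $W$ is a standard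 Gaussian vector on $\mathbb R^N$ and $\Phi$ is the standard normal distribution function, one has $$\lim_{N\to\infty}N^\beta\Delta_N=0\quad\text{for every }0<\beta<\tfrac19,\qquad\text{and moreover}\qquad \Delta_N=O(N^{-1/9}).$$ -/

import Mathlib

open MeasureTheory ProbabilityTheory Filter Topology
open scoped ContDiff

noncomputable section

namespace MALA

/-- The regularity assumption on `H` and `U`: all derivatives of order at least one exist and are
bounded, `H` itself is bounded, and `U x → -∞` as `|x| → ∞`. -/
structure HP (H U : ℝ → ℝ) : Prop where
  smooth_H : ContDiff ℝ ∞ H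
  smooth_U : ContDiff ℝ ∞ U
  deriv_H_bdd : ∀ k : ℕ, 1 ≤ k → ∃ C : ℝ, ∀ x, |iteratedDeriv k H x| ≤ C
  deriv_U_bdd : ∀ k : ℕ, 1 ≤ k → ∃ C : ℝ, ∀ x, |iteratedDeriv k U x| ≤ C
  H_bdd : ∃ C : ℝ, ∀ x, |H x| ≤ C
  U_tendsto : Tendsto U (cocompact ℝ) atBot

/-- `U = y H + log (dμ/dx)`, where `p` is the Lebesgue density of the prior `μ`. -/
def potential (y : ℝ) (H p : ℝ → ℝ) (x : ℝ) : ℝ := y * H x + Real.log (p x)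

/-- The unnormalized log-density of the posterior `π_N`. -/
def logWeight (H U : ℝ → ℝ) (N : ℕ) (x : Fin N → ℝ) : ℝ :=
  ∑ i, U (x i) - 1 / (2 * (N : ℝ)) * ∑ i, ∑ j, H (x i) * H (x j)

/-- The normalized Lebesgue density of `π_N` on `ℝ^N`. -/
def postDensity (H U : ℝ → ℝ) (N : ℕ) (x : Fin N → ℝ) : ℝ :=
  Real.exp (logWeight H U N x) / ∫ z : Fin N → ℝ, Real.exp (logWeight H U N z)

/-- The posterior distribution `π_N` on `ℝ^N`. -/
def post (H U : ℝ → ℝ) (N : ℕ) : Measure (Fin N → ℝ) :=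
  (volume : Measure (Fin N → ℝ)).withDensity fun x => ENNReal.ofReal (postDensity H U N x)

/-- The `i`-th component of `∇ log π_N (x)`. -/
def drift (H U : ℝ → ℝ) (N : ℕ) (x : Fin N → ℝ) (i : Fin N) : ℝ :=
  deriv U (x i) - deriv H (x i) * (1 / (N : ℝ) * ∑ j, H (x j))

/-- The Langevin proposal `Y_σ(x, w)`. -/
def proposal (H U : ℝ → ℝ) (N : ℕ) (σ : ℝ) (x w : Fin N → ℝ) : Fin N → ℝ :=
  fun i => x i + σ * w i + σ ^ 2 / 2 * drift H U N x i

/-- The transition density `q_N(x, y)` of the proposal: the density at `y` of the Gaussian law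
with mean `x + (σ² / 2) ∇ log π_N (x)` and covariance matrix `σ² I`. -/
def proposalDensity (H U : ℝ → ℝ) (N : ℕ) (σ : ℝ) (x y : Fin N → ℝ) : ℝ :=
  ∏ i, gaussianPDFReal (x i + σ ^ 2 / 2 * drift H U N x i) (Real.toNNReal (σ ^ 2)) (y i)

/-- The log-acceptance ratio `G_{σ,N}(x, w)`. -/
def logAccept (H U : ℝ → ℝ) (N : ℕ) (σ : ℝ) (x w : Fin N → ℝ) : ℝ :=
  Real.log
    ((postDensity H U N (proposal H U N σ x w) *
        proposalDensity H U N σ (proposal H U N σ x w) x) /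
      (postDensity H U N x * proposalDensity H U N σ x (proposal H U N σ x w)))

/-- The law of a vector of `N` i.i.d. standard normal variables. -/
def stdGaussian (N : ℕ) : Measure (Fin N → ℝ) :=
  Measure.pi fun _ => gaussianReal 0 1

/-- `ψ = U - H ∫ H dπ`. -/
def psi (H U : ℝ → ℝ) (π : Measure ℝ) (x : ℝ) : ℝ := U x - H x * ∫ z, H z ∂π

/-- `π` is the one-particle limit law: a probability measure whose Lebesgue density is
proportional to `exp ψ`, where `ψ = U - H ∫ H dπ` depends on `π` itself. -/
def IsLimitLaw (H U : ℝ → ℝ) (π : Measure ℝ) : Prop :=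
  IsProbabilityMeasure π ∧ ∃ c : ℝ, 0 < c ∧
    π = (volume : Measure ℝ).withDensity fun x => ENNReal.ofReal (c * Real.exp (psi H U π x))

/-- The constant `τ²`. -/
def tauSq (H U : ℝ → ℝ) (π : Measure ℝ) : ℝ :=
  let ψ := psi H U π
  let ψ₁ := iteratedDeriv 1 ψ
  let ψ₂ := iteratedDeriv 2 ψ
  let ψ₃ := iteratedDeriv 3 ψ
  let H₁ := iteratedDeriv 1 H
  let H₂ := iteratedDeriv 2 H
  1 / 144 *
    (9 * (∫ x, ψ₂ x ^ 2 * ψ₁ x ^ 2 ∂π) + 18 * (∫ x, ψ₁ x * ψ₂ x * ψ₃ x ∂π)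
      + 15 * (∫ x, ψ₃ x ^ 2 ∂π)
      - 18 * (∫ x, (H₂ x + H₁ x * ψ₁ x) ∂π) * (∫ x, H₁ x * (ψ₃ x + ψ₁ x * ψ₂ x) ∂π)
      + 9 * (∫ x, H₁ x ^ 2 ∂π) * ((∫ x, H₂ x ∂π) + ∫ x, H₁ x * ψ₁ x ∂π) ^ 2)

/-- The constant `τ`. -/
def tau (H U : ℝ → ℝ) (π : Measure ℝ) : ℝ := Real.sqrt (tauSq H U π)

/-- The scaling `σ_N = ℓ / N^{1/6}`. -/
def sigmaN (ℓ : ℝ) (N : ℕ) : ℝ := ℓ / (N : ℝ) ^ ((1 : ℝ) / 6)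

/-- The Kolmogorov distance between the law of `G_{σ_N,N}(x, W) / (ℓ³ τ) + ℓ³ τ / 2`, for a
standard Gaussian vector `W` on `ℝ^N`, and the standard normal law. -/
def kolmDist (H U : ℝ → ℝ) (τ ℓ : ℝ) (N : ℕ) (x : Fin N → ℝ) : ℝ :=
  ⨆ u : ℝ, |(stdGaussian N).real
      {w | logAccept H U N (sigmaN ℓ N) x w / (ℓ ^ 3 * τ) + ℓ ^ 3 * τ / 2 ≤ u}
    - cdf (gaussianReal 0 1) u|

end MALA

end

namespace MALA

/-! ### Taylor expansion along a chain of derivatives -/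

/-! The proof reduces the interacting chain to a product of one-dimensional ones. Completing the
square around `m = ∫ H dπ` writes `π_N` as the product law `π^{⊗N}` tilted by `exp(-(N/2)(mean of H
- m)²)` and renormalised. The tilt is at most 1 and its integral is bounded below uniformly in `N`,
so an event rare under the product law is rare under `π_N` (`exists_post_le_pi`). The law `π` itself
is a scalar fixed point: an intermediate value argument finds `m`, and the symmetrised relative
entropy of two solutions forces their means to agree.

An exact identity (`logAccept_eq_ratio_add_interaction`) splits the log-acceptance ratio into a sum
of one-dimensional ratios for the target `e^ψ` and an interaction term. A one-dimensional ratio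
equals `-σ³ lead + O(σ⁴)`, where `lead` is a centred polynomial in the Gaussian noise with variance
`varTerm`. As `N σ⁶ = ℓ⁶`, the sum of the leading terms has variance close to `ℓ⁶ ∫ varTerm dπ`, and
Lindeberg replacement gives its normal limit (`exists_kolmogorov_bound`). Integration by parts gives
`∫ (H'' + H'ψ') dπ = 0`, which removes the `H` terms from `τ²` and leaves `∫ varTerm dπ`. This is an
integral of a sum of squares; were it zero, `ψ'''` would vanish, so `ψ`, having bounded derivative,
would be affine and could not tend to `-∞` at both ends.

The mean would need an expansion to order `σ⁶` if computed directly. Reversibility avoids this: for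
the one-dimensional ratio `g`, detailed balance and antisymmetry give `E[g e^g] = -E[g]` in
stationarity, and `g e^g = g + g² + O(|g|³ e^{|g|})` then yields `E[g] = -E[g²]/2 + O(σ⁹)`, that is,
`-σ⁶τ²/2 + O(σ⁷)` (`exists_mean_bound`).

All errors are powers of `n = N^{1/36}`, so `σ` has order `n⁻⁶` and the target `N^{-1/9}` is `n⁻⁴`.
Configurations are restricted to those where four empirical sums lie within `n¹⁹ = √N · n` of their
means; by Hoeffding's inequality the exceptional set has probability of order `exp(-c n²)`. On this
set `exists_remainder_bound` makes the interaction and the Taylor remainders at most `C n⁻⁴` off an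
event of probability at most `C n⁻⁴`, by fourth moment Markov inequalities, and `exists_cdf_bound`
combines this with the limit theorem. -/

theorem abs_taylor_remainder_le {n : ℕ} : ∀ {F : ℕ → ℝ → ℝ}
    (_ : ∀ k x, HasDerivAt (F k) (F (k + 1) x) x) {B : ℝ} (_ : ∀ x, |F n x| ≤ B) (x δ : ℝ),
    |F 0 (x + δ) - ∑ j ∈ Finset.range n, F j x * δ ^ j / (j.factorial : ℝ)| ≤ B * |δ| ^ n := by
  induction n with
  | zero => intro F _ B hB x δ; simpa using hB (x + δ)
  | succ n ih =>
    intro F hF B hB x δ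
    have hB0 : 0 ≤ B := (abs_nonneg _).trans (hB 0)
    -- The derivative in the increment of the remainder of order `n + 1` is the remainder of order
    -- `n` for the shifted chain. The mean value inequality then gains one factor `|δ|`; the
    -- factorial is given up.
    have ih' := ih (F := fun k => F (k + 1)) (fun k x => hF (k + 1) x) hB x
    set r : ℝ → ℝ := fun t => F 0 (x + t) -
      ∑ j ∈ Finset.range (n + 1), F j x * t ^ j / (j.factorial : ℝ) with hr
    set r' : ℝ → ℝ := fun t => F 1 (x + t) -
      ∑ j ∈ Finset.range n, F (j + 1) x * t ^ j / (j.factorial : ℝ) with hr'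
    have hd : ∀ t, HasDerivAt r (r' t) t := by
      intro t
      have h1 : HasDerivAt (fun t => F 0 (x + t)) (F 1 (x + t)) t := by
        simpa using (hF 0 (x + t)).comp_const_add x t
      refine h1.sub ?_
      have h2 : ∀ j ∈ Finset.range (n + 1),
          HasDerivAt (fun t : ℝ => F j x * t ^ j / (j.factorial : ℝ))
            (F j x * ((j : ℝ) * t ^ (j - 1)) / (j.factorial : ℝ)) t := by
        intro j _
        exact ((hasDerivAt_pow j t).const_mul (F j x)).div_const _
      have h3 := HasDerivAt.fun_sum h2
      refine h3.congr_deriv ?_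
      rw [Finset.sum_range_succ']
      simp only [Nat.cast_zero, zero_mul, mul_zero, zero_div, add_zero, Nat.add_sub_cancel]
      refine Finset.sum_congr rfl fun j _ => ?_
      rw [Nat.factorial_succ]
      push_cast
      have : (j.factorial : ℝ) ≠ 0 := by positivity
      field_simp
    have hbound : ∀ t ∈ Metric.closedBall (0 : ℝ) |δ|, ‖r' t‖ ≤ B * |δ| ^ n := by
      intro t ht
      have ht' : |t| ≤ |δ| := by simpa [Real.norm_eq_abs] using ht
      refine (ih' t).trans ?_
      gcongr
    have h := (convex_closedBall (0 : ℝ) |δ|).norm_image_sub_le_of_norm_hasDerivWithin_le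
      (fun t _ => (hd t).hasDerivWithinAt) hbound (x := 0) (y := δ) (by simp) (by simp)
    have hr0 : r 0 = 0 := by
      simp [hr, Finset.sum_range_succ']
    rw [hr0] at h
    simp only [sub_zero, Real.norm_eq_abs] at h
    rw [pow_succ, ← mul_assoc]
    exact h

/-! ### Moments of the standard normal law -/

theorem one_add_abs_pow_le_exp (k : ℕ) (w : ℝ) :
    (1 + |w|) ^ k ≤ (k.factorial : ℝ) * Real.exp (1 + |w|) := by
  have h := Real.pow_div_factorial_le_exp (x := 1 + |w|) (by positivity) k
  rw [div_le_iff₀ (by positivity)] at h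
  linarith

/-- Exponential weights enter because the reversibility argument integrates the exponential of the
log-acceptance ratio against the Gaussian. -/
theorem integrable_pow_mul_exp_gaussian (k : ℕ) (c : ℝ) :
    Integrable (fun w : ℝ => (1 + |w|) ^ k * Real.exp (c * |w|)) (gaussianReal 0 1) := by
  have h1 := integrable_exp_mul_gaussianReal (μ := 0) (v := 1) (c + 1)
  have h2 := integrable_exp_mul_gaussianReal (μ := 0) (v := 1) (-(c + 1))
  refine ((h1.add h2).const_mul ((k.factorial : ℝ) * Real.exp 1)).mono'
    (Continuous.aestronglyMeasurable (by fun_prop)) (ae_of_all _ fun w => ?_)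
  rw [Real.norm_eq_abs, abs_of_nonneg (by positivity)]
  have h3 : Real.exp ((c + 1) * |w|) ≤ Real.exp ((c + 1) * w) + Real.exp (-(c + 1) * w) := by
    rcases abs_cases w with ⟨h, _⟩ | ⟨h, _⟩ <;> rw [h]
    · linarith [Real.exp_pos (-(c + 1) * w)]
    · have : (c + 1) * -w = -(c + 1) * w := by ring
      rw [this]
      linarith [Real.exp_pos ((c + 1) * w)]
  calc (1 + |w|) ^ k * Real.exp (c * |w|)
      ≤ (k.factorial : ℝ) * Real.exp (1 + |w|) * Real.exp (c * |w|) := by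
        gcongr; exact one_add_abs_pow_le_exp k w
    _ = (k.factorial : ℝ) * Real.exp 1 * Real.exp ((c + 1) * |w|) := by
        rw [mul_assoc, mul_assoc, ← Real.exp_add, ← Real.exp_add]; ring_nf
    _ ≤ _ := by
        simp only [Pi.add_apply]
        gcongr

theorem integrable_one_add_abs_pow_gaussian (k : ℕ) :
    Integrable (fun w : ℝ => (1 + |w|) ^ k) (gaussianReal 0 1) := by
  simpa using integrable_pow_mul_exp_gaussian k 0

theorem integrable_pow_gaussian (k : ℕ) :
    Integrable (fun w : ℝ => w ^ k) (gaussianReal 0 1) := by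
  refine (integrable_one_add_abs_pow_gaussian k).mono'
    (Continuous.aestronglyMeasurable (by fun_prop)) (ae_of_all _ fun w => ?_)
  rw [norm_pow, Real.norm_eq_abs]
  gcongr
  linarith

theorem integrable_gaussian_iff {f : ℝ → ℝ} :
    Integrable f (gaussianReal 0 1) ↔ Integrable (fun x => gaussianPDFReal 0 1 x * f x) := by
  rw [gaussianReal_of_var_ne_zero _ one_ne_zero,
    integrable_withDensity_iff_integrable_smul' (measurable_gaussianPDF _ _)
      (ae_of_all _ fun _ => gaussianPDF_lt_top)]
  simp [toReal_gaussianPDF]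

/-- Integration by parts: the derivative of the density times `x ^ (k + 1)` has integral zero. -/
theorem integral_pow_add_two_gaussian (k : ℕ) :
    ∫ w, w ^ (k + 2) ∂(gaussianReal 0 1) = (k + 1 : ℝ) * ∫ w, w ^ k ∂(gaussianReal 0 1) := by
  have hI : ∀ j : ℕ, Integrable (fun x : ℝ => gaussianPDFReal 0 1 x * x ^ j) := fun j =>
    integrable_gaussian_iff.1 (integrable_pow_gaussian j)
  have hd : ∀ x : ℝ, HasDerivAt (fun x : ℝ => gaussianPDFReal 0 1 x * x ^ (k + 1))
      ((k + 1 : ℝ) * (gaussianPDFReal 0 1 x * x ^ k) - gaussianPDFReal 0 1 x * x ^ (k + 2)) x := by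
    intro x
    have h1 : HasDerivAt (gaussianPDFReal 0 1) (-x * gaussianPDFReal 0 1 x) x := by
      rw [gaussianPDFReal_def]
      have h : HasDerivAt (fun x : ℝ => -(x - 0) ^ 2 / (2 * ((1 : NNReal) : ℝ))) (-x) x := by
        have := (((hasDerivAt_id x).sub_const 0).pow 2).neg.div_const (2 * ((1 : NNReal) : ℝ))
        refine this.congr_deriv ?_
        simp; ring
      refine (h.exp.const_mul _).congr_deriv ?_
      ring
    refine (h1.mul (hasDerivAt_pow (k + 1) x)).congr_deriv ?_
    push_cast
    ring
  have h0 := integral_eq_zero_of_hasDerivAt_of_integrable hd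
    (((hI k).const_mul _).sub (hI (k + 2))) (hI (k + 1))
  rw [integral_sub ((hI k).const_mul _) (hI (k + 2)), integral_const_mul] at h0
  simp only [integral_gaussianReal_eq_integral_smul (one_ne_zero), smul_eq_mul]
  linarith

theorem integral_pow_one_gaussian : ∫ w : ℝ, w ∂(gaussianReal 0 1) = 0 := by simp

theorem integral_pow_two_gaussian : ∫ w : ℝ, w ^ 2 ∂(gaussianReal 0 1) = 1 := by
  have := integral_pow_add_two_gaussian 0
  simpa using this

theorem integral_pow_three_gaussian : ∫ w : ℝ, w ^ 3 ∂(gaussianReal 0 1) = 0 := by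
  have := integral_pow_add_two_gaussian 1
  simpa using this

theorem integral_pow_four_gaussian : ∫ w : ℝ, w ^ 4 ∂(gaussianReal 0 1) = 3 := by
  have := integral_pow_add_two_gaussian 2
  rw [integral_pow_two_gaussian] at this
  rw [this]; norm_num

theorem integral_pow_six_gaussian : ∫ w : ℝ, w ^ 6 ∂(gaussianReal 0 1) = 15 := by
  have := integral_pow_add_two_gaussian 4
  rw [integral_pow_four_gaussian] at this
  rw [this]; norm_num

/-! ### Fourth moments of sums of independent variables -/

section FourthMoment

variable {Ω ι : Type*} {mΩ : MeasurableSpace Ω} {μ : Measure Ω} [IsProbabilityMeasure μ]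

theorem MemLp.integrable_pow_le_four {f : Ω → ℝ} (hf : MemLp f 4 μ) {k : ℕ} (hk : k ≤ 4) :
    Integrable (fun a => f a ^ k) μ := by
  have h1 : MemLp f (k : ENNReal) μ := hf.mono_exponent (by exact_mod_cast hk)
  have h2 := h1.integrable_norm_pow'
  refine h2.mono' (hf.1.pow k) (ae_of_all _ fun a => ?_)
  simp

theorem indepFun_pow_mul_integral {X Y : Ω → ℝ} (h : IndepFun X Y μ) (hX : MemLp X 4 μ)
    (hY : MemLp Y 4 μ) {j k : ℕ} (hj : j ≤ 4) (hk : k ≤ 4) :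
    Integrable (fun a => X a ^ j * Y a ^ k) μ ∧
      ∫ a, X a ^ j * Y a ^ k ∂μ = (∫ a, X a ^ j ∂μ) * ∫ a, Y a ^ k ∂μ := by
  have h' : IndepFun (fun a => X a ^ j) (fun a => Y a ^ k) μ :=
    h.comp (φ := fun x => x ^ j) (ψ := fun x => x ^ k) (by fun_prop) (by fun_prop)
  have hXj := MemLp.integrable_pow_le_four hX hj
  have hYk := MemLp.integrable_pow_le_four hY hk
  exact ⟨h'.integrable_mul hXj hYk, h'.integral_fun_mul_eq_mul_integral hXj.1 hYk.1⟩

/-- When one variable is added, every cross term with a first power vanishes by independence and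
centring, and only `6 E[S²] E[X²]` survives. The fourth moment bound then closes since `3k² + 6k + 1
≤ 3(k + 1)²`. Fourth moments are needed later: at deviation `√N · n`, Chebyshev would give only
`n⁻²` instead of `n⁻⁴`. -/
theorem moments_sum_le {X : ι → Ω → ℝ} (hind : iIndepFun X μ) (hm : ∀ i, Measurable (X i))
    (hL : ∀ i, MemLp (X i) 4 μ) (h0 : ∀ i, ∫ a, X i a ∂μ = 0) {A : ℝ} (hA : 0 ≤ A)
    (h2 : ∀ i, ∫ a, X i a ^ 2 ∂μ ≤ A) (h4 : ∀ i, ∫ a, X i a ^ 4 ∂μ ≤ A ^ 2) (s : Finset ι) :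
    ∫ a, (∑ i ∈ s, X i a) ∂μ = 0 ∧ ∫ a, (∑ i ∈ s, X i a) ^ 2 ∂μ ≤ s.card * A ∧
      ∫ a, (∑ i ∈ s, X i a) ^ 4 ∂μ ≤ 3 * (s.card : ℝ) ^ 2 * A ^ 2 := by
  classical
  induction s using Finset.induction_on with
  | empty => simp
  | insert i s hi ih =>
    obtain ⟨ih0, ih2, ih4⟩ := ih
    have hSL : MemLp (fun a => ∑ j ∈ s, X j a) 4 μ := memLp_finsetSum s fun j _ => hL j
    have hIn : IndepFun (fun a => ∑ j ∈ s, X j a) (X i) μ := by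
      have := hind.indepFun_finsetSum_of_notMem hm hi
      convert this using 1
      ext a; simp
    have hp := fun {j k : ℕ} (hj : j ≤ 4) (hk : k ≤ 4) =>
      indepFun_pow_mul_integral hIn hSL (hL i) hj hk
    have hS1 := MemLp.integrable_pow_le_four hSL (k := 1) (by norm_num)
    have hX1 := MemLp.integrable_pow_le_four (hL i) (k := 1) (by norm_num)
    have hS2 := MemLp.integrable_pow_le_four hSL (k := 2) (by norm_num)
    have hX2 := MemLp.integrable_pow_le_four (hL i) (k := 2) (by norm_num)
    have hS4 := MemLp.integrable_pow_le_four hSL (k := 4) (by norm_num)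
    have hX4 := MemLp.integrable_pow_le_four (hL i) (k := 4) (by norm_num)
    have hX2n : 0 ≤ ∫ a, X i a ^ 2 ∂μ := integral_nonneg fun a => by positivity
    have hS2n : 0 ≤ ∫ a, (∑ j ∈ s, X j a) ^ 2 ∂μ := integral_nonneg fun a => by positivity
    simp only [pow_one] at hS1 hX1
    obtain ⟨i11, e11⟩ := hp (j := 1) (k := 1) (by norm_num) (by norm_num)
    obtain ⟨i31, e31⟩ := hp (j := 3) (k := 1) (by norm_num) (by norm_num)
    obtain ⟨i22, e22⟩ := hp (j := 2) (k := 2) (by norm_num) (by norm_num)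
    obtain ⟨i13, e13⟩ := hp (j := 1) (k := 3) (by norm_num) (by norm_num)
    simp only [pow_one, h0 i, ih0, zero_mul, mul_zero] at i11 e11 i31 e31 i13 e13
    simp only [Finset.sum_insert hi, Finset.card_insert_of_notMem hi, Nat.cast_add, Nat.cast_one]
    refine ⟨?_, ?_, ?_⟩
    · rw [integral_add hX1 hS1, h0, ih0, add_zero]
    · have : ∀ a, (X i a + ∑ j ∈ s, X j a) ^ 2 = X i a ^ 2 + (2 * ((∑ j ∈ s, X j a) * X i a)
          + (∑ j ∈ s, X j a) ^ 2) := fun a => by ring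
      simp_rw [this]
      rw [integral_add hX2 ((i11.const_mul 2).fun_add hS2), integral_add (i11.const_mul 2) hS2,
        integral_const_mul, e11]
      have := h2 i
      linarith
    · have : ∀ a, (X i a + ∑ j ∈ s, X j a) ^ 4 = X i a ^ 4 + (4 * ((∑ j ∈ s, X j a) * X i a ^ 3)
          + (6 * ((∑ j ∈ s, X j a) ^ 2 * X i a ^ 2) + (4 * ((∑ j ∈ s, X j a) ^ 3 * X i a)
          + (∑ j ∈ s, X j a) ^ 4))) := fun a => by ring
      simp_rw [this]
      rw [integral_add hX4 ((i13.const_mul 4).fun_add ((i22.const_mul 6).fun_add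
          ((i31.const_mul 4).fun_add hS4))),
        integral_add (i13.const_mul 4) ((i22.const_mul 6).fun_add ((i31.const_mul 4).fun_add hS4)),
        integral_add (i22.const_mul 6) ((i31.const_mul 4).fun_add hS4),
        integral_add (i31.const_mul 4) hS4]
      simp only [integral_const_mul]
      rw [e13, e22, e31]
      have hc : (0 : ℝ) ≤ s.card := by positivity
      have := mul_le_mul ih2 (h2 i) hX2n (by positivity)
      nlinarith [h4 i, h2 i, sq_nonneg A]

end FourthMoment

/-! ### Polynomial weights and fourth moment deviation bounds. -/

/-- The polynomial weight that dominates all the increments of the proposal. -/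
noncomputable def wt (w : ℝ) : ℝ := (1 + |w|) ^ 4

theorem one_le_wt (w : ℝ) : 1 ≤ wt w := one_le_pow₀ (by linarith [abs_nonneg w])

theorem one_add_abs_pow_le_wt {k : ℕ} (hk : k ≤ 4) (w : ℝ) : (1 + |w|) ^ k ≤ wt w :=
  pow_le_pow_right₀ (by linarith [abs_nonneg w]) hk

theorem integrable_wt_pow (k : ℕ) : Integrable (fun w => wt w ^ k) (gaussianReal 0 1) := by
  simp only [wt, ← pow_mul]
  exact integrable_one_add_abs_pow_gaussian _

theorem integrable_wt : Integrable wt (gaussianReal 0 1) := by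
  simpa using integrable_wt_pow 1

theorem continuous_wt : Continuous wt := by unfold wt; fun_prop

theorem memLp_of_abs_le_wt {f : ℝ → ℝ} (hf : Measurable f) {c : ℝ} (h : ∀ w, |f w| ≤ c * wt w) :
    MemLp f 4 (gaussianReal 0 1) := by
  have h1 : MemLp wt 4 (gaussianReal 0 1) := by
    rw [← memLp_norm_rpow_iff (q := 4) continuous_wt.aestronglyMeasurable (by norm_num)
      (by norm_num), ENNReal.div_self (by norm_num) (by norm_num), memLp_one_iff_integrable]
    convert integrable_wt_pow 4 using 2 with w
    rw [Real.norm_eq_abs, abs_of_nonneg (zero_le_one.trans (one_le_wt w))]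
    norm_cast
  refine (h1.const_mul c).mono' hf.aestronglyMeasurable (ae_of_all _ fun w => h w)

/-- Deviations of sums of independent functions of standard normal variables. -/
theorem exists_deviation_bound : ∃ K : ℝ, 0 < K ∧ ∀ (N : ℕ) (f : Fin N → ℝ → ℝ) (a : Fin N → ℝ)
    (c t : ℝ), (∀ i, Measurable (f i)) → 0 ≤ c → (∀ i w, |f i w - a i| ≤ c * wt w) → 0 < t →
    (stdGaussian N).real {w | t < |∑ i, f i (w i) - ∑ i, ∫ z, f i z ∂(gaussianReal 0 1)|} ≤
      K * ((N : ℝ) ^ 2 * c ^ 4) / t ^ 4 := by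
  set m : ℝ := ∫ z, wt z ∂(gaussianReal 0 1) with hm
  have hm1 : 1 ≤ m := by
    have : ∫ z : ℝ, (1 : ℝ) ∂(gaussianReal 0 1) ≤ m :=
      integral_mono (integrable_const _) integrable_wt one_le_wt
    simpa using this
  have hw2 : Integrable (fun w => (2 * m * wt w) ^ 2) (gaussianReal 0 1) := by
    simp only [mul_pow]; exact (integrable_wt_pow 2).const_mul _
  have hw4 : Integrable (fun w => (2 * m * wt w) ^ 4) (gaussianReal 0 1) := by
    simp only [mul_pow]; exact (integrable_wt_pow 4).const_mul _
  set A2 : ℝ := ∫ w, (2 * m * wt w) ^ 2 ∂(gaussianReal 0 1) with hA2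
  set A4 : ℝ := ∫ w, (2 * m * wt w) ^ 4 ∂(gaussianReal 0 1) with hA4
  have hA2n : 0 ≤ A2 := integral_nonneg fun _ => by positivity
  have hA4n : 0 ≤ A4 := integral_nonneg fun _ => by positivity
  -- The summand 1 ensures `A4 ≤ A ^ 2`, so that one constant controls both the second and the
  -- fourth moments.
  set A := 1 + A2 + A4 with hA
  have hA4A : A4 ≤ A ^ 2 := by nlinarith
  refine ⟨3 * A ^ 2, by positivity, ?_⟩
  intro N f a c t hf hc hfa ht
  have hfi : ∀ i, Integrable (f i) (gaussianReal 0 1) := by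
    intro i
    refine ((integrable_wt.const_mul c).add (integrable_const |a i|)).mono'
      (hf i).aestronglyMeasurable (ae_of_all _ fun w => ?_)
    have h1 := hfa i w
    have h2 : |f i w| ≤ |f i w - a i| + |a i| := by
      simpa using abs_add_le (f i w - a i) (a i)
    simp only [Pi.add_apply, Real.norm_eq_abs]; linarith
  set g : Fin N → ℝ → ℝ := fun i w => f i w - ∫ z, f i z ∂(gaussianReal 0 1) with hg
  have hgm : ∀ i, Measurable (g i) := fun i => (hf i).sub_const _
  -- Passing from the arbitrary centre `a i` to the mean costs at most `c * m`, which is absorbed in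
  -- the weight because `m` and `wt` are at least 1.
  have hgb : ∀ i w, |g i w| ≤ c * (2 * m * wt w) := by
    intro i w
    have h1 : |(∫ z, f i z ∂(gaussianReal 0 1)) - a i| ≤ c * m := by
      have h2 : (∫ z, f i z ∂(gaussianReal 0 1)) - a i
          = ∫ z, (f i z - a i) ∂(gaussianReal 0 1) := by
        rw [integral_sub (hfi i) (integrable_const _)]; simp
      rw [h2, hm, ← integral_const_mul, ← Real.norm_eq_abs]
      exact norm_integral_le_of_norm_le (integrable_wt.const_mul c) (ae_of_all _ fun w => hfa i w)
    have h3 : g i w = (f i w - a i) - ((∫ z, f i z ∂(gaussianReal 0 1)) - a i) := by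
      simp only [hg]; ring
    have h4 := abs_sub (f i w - a i) ((∫ z, f i z ∂(gaussianReal 0 1)) - a i)
    rw [h3]
    have h5 := hfa i w
    have h6 : c * m ≤ c * (m * wt w) := by
      gcongr; nlinarith [one_le_wt w]
    have h7 : c * wt w ≤ c * (m * wt w) := by
      gcongr; nlinarith [one_le_wt w]
    nlinarith
  have hgint : ∀ i, ∫ w, g i w ∂(gaussianReal 0 1) = 0 := by
    intro i
    simp only [hg]
    rw [integral_sub (hfi i) (integrable_const _)]; simp
  have hgL : ∀ i, MemLp (g i) 4 (gaussianReal 0 1) := fun i =>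
    memLp_of_abs_le_wt (hgm i) (c := c * (2 * m)) (fun w => by simpa [mul_assoc] using hgb i w)
  have hg2 : ∀ i, ∫ w, g i w ^ 2 ∂(gaussianReal 0 1) ≤ c ^ 2 * A := by
    intro i
    calc ∫ w, g i w ^ 2 ∂(gaussianReal 0 1)
        ≤ ∫ w, c ^ 2 * (2 * m * wt w) ^ 2 ∂(gaussianReal 0 1) := by
          refine integral_mono (MemLp.integrable_pow_le_four (hgL i) (by norm_num))
            (hw2.const_mul _) fun w => ?_
          simp only
          rw [← mul_pow, ← sq_abs]
          gcongr
          exact hgb i w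
      _ = c ^ 2 * A2 := integral_const_mul _ _
      _ ≤ c ^ 2 * A := by gcongr; linarith
  have hg4 : ∀ i, ∫ w, g i w ^ 4 ∂(gaussianReal 0 1) ≤ (c ^ 2 * A) ^ 2 := by
    intro i
    calc ∫ w, g i w ^ 4 ∂(gaussianReal 0 1)
        ≤ ∫ w, c ^ 4 * (2 * m * wt w) ^ 4 ∂(gaussianReal 0 1) := by
          refine integral_mono (MemLp.integrable_pow_le_four (hgL i) le_rfl)
            (hw4.const_mul _) fun w => ?_
          simp only
          rw [← mul_pow, ← (show Even 4 by decide).pow_abs (g i w)]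
          gcongr
          exact hgb i w
      _ = c ^ 4 * A4 := integral_const_mul _ _
      _ ≤ c ^ 4 * A ^ 2 := by gcongr
      _ = _ := by ring
  have hmp : ∀ i : Fin N, MeasurePreserving (Function.eval i) (stdGaussian N) (gaussianReal 0 1) :=
    fun i => measurePreserving_eval _ i
  have : IsProbabilityMeasure (stdGaussian N) := by unfold stdGaussian; infer_instance
  have hev : ∀ (i : Fin N) (h : ℝ → ℝ), Measurable h →
      ∫ w, h (w i) ∂(stdGaussian N) = ∫ z, h z ∂(gaussianReal 0 1) := by
    intro i h hh
    rw [← (hmp i).map_eq, integral_map (hmp i).measurable.aemeasurable hh.aestronglyMeasurable]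
  have hL : ∀ i, MemLp (fun w : Fin N → ℝ => g i (w i)) 4 (stdGaussian N) := fun i =>
    (hgL i).comp_measurePreserving (hmp i)
  have hind : iIndepFun (fun (i : Fin N) (w : Fin N → ℝ) => g i (w i)) (stdGaussian N) :=
    iIndepFun_pi fun i => (hgm i).aemeasurable
  obtain ⟨_, _, h4⟩ := moments_sum_le hind (fun i => (hgm i).comp (measurable_pi_apply i)) hL
    (fun i => by rw [hev i _ (hgm i), hgint]) (A := c ^ 2 * A) (by positivity)
    (fun i => by rw [hev i (fun z => g i z ^ 2) ((hgm i).pow_const 2)]; exact hg2 i)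
    (fun i => by rw [hev i (fun z => g i z ^ 4) ((hgm i).pow_const 4)]; exact hg4 i)
    Finset.univ
  have hSL : MemLp (fun w : Fin N → ℝ => ∑ i, g i (w i)) 4 (stdGaussian N) :=
    memLp_finsetSum _ fun i _ => hL i
  have hmk := mul_meas_ge_le_integral_of_nonneg (μ := stdGaussian N)
    (f := fun w : Fin N → ℝ => (∑ i, g i (w i)) ^ 4) (ae_of_all _ fun w => by positivity)
    (MemLp.integrable_pow_le_four hSL le_rfl) (t ^ 4)
  have hsub : {w : Fin N → ℝ | t < |∑ i, f i (w i) - ∑ i, ∫ z, f i z ∂(gaussianReal 0 1)|}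
      ⊆ {w | t ^ 4 ≤ (∑ i, g i (w i)) ^ 4} := by
    intro w hw
    simp only [Set.mem_ofPred_eq] at hw ⊢
    rw [← Finset.sum_sub_distrib] at hw
    rw [← (show Even 4 by decide).pow_abs (∑ i, g i (w i))]
    gcongr
  rw [le_div_iff₀ (by positivity), mul_comm]
  calc _ ≤ t ^ 4 * (stdGaussian N).real {w | t ^ 4 ≤ (∑ i, g i (w i)) ^ 4} := by
        gcongr; exact measure_ne_top _ _
    _ ≤ _ := hmk.trans h4
    _ = _ := by simp; ring

/-! ### Lindeberg's replacement argument -/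

theorem abs_integral_taylor_le {F : ℕ → ℝ → ℝ} (hF : ∀ k x, HasDerivAt (F k) (F (k + 1) x) x)
    {M₀ M : ℝ} (h0 : ∀ x, |F 0 x| ≤ M₀) (h3 : ∀ x, |F 3 x| ≤ M) {μ : Measure ℝ}
    [IsProbabilityMeasure μ] (hμ : MemLp id 4 μ) (z : ℝ) :
    |∫ x, F 0 (z + x) ∂μ - (F 0 z + F 1 z * ∫ x, x ∂μ + F 2 z / 2 * ∫ x, x ^ 2 ∂μ)|
      ≤ M * ∫ x, |x| ^ 3 ∂μ := by
  have i1 : Integrable (fun x : ℝ => x) μ := by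
    simpa using MemLp.integrable_pow_le_four hμ (k := 1) (by norm_num)
  have i2 : Integrable (fun x : ℝ => x ^ 2) μ := by
    simpa using MemLp.integrable_pow_le_four hμ (k := 2) (by norm_num)
  have i3 : Integrable (fun x : ℝ => |x| ^ 3) μ := by
    have := (MemLp.integrable_pow_le_four hμ (k := 3) (by norm_num)).abs
    simpa [abs_pow] using this
  have hc : Continuous (F 0) := continuous_iff_continuousAt.2 fun x => (hF 0 x).continuousAt
  have i0 : Integrable (fun x => F 0 (z + x)) μ :=
    (integrable_const M₀).mono' (by fun_prop) (ae_of_all _ fun x => h0 _)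
  have e : ∫ x, F 0 (z + x) ∂μ - (F 0 z + F 1 z * ∫ x, x ∂μ + F 2 z / 2 * ∫ x, x ^ 2 ∂μ)
      = ∫ x, (F 0 (z + x) - (F 0 z + F 1 z * x + F 2 z / 2 * x ^ 2)) ∂μ := by
    rw [integral_sub i0 (((integrable_const _).fun_add (i1.const_mul _)).fun_add (i2.const_mul _)),
      integral_add ((integrable_const _).fun_add (i1.const_mul _)) (i2.const_mul _),
      integral_add (integrable_const _) (i1.const_mul _), integral_const_mul, integral_const_mul]
    simp
  rw [e, ← integral_const_mul, ← Real.norm_eq_abs]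
  refine norm_integral_le_of_norm_le (i3.const_mul M) (ae_of_all _ fun x => ?_)
  have h := abs_taylor_remainder_le hF h3 z x
  simp only [Finset.sum_range_succ, Finset.range_zero, Finset.sum_empty, Nat.factorial] at h
  rw [Real.norm_eq_abs]
  refine le_of_eq_of_le ?_ h
  congr 1
  norm_num
  ring

theorem abs_integral_sub_integral_le {F : ℕ → ℝ → ℝ}
    (hF : ∀ k x, HasDerivAt (F k) (F (k + 1) x) x)
    {M₀ M : ℝ} (h0 : ∀ x, |F 0 x| ≤ M₀) (h3 : ∀ x, |F 3 x| ≤ M) {μ ν : Measure ℝ}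
    [IsProbabilityMeasure μ] [IsProbabilityMeasure ν] (hμ : MemLp id 4 μ) (hν : MemLp id 4 ν)
    (e1 : ∫ x, x ∂μ = ∫ x, x ∂ν) (e2 : ∫ x, x ^ 2 ∂μ = ∫ x, x ^ 2 ∂ν) (z : ℝ) :
    |∫ x, F 0 (z + x) ∂μ - ∫ x, F 0 (z + x) ∂ν|
      ≤ M * (∫ x, |x| ^ 3 ∂μ + ∫ x, |x| ^ 3 ∂ν) := by
  have h1 := abs_integral_taylor_le hF h0 h3 hμ z
  have h2 := abs_integral_taylor_le hF h0 h3 hν z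
  rw [e1, e2] at h1
  rw [mul_add]
  exact (abs_sub_le _ _ _).trans (add_le_add h1 (by rwa [abs_sub_comm]))

/-- Summands are exchanged one at a time for centred Gaussians of the same variance. The first two
moments agree, so each exchange costs only third moments times the bound on the third derivative.
The test function is quantified after `s` because the induction applies to its translates. -/
theorem lindeberg {Ω ι : Type*} {mΩ : MeasurableSpace Ω} {μ : Measure Ω} [IsProbabilityMeasure μ]
    {X : ι → Ω → ℝ} (hind : iIndepFun X μ) (hm : ∀ i, Measurable (X i))
    (hL : ∀ i, MemLp (X i) 4 μ) (hX : ∀ i, ∫ a, X i a ∂μ = 0) (v : ι → NNReal)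
    (hv : ∀ i, ∫ a, X i a ^ 2 ∂μ = v i) {ρ : ℝ}
    (hρ : ∀ i, ∫ a, |X i a| ^ 3 ∂μ + ∫ z, |z| ^ 3 ∂(gaussianReal 0 (v i)) ≤ ρ)
    {M₀ M : ℝ} (s : Finset ι) : ∀ {F : ℕ → ℝ → ℝ}
    (_ : ∀ k x, HasDerivAt (F k) (F (k + 1) x) x) (_ : ∀ x, |F 0 x| ≤ M₀)
    (_ : ∀ x, |F 3 x| ≤ M),
    |∫ a, F 0 (∑ i ∈ s, X i a) ∂μ - ∫ z, F 0 z ∂(gaussianReal 0 (∑ i ∈ s, v i))|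
      ≤ s.card * (M * ρ) := by
  classical
  induction s using Finset.induction_on with
  | empty => intro F _ _ _; simp
  | insert i s hi ih =>
    intro F hF h0 h3
    have hM : 0 ≤ M := (abs_nonneg _).trans (h3 0)
    have hc : Continuous (F 0) := continuous_iff_continuousAt.2 fun x => (hF 0 x).continuousAt
    set S : Ω → ℝ := fun a => ∑ j ∈ s, X j a with hS
    have hSm : Measurable S := Finset.measurable_sum _ fun j _ => hm j
    have hIn : IndepFun S (X i) μ := by
      have := hind.indepFun_finsetSum_of_notMem hm hi
      convert this using 1
      ext a; simp [hS]
    have hb : ∀ (ν : Measure ℝ) [IsFiniteMeasure ν], Integrable (F 0) ν := fun ν _ =>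
      (integrable_const M₀).mono' hc.aestronglyMeasurable (ae_of_all _ h0)
    have : IsProbabilityMeasure (μ.map S) := Measure.isProbabilityMeasure_map hSm.aemeasurable
    have : IsProbabilityMeasure (μ.map (X i)) :=
      Measure.isProbabilityMeasure_map (hm i).aemeasurable
    have e1 : ∫ a, F 0 (∑ j ∈ insert i s, X j a) ∂μ
        = ∫ x, ∫ t, F 0 (t + x) ∂(μ.map S) ∂(μ.map (X i)) := by
      have h1 : ∫ a, F 0 (∑ j ∈ insert i s, X j a) ∂μ = ∫ t, F 0 t ∂(μ.map (X i + S)) := by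
        rw [integral_map ((hm i).add hSm).aemeasurable hc.aestronglyMeasurable]
        simp [Finset.sum_insert hi, hS]
      rw [h1, hIn.symm.map_add_eq_map_conv_map (hm i) hSm, integral_conv (hb _)]
      simp_rw [add_comm]
    have e2 : ∫ z, F 0 z ∂(gaussianReal 0 (∑ j ∈ insert i s, v j))
        = ∫ t, ∫ x, F 0 (t + x) ∂(gaussianReal 0 (v i)) ∂(gaussianReal 0 (∑ j ∈ s, v j)) := by
      rw [← integral_conv (hb _), gaussianReal_conv_gaussianReal, Finset.sum_insert hi, add_zero,
        add_comm]
    have hi2 : ∀ (ν ν' : Measure ℝ) [IsFiniteMeasure ν] [IsFiniteMeasure ν'],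
        Integrable (fun p : ℝ × ℝ => F 0 (p.1 + p.2)) (ν.prod ν') := fun ν ν' _ _ =>
      (integrable_const M₀).mono' (by fun_prop) (ae_of_all _ fun p => h0 _)
    -- The hybrid: the sum over `s` is already Gaussian and `X i` is not. One side is the induction
    -- hypothesis for translated test functions, the other a single exchange.
    set I : ℝ := ∫ t, ∫ x, F 0 (t + x) ∂(μ.map (X i)) ∂(gaussianReal 0 (∑ j ∈ s, v j)) with hI
    have hIswap : I = ∫ x, ∫ t, F 0 (t + x) ∂(gaussianReal 0 (∑ j ∈ s, v j)) ∂(μ.map (X i)) :=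
      integral_integral_swap (hi2 _ _)
    have hi3 : ∀ (ν ν' : Measure ℝ) [IsFiniteMeasure ν] [IsFiniteMeasure ν'],
        Integrable (fun t => ∫ x, F 0 (t + x) ∂ν') ν := fun ν ν' _ _ =>
      (hi2 ν ν').integral_prod_left
    have hi4 : ∀ (ν ν' : Measure ℝ) [IsFiniteMeasure ν] [IsFiniteMeasure ν'],
        Integrable (fun x => ∫ t, F 0 (t + x) ∂ν') ν := fun ν ν' _ _ => by
      simpa [add_comm] using hi3 ν ν'
    have b1 : |∫ a, F 0 (∑ j ∈ insert i s, X j a) ∂μ - I| ≤ s.card * (M * ρ) := by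
      rw [e1, hIswap, ← integral_sub (hi4 _ _) (hi4 _ _), ← Real.norm_eq_abs]
      refine (norm_integral_le_of_norm_le_const (C := s.card * (M * ρ))
        (ae_of_all _ fun x => ?_)).trans (by simp)
      have := ih (F := fun k t => F k (t + x))
        (fun k t => by simpa using (hF k (t + x)).comp_add_const t x)
        (fun t => h0 _) (fun t => h3 _)
      rw [integral_map hSm.aemeasurable (by fun_prop)]
      exact this
    have hmap : ∀ f : ℝ → ℝ, Measurable f → ∫ x, f x ∂(μ.map (X i)) = ∫ a, f (X i a) ∂μ :=
      fun f hf => integral_map (hm i).aemeasurable hf.aestronglyMeasurable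
    have b2 : |I - ∫ z, F 0 z ∂(gaussianReal 0 (∑ j ∈ insert i s, v j))| ≤ M * ρ := by
      rw [e2, hI, ← integral_sub (hi3 _ _) (hi3 _ _), ← Real.norm_eq_abs]
      refine (norm_integral_le_of_norm_le_const (C := M * ρ)
        (ae_of_all _ fun t => ?_)).trans (by simp)
      have hL' : MemLp id 4 (μ.map (X i)) :=
        (memLp_map_measure_iff (by fun_prop) (hm i).aemeasurable).2 (hL i)
      have hG : MemLp id 4 (gaussianReal 0 (v i)) := memLp_id_gaussianReal' 4 (by norm_num)
      have hvar : ∫ x, x ^ 2 ∂(gaussianReal 0 (v i)) = v i := by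
        have := variance_fun_id_gaussianReal (μ := 0) (v := v i)
        rw [variance_eq_integral (by fun_prop)] at this
        simpa using this
      have := abs_integral_sub_integral_le hF h0 h3 hL' hG
        (by rw [hmap _ measurable_id', hX]; simp)
        (by rw [hmap (fun x => x ^ 2) (by fun_prop), hv, hvar]) t
      rw [hmap (fun x => |x| ^ 3) (by fun_prop)] at this
      rw [Real.norm_eq_abs]
      refine this.trans ?_
      gcongr
      exact hρ i
    rw [Finset.card_insert_of_notMem hi]
    push_cast
    have := abs_sub_le (∫ a, F 0 (∑ j ∈ insert i s, X j a) ∂μ) I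
      (∫ z, F 0 z ∂(gaussianReal 0 (∑ j ∈ insert i s, v j)))
    linarith

/-! ### Smoothed indicator functions -/

/-- The transition function is locally constant off `[0, 1]`, so its derivatives vanish there, and
on the compact interval they are bounded by continuity. -/
theorem exists_iteratedDeriv_smoothTransition_bound {k : ℕ} (hk : 1 ≤ k) :
    ∃ C : ℝ, ∀ x, |iteratedDeriv k Real.smoothTransition x| ≤ C := by
  have hc : Continuous (iteratedDeriv k Real.smoothTransition) :=
    (Real.smoothTransition.contDiff (n := k)).continuous_iteratedDeriv k le_rfl
  obtain ⟨C, hC⟩ := isCompact_Icc.exists_bound_of_continuousOn (s := Set.Icc (0 : ℝ) 1)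
    hc.continuousOn
  have hconst : ∀ (c x : ℝ), Real.smoothTransition =ᶠ[𝓝 x] (fun _ => c) →
      iteratedDeriv k Real.smoothTransition x = 0 := by
    intro c x h
    rw [h.iteratedDeriv_eq k, iteratedDeriv_const]
    simp [show k ≠ 0 by omega]
  refine ⟨max C 0, fun x => ?_⟩
  by_cases h0 : x < 0
  · rw [hconst 0 x]
    · simp
    · filter_upwards [gt_mem_nhds h0] with y hy
      exact Real.smoothTransition.zero_of_nonpos hy.le
  by_cases h1 : 1 < x
  · rw [hconst 1 x]
    · simp
    · filter_upwards [lt_mem_nhds h1] with y hy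
      exact Real.smoothTransition.one_of_one_le hy.le
  · exact (hC x ⟨not_lt.1 h0, not_lt.1 h1⟩).trans (le_max_left _ _)

/-- A smooth approximation of the indicator of `(-∞, u]`, together with its derivatives. -/
noncomputable def bump (u ε : ℝ) (k : ℕ) (t : ℝ) : ℝ :=
  (-(1 / ε)) ^ k * iteratedDeriv k Real.smoothTransition ((u - t) / ε + 1)

theorem hasDerivAt_bump (u ε : ℝ) (k : ℕ) (t : ℝ) :
    HasDerivAt (bump u ε k) (bump u ε (k + 1) t) t := by
  have h1 : HasDerivAt (fun t => (u - t) / ε + 1) (-(1 / ε)) t := by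
    have := (((hasDerivAt_id t).const_sub u).div_const ε).add_const 1
    refine this.congr_deriv ?_
    ring
  have h2 : HasDerivAt (iteratedDeriv k Real.smoothTransition)
      (iteratedDeriv (k + 1) Real.smoothTransition ((u - t) / ε + 1)) ((u - t) / ε + 1) := by
    rw [iteratedDeriv_succ]
    have hd := (Real.smoothTransition.contDiff (n := ((k + 1 : ℕ) : ℕ∞))).differentiable_iteratedDeriv
      k (by norm_cast; omega)
    exact (hd _).hasDerivAt
  have h3 := (h2.comp t h1).const_mul ((-(1 / ε)) ^ k)
  refine h3.congr_deriv ?_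
  simp only [bump, pow_succ]
  ring

theorem bump_zero_nonneg (u ε t : ℝ) : 0 ≤ bump u ε 0 t := by
  simp [bump, Real.smoothTransition.nonneg]

theorem bump_zero_le_one (u ε t : ℝ) : bump u ε 0 t ≤ 1 := by
  simp [bump, Real.smoothTransition.le_one]

theorem bump_eq_one {u ε t : ℝ} (hε : 0 < ε) (h : t ≤ u) : bump u ε 0 t = 1 := by
  have : 0 ≤ (u - t) / ε := div_nonneg (by linarith) hε.le
  simp only [bump, pow_zero, iteratedDeriv_zero, one_mul]
  exact Real.smoothTransition.one_of_one_le (by linarith)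

theorem bump_eq_zero {u ε t : ℝ} (hε : 0 < ε) (h : u + ε ≤ t) : bump u ε 0 t = 0 := by
  have : (u - t) / ε ≤ -1 := by
    rw [div_le_iff₀ hε]; linarith
  simp only [bump, pow_zero, iteratedDeriv_zero, one_mul]
  exact Real.smoothTransition.zero_of_nonpos (by linarith)

theorem abs_bump_le {k : ℕ} {C : ℝ} (hC : ∀ x, |iteratedDeriv k Real.smoothTransition x| ≤ C)
    {ε : ℝ} (hε : 0 < ε) (u t : ℝ) : |bump u ε k t| ≤ C / ε ^ k := by
  rw [bump, abs_mul, abs_pow, abs_neg, abs_of_pos (by positivity), div_pow, one_pow,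
    div_mul_eq_mul_div, one_mul]
  gcongr
  exact hC _

/-- The normal density is at most 1. This converts a shift of the threshold into an additive error.
-/
theorem cdf_gaussian_sub_le {a b : ℝ} (h : a ≤ b) :
    cdf (gaussianReal 0 1) b - cdf (gaussianReal 0 1) a ≤ b - a := by
  rw [cdf_eq_real, cdf_eq_real, ← Set.Iic_union_Ioc_eq_Iic h,
    measureReal_union (Set.Iic_disjoint_Ioc le_rfl) measurableSet_Ioc]
  have h1 : (gaussianReal 0 1).real (Set.Ioc a b) = ∫ x in Set.Ioc a b, gaussianPDFReal 0 1 x := by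
    rw [measureReal_def, gaussianReal_apply_eq_integral 0 one_ne_zero, ENNReal.toReal_ofReal]
    exact integral_nonneg fun x => gaussianPDFReal_nonneg _ _ _
  have h2 : ∫ x in Set.Ioc a b, gaussianPDFReal 0 1 x ≤ b - a := by
    have h3 : ∀ x, gaussianPDFReal 0 1 x ≤ 1 := by
      intro x
      rw [gaussianPDFReal_def]
      have h4 : Real.exp (-(x - 0) ^ 2 / (2 * ((1 : NNReal) : ℝ))) ≤ 1 := by
        rw [Real.exp_le_one_iff]
        have : 0 ≤ (x - 0) ^ 2 := sq_nonneg _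
        simp only [NNReal.coe_one, mul_one]
        linarith
      have h5 : (Real.sqrt (2 * Real.pi * ((1 : NNReal) : ℝ)))⁻¹ ≤ 1 := by
        apply inv_le_one_of_one_le₀
        rw [Real.one_le_sqrt]
        simp only [NNReal.coe_one, mul_one]
        linarith [Real.pi_gt_three]
      exact mul_le_one₀ h5 (Real.exp_pos _).le h4
    calc ∫ x in Set.Ioc a b, gaussianPDFReal 0 1 x ≤ ∫ x in Set.Ioc a b, (1 : ℝ) :=
          integral_mono (integrable_gaussianPDFReal 0 1).integrableOn
            (integrable_const _) fun x => h3 x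
      _ = b - a := by simp [h]
  rw [h1]; linarith

theorem continuous_bump (u ε : ℝ) (k : ℕ) : Continuous (bump u ε k) :=
  continuous_iff_continuousAt.2 fun x => (hasDerivAt_bump u ε k x).continuousAt

theorem real_le_integral_bump_le {Ω : Type*} {mΩ : MeasurableSpace Ω} (ν : Measure Ω)
    [IsProbabilityMeasure ν] {T : Ω → ℝ} (hT : Measurable T) {ε : ℝ} (hε : 0 < ε) (u : ℝ) :
    ν.real {a | T a ≤ u} ≤ ∫ a, bump u ε 0 (T a) ∂ν ∧
      ∫ a, bump u ε 0 (T a) ∂ν ≤ ν.real {a | T a ≤ u + ε} := by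
  have hInt : Integrable (fun a => bump u ε 0 (T a)) ν :=
    (integrable_const (1 : ℝ)).mono' ((continuous_bump u ε 0).measurable.comp hT).aestronglyMeasurable
      (ae_of_all _ fun a => by
        rw [Real.norm_eq_abs, abs_of_nonneg (bump_zero_nonneg _ _ _)]
        exact bump_zero_le_one _ _ _)
  have hms : ∀ u, MeasurableSet {a | T a ≤ u} := fun u => measurableSet_le hT measurable_const
  constructor
  · rw [← integral_indicator_one (hms u)]
    refine integral_mono ((integrable_const (1 : ℝ)).indicator (hms u)) hInt fun a => ?_
    by_cases ha : T a ≤ u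
    · simp [Set.indicator, ha, bump_eq_one hε ha]
    · simp [Set.indicator, ha, bump_zero_nonneg]
  · rw [← integral_indicator_one (hms (u + ε))]
    refine integral_mono hInt ((integrable_const (1 : ℝ)).indicator (hms _)) fun a => ?_
    by_cases ha : T a ≤ u + ε
    · simp [Set.indicator, ha, bump_zero_le_one]
    · simp [Set.indicator, ha, bump_eq_zero hε (not_le.1 ha).le]

/-- Kolmogorov distances are controlled by smoothed indicators. -/
theorem abs_real_Iic_sub_cdf_le {Ω : Type*} {mΩ : MeasurableSpace Ω} {μ : Measure Ω}
    [IsProbabilityMeasure μ] {S : Ω → ℝ} (hS : Measurable S) {ε κ : ℝ} (hε : 0 < ε)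
    (h : ∀ u, |∫ a, bump u ε 0 (S a) ∂μ - ∫ z, bump u ε 0 z ∂(gaussianReal 0 1)| ≤ κ) (u : ℝ) :
    |μ.real {a | S a ≤ u} - cdf (gaussianReal 0 1) u| ≤ κ + ε := by
  have hk1 := fun u => real_le_integral_bump_le μ hS hε u
  have hk2 := fun u => real_le_integral_bump_le (gaussianReal 0 1) measurable_id hε u
  have hcdf : ∀ u, (gaussianReal 0 1).real {a | id a ≤ u} = cdf (gaussianReal 0 1) u := fun u => by
    rw [cdf_eq_real]; rfl
  simp only [hcdf] at hk2
  simp only [id] at hk2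
  have l1 := cdf_gaussian_sub_le (show u ≤ u + ε by linarith)
  have l2 := cdf_gaussian_sub_le (show u - ε ≤ u by linarith)
  -- The bump starting its descent at `u` bounds the distribution function from above, the one
  -- starting at `u - ε` from below.
  have a1 := abs_le.1 (h u)
  have a2 := abs_le.1 (h (u - ε))
  have b1 := hk1 u
  have b2 := hk1 (u - ε)
  have c1 := hk2 u
  have c2 := hk2 (u - ε)
  rw [sub_add_cancel] at b2 c2
  rw [abs_le]
  constructor <;> linarith

/-! ### Quantitative central limit theorem and its stability. -/

theorem gaussianReal_eq_map_sqrt (v : NNReal) :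
    gaussianReal 0 v = (gaussianReal 0 1).map (fun z => Real.sqrt v * z) := by
  rw [gaussianReal_map_const_mul, mul_zero, mul_one]
  congr 1
  ext
  simp

theorem integral_gaussianReal_var (v : NNReal) {f : ℝ → ℝ} (hf : Measurable f) :
    ∫ z, f z ∂(gaussianReal 0 v) = ∫ z, f (Real.sqrt v * z) ∂(gaussianReal 0 1) := by
  rw [gaussianReal_eq_map_sqrt v, integral_map (by fun_prop) hf.aestronglyMeasurable]

theorem integrable_abs_pow_gaussian (k : ℕ) :
    Integrable (fun w : ℝ => |w| ^ k) (gaussianReal 0 1) := by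
  simpa [abs_pow] using (integrable_pow_gaussian k).abs

/-- A quantitative central limit theorem for sums of independent functions of standard normal
variables. -/
theorem exists_kolmogorov_bound : ∃ K : ℝ, 0 < K ∧ ∀ (N : ℕ) (f : Fin N → ℝ → ℝ) (c ε V u : ℝ),
    (∀ i, Measurable (f i)) → 0 ≤ c → (∀ i w, |f i w| ≤ c * wt w) →
    (∀ i, ∫ z, f i z ∂(gaussianReal 0 1) = 0) →
    (∑ i, ∫ z, f i z ^ 2 ∂(gaussianReal 0 1) = V) → 0 < ε →
    |(stdGaussian N).real {w | ∑ i, f i (w i) ≤ u} - cdf (gaussianReal 0 1) u| ≤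
      K * (ε + N * c ^ 3 / ε ^ 3 + |V - 1| / ε) := by
  obtain ⟨C₁, hC₁⟩ := exists_iteratedDeriv_smoothTransition_bound (k := 1) le_rfl
  obtain ⟨C₃, hC₃⟩ := exists_iteratedDeriv_smoothTransition_bound (k := 3) (by norm_num)
  have hC₁0 : 0 ≤ C₁ := (abs_nonneg _).trans (hC₁ 0)
  have hC₃0 : 0 ≤ C₃ := (abs_nonneg _).trans (hC₃ 0)
  set W2 : ℝ := ∫ z, wt z ^ 2 ∂(gaussianReal 0 1) with hW2
  set W3 : ℝ := ∫ z, wt z ^ 3 ∂(gaussianReal 0 1) with hW3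
  set G1 : ℝ := ∫ z : ℝ, |z| ∂(gaussianReal 0 1) with hG1
  set G3 : ℝ := ∫ z : ℝ, |z| ^ 3 ∂(gaussianReal 0 1) with hG3
  have hwt0 : ∀ z, 0 ≤ wt z := fun z => zero_le_one.trans (one_le_wt z)
  have hW2n : 0 ≤ W2 := integral_nonneg fun z => by have := hwt0 z; positivity
  have hW3n : 0 ≤ W3 := integral_nonneg fun z => by have := hwt0 z; positivity
  have hG1n : 0 ≤ G1 := integral_nonneg fun z => by positivity
  have hG3n : 0 ≤ G3 := integral_nonneg fun z => by positivity
  set R : ℝ := W3 + Real.sqrt W2 ^ 3 * G3 with hR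
  have hRn : 0 ≤ R := by positivity
  -- The three summands pay for the smoothing width, for the Lindeberg exchange, and for changing
  -- the variance from `V` to 1.
  refine ⟨1 + C₃ * R + C₁ * G1, by positivity, ?_⟩
  intro N f c ε V u hf hc hfb hf0 hV hε
  have hPM : IsProbabilityMeasure (stdGaussian N) := by unfold stdGaussian; infer_instance
  have hfL : ∀ i, MemLp (f i) 4 (gaussianReal 0 1) := fun i => memLp_of_abs_le_wt (hf i) (hfb i)
  have hmp : ∀ i : Fin N, MeasurePreserving (Function.eval i) (stdGaussian N) (gaussianReal 0 1) :=
    fun i => measurePreserving_eval _ i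
  have hev : ∀ (i : Fin N) (h : ℝ → ℝ), Measurable h →
      ∫ w, h (w i) ∂(stdGaussian N) = ∫ z, h z ∂(gaussianReal 0 1) := by
    intro i h hh
    rw [← (hmp i).map_eq, integral_map (hmp i).measurable.aemeasurable hh.aestronglyMeasurable]
  have hv0 : ∀ i, 0 ≤ ∫ z, f i z ^ 2 ∂(gaussianReal 0 1) := fun i =>
    integral_nonneg fun z => by positivity
  set v : Fin N → NNReal := fun i => ⟨∫ z, f i z ^ 2 ∂(gaussianReal 0 1), hv0 i⟩ with hv
  have hvle : ∀ i, (v i : ℝ) ≤ c ^ 2 * W2 := by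
    intro i
    change ∫ z, f i z ^ 2 ∂(gaussianReal 0 1) ≤ _
    rw [hW2, ← integral_const_mul]
    refine integral_mono (MemLp.integrable_pow_le_four (hfL i) (by norm_num))
      ((integrable_wt_pow 2).const_mul _) fun w => ?_
    simp only
    rw [← mul_pow, ← sq_abs]
    gcongr
    exact hfb i w
  have hρ : ∀ i, ∫ w, |f i (w i)| ^ 3 ∂(stdGaussian N) + ∫ z, |z| ^ 3 ∂(gaussianReal 0 (v i))
      ≤ c ^ 3 * R := by
    intro i
    rw [hev i (fun z => |f i z| ^ 3) (by have := hf i; fun_prop), hR, mul_add,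
      integral_gaussianReal_var (v i) (by fun_prop)]
    refine add_le_add ?_ ?_
    · rw [hW3, ← integral_const_mul]
      refine integral_mono ?_ ((integrable_wt_pow 3).const_mul _) fun w => ?_
      · simpa [abs_pow] using (MemLp.integrable_pow_le_four (hfL i) (k := 3) (by norm_num)).abs
      · simp only
        rw [← mul_pow]
        gcongr
        exact hfb i w
    · simp only [abs_mul, mul_pow]
      rw [integral_const_mul, ← hG3, ← mul_assoc, ← mul_pow, abs_of_nonneg (Real.sqrt_nonneg _)]
      gcongr
      calc Real.sqrt (v i) ≤ Real.sqrt (c ^ 2 * W2) := Real.sqrt_le_sqrt (hvle i)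
        _ = c * Real.sqrt W2 := by
          rw [Real.sqrt_mul (by positivity), Real.sqrt_sq hc]
  have hind : iIndepFun (fun (i : Fin N) (w : Fin N → ℝ) => f i (w i)) (stdGaussian N) :=
    iIndepFun_pi fun i => (hf i).aemeasurable
  have hVs : ((∑ i, v i : NNReal) : ℝ) = V := by
    rw [← hV]; push_cast; rfl
  have hV0 : 0 ≤ V := hVs ▸ NNReal.coe_nonneg _
  have hSm : Measurable fun w : Fin N → ℝ => ∑ i, f i (w i) :=
    Finset.measurable_sum _ fun i _ => (hf i).comp (measurable_pi_apply i)
  have hb1 : ∀ u t, |bump u ε 0 t| ≤ 1 := fun u t => by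
    rw [abs_of_nonneg (bump_zero_nonneg _ _ _)]; exact bump_zero_le_one _ _ _
  have main := abs_real_Iic_sub_cdf_le (μ := stdGaussian N) hSm hε
    (κ := N * (C₃ / ε ^ 3 * (c ^ 3 * R)) + C₁ / ε * |V - 1| * G1) (fun u => by
      have h1 := lindeberg hind (fun i => (hf i).comp (measurable_pi_apply i))
        (fun i => (hfL i).comp_measurePreserving (hmp i))
        (fun i => by rw [hev i _ (hf i), hf0]) v
        (fun i => by rw [hev i (fun z => f i z ^ 2) ((hf i).pow_const 2)]; rfl) hρ
        (M₀ := 1) Finset.univ (hasDerivAt_bump u ε) (hb1 u) (abs_bump_le hC₃ hε u)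
      -- The two Gaussians are coupled as `√V z` and `z`; the bump is Lipschitz with constant `C₁ /
      -- ε`, and `|√V - 1| ≤ |V - 1|`.
      have h2 : |∫ z, bump u ε 0 z ∂(gaussianReal 0 (∑ i, v i))
          - ∫ z, bump u ε 0 z ∂(gaussianReal 0 1)| ≤ C₁ / ε * |V - 1| * G1 := by
        have hib : ∀ s : ℝ, Integrable (fun z => bump u ε 0 (s * z)) (gaussianReal 0 1) := fun s =>
          (integrable_const (1 : ℝ)).mono'
            ((continuous_bump u ε 0).comp (by fun_prop)).aestronglyMeasurable
            (ae_of_all _ fun z => hb1 _ _)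
        rw [integral_gaussianReal_var _ (continuous_bump u ε 0).measurable, hVs,
          ← integral_sub (hib _) (by simpa using hib 1), ← Real.norm_eq_abs, hG1,
          ← integral_const_mul]
        refine norm_integral_le_of_norm_le
          ((by simpa using integrable_abs_pow_gaussian 1 : Integrable (fun z : ℝ => |z|) _).const_mul _)
          (ae_of_all _ fun z => ?_)
        have h3 := abs_taylor_remainder_le (n := 1) (hasDerivAt_bump u ε)
          (abs_bump_le hC₁ hε u) z (Real.sqrt V * z - z)
        simp only [Finset.sum_range_succ, Finset.range_zero, Finset.sum_empty, Nat.factorial] at h3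
        simp only [pow_zero, mul_one, Nat.cast_one, div_one, zero_add, pow_one,
          add_sub_cancel] at h3
        rw [Real.norm_eq_abs]
        refine h3.trans ?_
        have h4 : |Real.sqrt V * z - z| = |Real.sqrt V - 1| * |z| := by
          rw [← abs_mul]; ring_nf
        rw [h4, ← mul_assoc]
        suffices h : |Real.sqrt V - 1| ≤ |V - 1| by gcongr
        have h5 : V - 1 = (Real.sqrt V - 1) * (Real.sqrt V + 1) := by
          have := Real.sq_sqrt hV0
          nlinarith
        rw [h5, abs_mul]
        have h6 : 1 ≤ |Real.sqrt V + 1| := by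
          rw [abs_of_nonneg (by positivity)]; linarith [Real.sqrt_nonneg V]
        nlinarith [abs_nonneg (Real.sqrt V - 1)]
      have h3 := abs_sub_le (∫ w, bump u ε 0 (∑ i, f i (w i)) ∂(stdGaussian N))
        (∫ z, bump u ε 0 z ∂(gaussianReal 0 (∑ i, v i))) (∫ z, bump u ε 0 z ∂(gaussianReal 0 1))
      simp only [Finset.card_univ, Fintype.card_fin] at h1
      linarith) u
  refine main.trans ?_
  have p1 : 0 ≤ N * c ^ 3 / ε ^ 3 := by positivity
  have p2 : 0 ≤ |V - 1| / ε := by positivity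
  have q1 : N * (C₃ / ε ^ 3 * (c ^ 3 * R)) = C₃ * R * (N * c ^ 3 / ε ^ 3) := by ring
  have q2 : C₁ / ε * |V - 1| * G1 = C₁ * G1 * (|V - 1| / ε) := by ring
  rw [q1, q2]
  have r1 : 0 ≤ C₃ * R := by positivity
  have r2 : 0 ≤ C₁ * G1 := by positivity
  have s1 := mul_nonneg r1 p2
  have s2 := mul_nonneg r2 p1
  have s3 := mul_nonneg r1 hε.le
  have s4 := mul_nonneg r2 hε.le
  linarith [show (1 + C₃ * R + C₁ * G1) * (ε + N * c ^ 3 / ε ^ 3 + |V - 1| / ε)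
    = ε + N * c ^ 3 / ε ^ 3 + |V - 1| / ε + C₃ * R * ε + C₃ * R * (N * c ^ 3 / ε ^ 3)
      + C₃ * R * (|V - 1| / ε) + C₁ * G1 * ε + C₁ * G1 * (N * c ^ 3 / ε ^ 3)
      + C₁ * G1 * (|V - 1| / ε) by ring]

/-- Stability of the Kolmogorov distance under perturbations that are small in probability. -/
theorem abs_real_sub_cdf_le_of_perturbation {Ω : Type*} {mΩ : MeasurableSpace Ω} {μ : Measure Ω}
    [IsProbabilityMeasure μ] {S T : Ω → ℝ} {κ η θ : ℝ} (hη : 0 ≤ η)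
    (hS : ∀ u, |μ.real {a | S a ≤ u} - cdf (gaussianReal 0 1) u| ≤ κ)
    (h : μ.real {a | η < |T a - S a|} ≤ θ) (u : ℝ) :
    |μ.real {a | T a ≤ u} - cdf (gaussianReal 0 1) u| ≤ κ + η + θ := by
  have h1 : μ.real {a | T a ≤ u} ≤ μ.real {a | S a ≤ u + η} + μ.real {a | η < |T a - S a|} := by
    refine (measureReal_mono ?_ (measure_ne_top _ _)).trans (measureReal_union_le _ _)
    intro a ha
    by_cases hb : η < |T a - S a|
    · exact Or.inr hb
    · left
      simp only [Set.mem_ofPred_eq] at ha ⊢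
      have := (abs_le.1 (not_lt.1 hb)).1
      linarith
  have h2 : μ.real {a | S a ≤ u - η} ≤ μ.real {a | T a ≤ u} + μ.real {a | η < |T a - S a|} := by
    refine (measureReal_mono ?_ (measure_ne_top _ _)).trans (measureReal_union_le _ _)
    intro a ha
    by_cases hb : η < |T a - S a|
    · exact Or.inr hb
    · left
      simp only [Set.mem_ofPred_eq] at ha ⊢
      have := (abs_le.1 (not_lt.1 hb)).2
      linarith
  have l1 := cdf_gaussian_sub_le (show u ≤ u + η by linarith)
  have l2 := cdf_gaussian_sub_le (show u - η ≤ u by linarith)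
  have a1 := abs_le.1 (hS (u + η))
  have a2 := abs_le.1 (hS (u - η))
  rw [abs_le]
  constructor <;> linarith

/-! ### Chains of derivatives -/

/-- `H k` and `P k` are the successive derivatives of `H 0` and `P 0`; those of order at most four
are bounded by `B`, except possibly `P 0` itself. -/
structure Chain (H P : ℕ → ℝ → ℝ) (B : ℝ) : Prop where
  dH : ∀ k x, HasDerivAt (H k) (H (k + 1) x) x
  dP : ∀ k x, HasDerivAt (P k) (P (k + 1) x) x
  bH : ∀ k, k ≤ 4 → ∀ x, |H k x| ≤ B
  bP : ∀ k, 1 ≤ k → k ≤ 4 → ∀ x, |P k x| ≤ B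
  one_le : 1 ≤ B

namespace Chain

variable {H P : ℕ → ℝ → ℝ} {B : ℝ}

theorem continuous_H (h : Chain H P B) (k : ℕ) : Continuous (H k) :=
  continuous_iff_continuousAt.2 fun x => (h.dH k x).continuousAt

theorem continuous_P (h : Chain H P B) (k : ℕ) : Continuous (P k) :=
  continuous_iff_continuousAt.2 fun x => (h.dP k x).continuousAt

end Chain

theorem hasDerivAt_iteratedDeriv_of_smooth {f : ℝ → ℝ} (hf : ContDiff ℝ ∞ f) (k : ℕ) (x : ℝ) :
    HasDerivAt (iteratedDeriv k f) (iteratedDeriv (k + 1) f x) x := by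
  rw [iteratedDeriv_succ]
  exact (hf.differentiable_iteratedDeriv k (by exact_mod_cast WithTop.coe_lt_top k) x).hasDerivAt

/-- Subtracting a multiple of `H` preserves bounded derivatives. Only orders up to four are ever
used, so one constant is enough. -/
theorem HP.exists_chain {H U : ℝ → ℝ} (h : HP H U) (m : ℝ) :
    ∃ B, Chain (fun k => iteratedDeriv k H) (fun k => iteratedDeriv k fun x => U x - H x * m) B := by
  have hψ : ContDiff ℝ ∞ (fun x => U x - H x * m) := h.smooth_U.sub (h.smooth_H.mul contDiff_const)
  have hk : ∀ k : ℕ, ∃ C : ℝ, ∀ x, |iteratedDeriv k H x| ≤ C := by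
    intro k
    rcases Nat.eq_zero_or_pos k with rfl | hk
    · simpa using h.H_bdd
    · exact h.deriv_H_bdd k hk
  -- The order condition stands inside the existential so that `choose` gives a constant for every
  -- `k`, with a dummy value at order 0, where `U` is unbounded.
  have hk' : ∀ k : ℕ, ∃ C : ℝ, 1 ≤ k → ∀ x, |iteratedDeriv k U x| ≤ C := by
    intro k
    rcases Nat.eq_zero_or_pos k with rfl | hk
    · exact ⟨0, fun h => absurd h (by norm_num)⟩
    · obtain ⟨C, hC⟩ := h.deriv_U_bdd k hk
      exact ⟨C, fun _ => hC⟩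
  choose A hA using hk
  choose D hD using hk'
  have hA0 : ∀ k, 0 ≤ A k := fun k => (abs_nonneg _).trans (hA k 0)
  set T : ℕ → ℝ := fun k => A k + (|D k| + A k * |m|) with hT
  have hT0 : ∀ k, 0 ≤ T k := fun k => by have := hA0 k; positivity
  have hle : ∀ k, k ≤ 4 → T k ≤ 1 + ∑ j ∈ Finset.range 5, T j := by
    intro k hk
    have := Finset.single_le_sum (f := T) (s := Finset.range 5) (fun j _ => hT0 j)
      (Finset.mem_range.2 (by omega : k < 5))
    linarith
  refine ⟨1 + ∑ j ∈ Finset.range 5, T j, ⟨hasDerivAt_iteratedDeriv_of_smooth h.smooth_H,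
    hasDerivAt_iteratedDeriv_of_smooth hψ, ?_, ?_, ?_⟩⟩
  · intro k hk x
    refine (hA k x).trans (le_trans ?_ (hle k hk))
    have := hA0 k
    have : 0 ≤ |D k| + A k * |m| := by positivity
    simp only [hT]; linarith
  · intro k hk1 hk x
    refine le_trans ?_ (hle k hk)
    have e : iteratedDeriv k (fun x => U x - H x * m) x
        = iteratedDeriv k U x - iteratedDeriv k H x * m := by
      rw [iteratedDeriv_fun_sub, iteratedDeriv_mul_const_field]
      · exact (h.smooth_U.of_le (by exact_mod_cast le_top)).contDiffAt
      · exact ((h.smooth_H.mul contDiff_const).of_le (by exact_mod_cast le_top)).contDiffAt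
    rw [e]
    refine (abs_sub _ _).trans ?_
    rw [abs_mul]
    have h1 := hD k hk1 x
    have h2 := mul_le_mul_of_nonneg_right (hA k x) (abs_nonneg m)
    have h3 := le_abs_self (D k)
    have h4 := hA0 k
    simp only [hT]; linarith
  · have := Finset.sum_nonneg (s := Finset.range 5) fun j _ => hT0 j
    linarith

/-! ### Existence and uniqueness of the limit law -/

/-- Since `H` is bounded, `e^U = e^{yH} p` is dominated by a multiple of the prior density. -/
theorem integrable_exp_potential {y : ℝ} {H p : ℝ → ℝ} (hp_pos : ∀ x, 0 < p x)
    (hp_int : ∫ x, p x = 1) (hHP : HP H (potential y H p)) :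
    Integrable fun x => Real.exp (potential y H p x) := by
  have hp : Integrable p := by
    by_contra h
    rw [integral_undef h] at hp_int
    norm_num at hp_int
  obtain ⟨C, hC⟩ := hHP.H_bdd
  have e : ∀ x, Real.exp (potential y H p x) = Real.exp (y * H x) * p x := fun x => by
    rw [potential, Real.exp_add, Real.exp_log (hp_pos x)]
  refine (hp.const_mul (Real.exp (|y| * C))).mono'
    (Real.continuous_exp.comp hHP.smooth_U.continuous).aestronglyMeasurable
    (ae_of_all _ fun x => ?_)
  rw [Real.norm_eq_abs, abs_of_pos (Real.exp_pos _), e]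
  have h1 : y * H x ≤ |y| * C :=
    (le_abs_self _).trans ((abs_mul _ _).le.trans
      (mul_le_mul_of_nonneg_left (hC x) (abs_nonneg y)))
  exact mul_le_mul_of_nonneg_right (Real.exp_le_exp.2 h1) (hp_pos x).le

section LimitLaw

variable {H U : ℝ → ℝ} {C : ℝ}

theorem integrable_exp_tilt (hH : Continuous H) (hU : Continuous U) (hC : ∀ x, |H x| ≤ C)
    (hI : Integrable fun x => Real.exp (U x)) (m : ℝ) :
    Integrable fun x => Real.exp (U x - H x * m) := by
  refine (hI.mul_const (Real.exp (C * |m|))).mono' (by fun_prop) (ae_of_all _ fun x => ?_)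
  rw [Real.norm_eq_abs, abs_of_pos (Real.exp_pos _), ← Real.exp_add]
  gcongr
  have h1 : -(H x * m) ≤ |H x * m| := neg_le_abs _
  rw [abs_mul] at h1
  have h2 := mul_le_mul_of_nonneg_right (hC x) (abs_nonneg m)
  linarith

theorem integrable_bdd_mul_of_continuous {f g : ℝ → ℝ} {K : ℝ} (hf : Continuous f)
    (hb : ∀ x, |f x| ≤ K) (hg : Integrable g) : Integrable fun x => g x * f x :=
  hg.mul_bdd hf.aestronglyMeasurable (ae_of_all _ hb)

/-- A limit law is determined by its mean `m` of `H`, which must be reproduced by the tilt `exp(U -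
H m)`. The defect is continuous in `m` by dominated convergence, and `|H| ≤ C` gives it opposite
weak signs at `-C` and `C`. -/
theorem exists_tilt_fixed_point (hH : Continuous H) (hU : Continuous U) (hC : ∀ x, |H x| ≤ C)
    (hI : Integrable fun x => Real.exp (U x)) :
    ∃ m : ℝ, ∫ x, Real.exp (U x - H x * m) * H x = m * ∫ x, Real.exp (U x - H x * m) := by
  have hC0 : 0 ≤ C := (abs_nonneg _).trans (hC 0)
  have hb : ∀ m ∈ Set.Icc (-C) C, ∀ x, Real.exp (U x - H x * m) ≤ Real.exp (U x - H x * 0) *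
      Real.exp (C * C) := by
    intro m hm x
    rw [← Real.exp_add]
    gcongr
    have h1 : -(H x * m) ≤ |H x * m| := neg_le_abs _
    rw [abs_mul] at h1
    have h2 := mul_le_mul (hC x) (abs_le.2 hm) (abs_nonneg m) hC0
    linarith
  have hI0 := integrable_exp_tilt hH hU hC hI 0
  have hZ : ContinuousOn (fun m => ∫ x, Real.exp (U x - H x * m)) (Set.Icc (-C) C) := by
    refine continuousOn_of_dominated (bound := fun x => Real.exp (U x - H x * 0) *
      Real.exp (C * C)) (fun m _ => by fun_prop) (fun m hm => ae_of_all _ fun x => ?_)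
      (hI0.mul_const _) (ae_of_all _ fun x => by fun_prop)
    rw [Real.norm_eq_abs, abs_of_pos (Real.exp_pos _)]
    exact hb m hm x
  have hY : ContinuousOn (fun m => ∫ x, Real.exp (U x - H x * m) * H x) (Set.Icc (-C) C) := by
    refine continuousOn_of_dominated (bound := fun x => Real.exp (U x - H x * 0) *
      Real.exp (C * C) * C) (fun m _ => by fun_prop) (fun m hm => ae_of_all _ fun x => ?_)
      ((hI0.mul_const _).mul_const _) (ae_of_all _ fun x => by fun_prop)
    rw [Real.norm_eq_abs, abs_mul, abs_of_pos (Real.exp_pos _)]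
    exact mul_le_mul (hb m hm x) (hC x) (abs_nonneg _) (by positivity)
  have hcont : ContinuousOn (fun m => m * (∫ x, Real.exp (U x - H x * m))
      - ∫ x, Real.exp (U x - H x * m) * H x) (Set.Icc (-C) C) :=
    (continuousOn_id.mul hZ).sub hY
  have hInt := fun m => integrable_exp_tilt hH hU hC hI m
  have hintH := fun m => integrable_bdd_mul_of_continuous hH hC (hInt m)
  have hl : ∫ x, Real.exp (U x - H x * C) * H x ≤ C * ∫ x, Real.exp (U x - H x * C) := by
    rw [← integral_const_mul]
    refine integral_mono (hintH C) ((hInt C).const_mul C) fun x => ?_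
    have := (abs_le.1 (hC x)).2
    simp only
    rw [mul_comm]
    gcongr
  have hr : -C * ∫ x, Real.exp (U x - H x * (-C)) ≤ ∫ x, Real.exp (U x - H x * (-C)) * H x := by
    rw [← integral_const_mul]
    refine integral_mono ((hInt (-C)).const_mul (-C)) (hintH (-C)) fun x => ?_
    have := (abs_le.1 (hC x)).1
    simp only
    rw [mul_comm]
    gcongr
  obtain ⟨m, _, hm⟩ := intermediate_value_Icc (by linarith : -C ≤ C) hcont
    (show (0 : ℝ) ∈ Set.Icc _ _ from ⟨by linarith, by linarith⟩)
  exact ⟨m, by simp only at hm; linarith⟩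

theorem integral_withDensity_exp {f g : ℝ → ℝ} (hf : Continuous f) {c : ℝ} (hc : 0 < c) :
    ∫ x, g x ∂((volume : Measure ℝ).withDensity fun x => ENNReal.ofReal (c * Real.exp (f x)))
      = c * ∫ x, Real.exp (f x) * g x := by
  rw [integral_withDensity_eq_integral_toReal_smul (by fun_prop)
    (ae_of_all _ fun x => ENNReal.ofReal_lt_top), ← integral_const_mul]
  refine integral_congr_ae (ae_of_all _ fun x => ?_)
  simp only [smul_eq_mul]
  rw [ENNReal.toReal_ofReal (by positivity)]
  ring

theorem isProbabilityMeasure_withDensity_exp {f : ℝ → ℝ} {c : ℝ} (hc : 0 < c)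
    (hI : Integrable fun x => Real.exp (f x)) (h1 : c * ∫ x, Real.exp (f x) = 1) :
    IsProbabilityMeasure ((volume : Measure ℝ).withDensity
      fun x => ENNReal.ofReal (c * Real.exp (f x))) := by
  constructor
  rw [withDensity_apply _ MeasurableSet.univ, Measure.restrict_univ,
    ← ofReal_integral_eq_lintegral_ofReal (hI.const_mul c) (ae_of_all _ fun x => by positivity),
    integral_const_mul, h1, ENNReal.ofReal_one]

theorem continuous_psi (hH : Continuous H) (hU : Continuous U) (π : Measure ℝ) :
    Continuous (psi H U π) := by unfold psi; fun_prop

theorem exists_isLimitLaw (hH : Continuous H) (hU : Continuous U) (hC : ∀ x, |H x| ≤ C)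
    (hI : Integrable fun x => Real.exp (U x)) : ∃ π : Measure ℝ, IsLimitLaw H U π := by
  obtain ⟨m, hm⟩ := exists_tilt_fixed_point hH hU hC hI
  have hInt := integrable_exp_tilt hH hU hC hI m
  have hcont : Continuous fun x => U x - H x * m := by fun_prop
  have hZ := integral_exp_pos hInt
  set Z := ∫ x, Real.exp (U x - H x * m) with hZdef
  set π := (volume : Measure ℝ).withDensity
    fun x => ENNReal.ofReal (Z⁻¹ * Real.exp (U x - H x * m)) with hπ
  have hmean : ∫ x, H x ∂π = m := by
    rw [hπ, integral_withDensity_exp hcont (inv_pos.2 hZ), hm]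
    field_simp
  have hpsi : psi H U π = fun x => U x - H x * m := by
    ext x; rw [psi, hmean]
  refine ⟨π, isProbabilityMeasure_withDensity_exp (inv_pos.2 hZ) hInt
    (inv_mul_cancel₀ hZ.ne'), Z⁻¹, inv_pos.2 hZ, ?_⟩
  rw [hpsi]

/-- The properties of the limit law used below. -/
theorem IsLimitLaw.exists_density (hH : Continuous H) (hU : Continuous U) (hC : ∀ x, |H x| ≤ C)
    (hI : Integrable fun x => Real.exp (U x)) {π : Measure ℝ} (h : IsLimitLaw H U π) :
    ∃ c : ℝ, 0 < c ∧ π = (volume : Measure ℝ).withDensity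
        (fun x => ENNReal.ofReal (c * Real.exp (psi H U π x))) ∧
      Integrable (fun x => Real.exp (psi H U π x)) ∧
      c * ∫ x, Real.exp (psi H U π x) = 1 ∧
      ∀ g : ℝ → ℝ, ∫ x, g x ∂π = c * ∫ x, Real.exp (psi H U π x) * g x := by
  obtain ⟨hP, c, hc, hπ⟩ := h
  have hcont := continuous_psi hH hU π
  have hg : ∀ g : ℝ → ℝ, ∫ x, g x ∂π = c * ∫ x, Real.exp (psi H U π x) * g x := by
    intro g
    conv_lhs => rw [hπ]
    exact integral_withDensity_exp hcont hc
  refine ⟨c, hc, hπ, integrable_exp_tilt hH hU hC hI _, ?_, hg⟩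
  have := hg fun _ => 1
  simp only [mul_one] at this
  rw [← this]; simp

/-- The symmetrised relative entropy of two limit laws is nonnegative. The difference of their
log-densities is a constant minus `(m - m') H`, so this entropy equals `-(m - m')²`; hence the means
agree, and then so do the potentials and the normalisations. -/
theorem IsLimitLaw.unique (hH : Continuous H) (hU : Continuous U) (hC : ∀ x, |H x| ≤ C)
    (hI : Integrable fun x => Real.exp (U x)) {π π' : Measure ℝ} (h : IsLimitLaw H U π)
    (h' : IsLimitLaw H U π') : π' = π := by
  obtain ⟨c, hc, hπ, hi, hn, hg⟩ := h.exists_density hH hU hC hI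
  obtain ⟨c', hc', hπ', hi', hn', hg'⟩ := h'.exists_density hH hU hC hI
  have hiH := integrable_bdd_mul_of_continuous hH hC hi
  have hiH' := integrable_bdd_mul_of_continuous hH hC hi'
  have hm := hg H
  have hm' := hg' H
  set m := ∫ x, H x ∂π with hmdef
  set m' := ∫ x, H x ∂π' with hmdef'
  set f : ℝ → ℝ := fun x => Real.exp (psi H U π x) with hf
  set f' : ℝ → ℝ := fun x => Real.exp (psi H U π' x) with hf'
  set k := Real.log c - Real.log c' with hk
  have key : 0 ≤ ∫ x, (c * f x - c' * f' x) * (k - (m - m') * H x) := by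
    refine integral_nonneg fun x => ?_
    have e1 : Real.log (c * f x) = Real.log c + psi H U π x := by
      rw [Real.log_mul hc.ne' (Real.exp_pos _).ne', Real.log_exp]
    have e2 : Real.log (c' * f' x) = Real.log c' + psi H U π' x := by
      rw [Real.log_mul hc'.ne' (Real.exp_pos _).ne', Real.log_exp]
    have e3 : k - (m - m') * H x = Real.log (c * f x) - Real.log (c' * f' x) := by
      rw [e1, e2, hk, psi, psi]; ring
    have p1 : 0 < c * f x := mul_pos hc (Real.exp_pos _)
    have p2 : 0 < c' * f' x := mul_pos hc' (Real.exp_pos _)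
    simp only [Pi.zero_apply]
    rw [e3]
    rcases le_total (c * f x) (c' * f' x) with hle | hle
    · exact mul_nonneg_of_nonpos_of_nonpos (by linarith)
        (by have := Real.log_le_log p1 hle; linarith)
    · exact mul_nonneg (by linarith) (by have := Real.log_le_log p2 hle; linarith)
  have e : ∀ x, (c * f x - c' * f' x) * (k - (m - m') * H x)
      = (k * c * f x - k * c' * f' x) - ((m - m') * c * (f x * H x)
        - (m - m') * c' * (f' x * H x)) := fun x => by ring
  simp_rw [e] at key
  have j1 : Integrable fun x => k * c * f x := hi.const_mul _
  have j2 : Integrable fun x => k * c' * f' x := hi'.const_mul _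
  have j3 : Integrable fun x => (m - m') * c * (f x * H x) := hiH.const_mul _
  have j4 : Integrable fun x => (m - m') * c' * (f' x * H x) := hiH'.const_mul _
  have j5 : Integrable fun x => k * c * f x - k * c' * f' x := j1.sub j2
  have j6 : Integrable fun x => (m - m') * c * (f x * H x) - (m - m') * c' * (f' x * H x) :=
    j3.sub j4
  rw [integral_sub j5 j6, integral_sub j1 j2, integral_sub j3 j4] at key
  simp only [integral_const_mul] at key
  have e5 : (k * c * ∫ x, f x) = k := by rw [mul_assoc, hn, mul_one]
  have e6 : (k * c' * ∫ x, f' x) = k := by rw [mul_assoc, hn', mul_one]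
  have e7 : ((m - m') * c * ∫ x, f x * H x) = (m - m') * m := by rw [mul_assoc, ← hm]
  have e8 : ((m - m') * c' * ∫ x, f' x * H x) = (m - m') * m' := by rw [mul_assoc, ← hm']
  rw [e5, e6, e7, e8] at key
  have hmm : m = m' := by nlinarith [sq_nonneg (m - m')]
  have hpsi : psi H U π' = psi H U π := by
    ext x; simp only [psi, ← hmdef, ← hmdef', hmm]
  have hff : f' = f := by rw [hf, hf', hpsi]
  rw [hff] at hn'
  have hZ : (∫ x, f x) ≠ 0 := by
    intro h0; rw [h0, mul_zero] at hn; norm_num at hn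
  have hcc : c' = c := mul_right_cancel₀ hZ (hn'.trans hn.symm)
  rw [hπ', hπ, hpsi, hcc, ← hπ]

end LimitLaw

/-! ### The constant `τ` -/

/-- The conditional variance of the leading term of the log-acceptance ratio. -/
noncomputable def varTerm (P : ℕ → ℝ → ℝ) (x : ℝ) : ℝ :=
  1 / 144 * (15 * P 3 x ^ 2 + 18 * (P 1 x * P 2 x * P 3 x) + 9 * (P 2 x ^ 2 * P 1 x ^ 2))

/-- Splitting `15 = 9 + 6` shows nonnegativity, and positivity wherever the third derivative is
nonzero. -/
theorem varTerm_eq (P : ℕ → ℝ → ℝ) (x : ℝ) :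
    varTerm P x = 1 / 144 * (9 * (P 1 x * P 2 x + P 3 x) ^ 2 + 6 * P 3 x ^ 2) := by
  rw [varTerm]; ring

theorem varTerm_nonneg (P : ℕ → ℝ → ℝ) (x : ℝ) : 0 ≤ varTerm P x := by
  rw [varTerm_eq]; positivity

section Gibbs

variable {H P : ℕ → ℝ → ℝ} {B c : ℝ} {π : Measure ℝ}

theorem Chain.continuous_varTerm (h : Chain H P B) : Continuous (varTerm P) := by
  have h1 := h.continuous_P 1
  have h2 := h.continuous_P 2
  have h3 := h.continuous_P 3
  unfold varTerm
  fun_prop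

/-- The integrand against `e^ψ` is the derivative of `e^ψ H'`. This cancellation serves twice: it
simplifies `τ²`, and it centres the empirical sum of `H'' + H'ψ'` that governs the interaction. -/
theorem Chain.integral_ibp_eq_zero (h : Chain H P B)
    (hi : Integrable fun x => Real.exp (P 0 x))
    (hg : ∀ g : ℝ → ℝ, ∫ x, g x ∂π = c * ∫ x, Real.exp (P 0 x) * g x) :
    ∫ x, (H 2 x + H 1 x * P 1 x) ∂π = 0 := by
  have hH1 := h.continuous_H 1
  have hH2 := h.continuous_H 2
  have hP1 := h.continuous_P 1
  have hB : 0 ≤ B := zero_le_one.trans h.one_le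
  have hb : ∀ x, |H 2 x + H 1 x * P 1 x| ≤ B + B * B := fun x => by
    refine (abs_add_le _ _).trans ?_
    rw [abs_mul]
    exact add_le_add (h.bH 2 (by norm_num) x) (mul_le_mul (h.bH 1 (by norm_num) x)
      (h.bP 1 le_rfl (by norm_num) x) (abs_nonneg _) hB)
  rw [hg, integral_eq_zero_of_hasDerivAt_of_integrable (f := fun x => Real.exp (P 0 x) * H 1 x)
    (f' := fun x => Real.exp (P 0 x) * (H 2 x + H 1 x * P 1 x)), mul_zero]
  · intro x
    refine ((h.dP 0 x).exp.mul (h.dH 1 x)).congr_deriv ?_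
    ring
  · exact integrable_bdd_mul_of_continuous (by fun_prop) hb hi
  · exact integrable_bdd_mul_of_continuous hH1 (h.bH 1 (by norm_num)) hi

theorem integrable_of_continuous_of_bdd {μ : Measure ℝ} [IsFiniteMeasure μ] {f : ℝ → ℝ} {K : ℝ}
    (hf : Continuous f) (hb : ∀ x, |f x| ≤ K) : Integrable f μ :=
  (integrable_const K).mono' hf.aestronglyMeasurable (ae_of_all _ hb)

theorem abs_mul_le_of_le {a b A B : ℝ} (ha : |a| ≤ A) (hb : |b| ≤ B) : |a * b| ≤ A * B := by
  rw [abs_mul]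
  exact mul_le_mul ha hb (abs_nonneg _) ((abs_nonneg _).trans ha)

theorem abs_pow_le_of_le {a A : ℝ} (ha : |a| ≤ A) (k : ℕ) : |a ^ k| ≤ A ^ k := by
  rw [abs_pow]
  exact pow_le_pow_left₀ (abs_nonneg _) ha k

theorem Chain.abs_varTerm_le (h : Chain H P B) (x : ℝ) : |varTerm P x| ≤ B ^ 4 := by
  have h1 := h.bP 1 le_rfl (by norm_num) x
  have h2 := h.bP 2 (by norm_num) (by norm_num) x
  have h3 := h.bP 3 (by norm_num) (by norm_num) x
  have hB := h.one_le
  have t1 := abs_pow_le_of_le h3 2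
  have t2 := abs_mul_le_of_le (abs_mul_le_of_le h1 h2) h3
  have t3 := abs_mul_le_of_le (abs_pow_le_of_le h2 2) (abs_pow_le_of_le h1 2)
  rw [abs_le] at t1 t2 t3
  have p2 : B ^ 2 ≤ B ^ 4 := pow_le_pow_right₀ hB (by norm_num)
  have p3 : B ^ 3 ≤ B ^ 4 := pow_le_pow_right₀ hB (by norm_num)
  have e3 : B * B * B = B ^ 3 := by ring
  have e4 : B ^ 2 * B ^ 2 = B ^ 4 := by ring
  rw [e3] at t2
  rw [e4] at t3
  rw [varTerm, abs_le]
  constructor <;> linarith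

/-- Both terms of `τ²` involving `H` carry the factor `∫ (H'' + H'ψ') dπ`, which vanishes. -/
theorem Chain.tauSq_eq {H U : ℝ → ℝ} [IsProbabilityMeasure π]
    (h : Chain (fun k => iteratedDeriv k H) (fun k => iteratedDeriv k (psi H U π)) B)
    (hi : Integrable fun x => Real.exp (psi H U π x))
    (hg : ∀ g : ℝ → ℝ, ∫ x, g x ∂π = c * ∫ x, Real.exp (psi H U π x) * g x) :
    tauSq H U π = ∫ x, varTerm (fun k => iteratedDeriv k (psi H U π)) x ∂π := by
  have h0 := h.integral_ibp_eq_zero (π := π) (c := c) (by simpa using hi) (by simpa using hg)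
  have cH1 := h.continuous_H 1
  have cH2 := h.continuous_H 2
  have cP1 := h.continuous_P 1
  have cP2 := h.continuous_P 2
  have cP3 := h.continuous_P 3
  have bH1 := h.bH 1 (by norm_num)
  have bH2 := h.bH 2 (by norm_num)
  have bP1 := h.bP 1 le_rfl (by norm_num)
  have bP2 := h.bP 2 (by norm_num) (by norm_num)
  have bP3 := h.bP 3 (by norm_num) (by norm_num)
  have i1 : Integrable (fun x => iteratedDeriv 2 H x) π := integrable_of_continuous_of_bdd cH2 bH2
  have i2 : Integrable (fun x => iteratedDeriv 1 H x * iteratedDeriv 1 (psi H U π) x) π :=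
    integrable_of_continuous_of_bdd (cH1.mul cP1) fun x => abs_mul_le_of_le (bH1 x) (bP1 x)
  have i3 : Integrable (fun x => iteratedDeriv 3 (psi H U π) x ^ 2) π :=
    integrable_of_continuous_of_bdd (cP3.pow 2) fun x => abs_pow_le_of_le (bP3 x) 2
  have i4 : Integrable (fun x => iteratedDeriv 1 (psi H U π) x * iteratedDeriv 2 (psi H U π) x
      * iteratedDeriv 3 (psi H U π) x) π :=
    integrable_of_continuous_of_bdd ((cP1.mul cP2).mul cP3) fun x =>
      abs_mul_le_of_le (abs_mul_le_of_le (bP1 x) (bP2 x)) (bP3 x)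
  have i5 : Integrable (fun x => iteratedDeriv 2 (psi H U π) x ^ 2
      * iteratedDeriv 1 (psi H U π) x ^ 2) π :=
    integrable_of_continuous_of_bdd ((cP2.pow 2).mul (cP1.pow 2)) fun x =>
      abs_mul_le_of_le (abs_pow_le_of_le (bP2 x) 2) (abs_pow_le_of_le (bP1 x) 2)
  have h0' := h0
  rw [integral_add i1 i2] at h0'
  simp only [tauSq, varTerm]
  rw [h0, h0', integral_const_mul, integral_add ((i3.const_mul 15).fun_add (i4.const_mul 18))
    (i5.const_mul 9), integral_add (i3.const_mul 15) (i4.const_mul 18)]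
  simp only [integral_const_mul]
  ring

/-- If the third derivative vanishes identically and the first one is bounded, then the function is
affine, hence cannot tend to `-∞` at both ends. -/
theorem Chain.exists_P_three_ne_zero (h : Chain H P B)
    (hbot : Tendsto (P 0) (cocompact ℝ) atBot) : ∃ x, P 3 x ≠ 0 := by
  by_contra hcon
  push Not at hcon
  have t1 : ∀ δ, P 1 δ = P 1 0 + P 2 0 * δ := by
    intro δ
    have := abs_taylor_remainder_le (n := 2) (F := fun k => P (k + 1)) (fun k x => h.dP (k + 1) x)
      (B := 0) (fun x => by simp [hcon x]) 0 δ
    rw [zero_mul] at this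
    have := abs_nonpos_iff.1 this
    simp [Finset.sum_range_succ] at this
    linarith
  have h20 : P 2 0 = 0 := by
    by_contra hne
    have h1 := h.bP 1 le_rfl (by norm_num) ((2 * B + 1) / P 2 0)
    have h2 := h.bP 1 le_rfl (by norm_num) 0
    rw [t1, mul_div_cancel₀ _ hne, abs_le] at h1
    rw [abs_le] at h2
    linarith
  have t0 : ∀ δ, P 0 δ = P 0 0 + P 1 0 * δ := by
    intro δ
    have := abs_taylor_remainder_le (n := 3) h.dP (B := 0) (fun x => by simp [hcon x]) 0 δ
    rw [zero_mul] at this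
    have := abs_nonpos_iff.1 this
    simp [Finset.sum_range_succ, h20] at this
    linarith
  rw [cocompact_eq_atBot_atTop, tendsto_sup] at hbot
  have e1 := (hbot.2.eventually (eventually_lt_atBot (P 0 0)))
  have e2 := (tendsto_neg_atTop_atBot.eventually
    (hbot.1.eventually (eventually_lt_atBot (P 0 0))))
  obtain ⟨δ, a1, a2⟩ := (e1.and e2).exists
  rw [t0 δ] at a1
  rw [t0 (-δ)] at a2
  linarith

/-- The density is everywhere positive, so one point with nonzero third derivative makes the
integral of the continuous nonnegative integrand positive. -/
theorem Chain.integral_varTerm_pos [IsProbabilityMeasure π] (h : Chain H P B)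
    (hbot : Tendsto (P 0) (cocompact ℝ) atBot) (hc : 0 < c)
    (hi : Integrable fun x => Real.exp (P 0 x))
    (hg : ∀ g : ℝ → ℝ, ∫ x, g x ∂π = c * ∫ x, Real.exp (P 0 x) * g x) :
    0 < ∫ x, varTerm P x ∂π := by
  obtain ⟨x₀, hx₀⟩ := h.exists_P_three_ne_zero hbot
  rw [hg]
  refine mul_pos hc ?_
  have hcont : Continuous fun x => Real.exp (P 0 x) * varTerm P x :=
    (Real.continuous_exp.comp (h.continuous_P 0)).mul h.continuous_varTerm
  refine integral_pos_of_integrable_nonneg_nonzero (x := x₀) hcont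
    (integrable_bdd_mul_of_continuous h.continuous_varTerm h.abs_varTerm_le hi)
    (fun x => mul_nonneg (Real.exp_pos _).le (varTerm_nonneg P x)) ?_
  refine mul_ne_zero (Real.exp_pos _).ne' ?_
  rw [varTerm_eq]
  have : 0 < P 3 x₀ ^ 2 := by positivity
  positivity

end Gibbs

/-! ### Comparison of the posterior with a product measure -/

theorem pi_withDensity_ofReal (N : ℕ) {g : ℝ → ℝ} (hg : Integrable g) (h0 : ∀ x, 0 ≤ g x) :
    Measure.pi (fun _ : Fin N => (volume : Measure ℝ).withDensity fun x => ENNReal.ofReal (g x))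
      = (volume : Measure (Fin N → ℝ)).withDensity fun x => ENNReal.ofReal (∏ i, g (x i)) := by
  have : IsFiniteMeasure ((volume : Measure ℝ).withDensity fun x => ENNReal.ofReal (g x)) :=
    isFiniteMeasure_withDensity_ofReal hg.2
  refine Measure.pi_eq fun s hs => ?_
  have hbox : MeasurableSet (Set.univ.pi s) := MeasurableSet.univ_pi hs
  rw [withDensity_apply _ hbox, ← lintegral_indicator hbox]
  have e : ∀ x : Fin N → ℝ, (Set.univ.pi s).indicator (fun x => ENNReal.ofReal (∏ i, g (x i))) x
      = ENNReal.ofReal (∏ i, (s i).indicator g (x i)) := by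
    intro x
    by_cases hx : x ∈ Set.univ.pi s
    · rw [Set.indicator_of_mem hx]
      congr 1
      refine Finset.prod_congr rfl fun i _ => ?_
      rw [Set.indicator_of_mem (hx i (Set.mem_univ i))]
    · rw [Set.indicator_of_notMem hx]
      obtain ⟨i, hi⟩ : ∃ i, x i ∉ s i := by simpa using hx
      rw [Finset.prod_eq_zero (Finset.mem_univ i) (Set.indicator_of_notMem hi g),
        ENNReal.ofReal_zero]
  simp_rw [e]
  have hi : ∀ i, Integrable ((s i).indicator g) := fun i => hg.indicator (hs i)
  have hn : ∀ i x, 0 ≤ (s i).indicator g x := fun i x => Set.indicator_nonneg (fun y _ => h0 y) x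
  have hprod : Integrable fun x : Fin N → ℝ => ∏ i, (s i).indicator g (x i) :=
    Integrable.fintype_prod hi
  rw [← ofReal_integral_eq_lintegral_ofReal hprod
    (ae_of_all _ fun x => Finset.prod_nonneg fun i _ => hn i _),
    integral_fintype_prod_volume_eq_prod, ENNReal.ofReal_prod_of_nonneg
      (fun i _ => integral_nonneg (hn i))]
  refine Finset.prod_congr rfl fun i _ => ?_
  rw [withDensity_apply _ (hs i), integral_indicator (hs i),
    ofReal_integral_eq_lintegral_ofReal hg.integrableOn (ae_of_all _ h0)]

section Posterior

variable {H U : ℝ → ℝ} {C c : ℝ} {π : Measure ℝ}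

/-- Completing the square around `m`: the linear part becomes the tilt of each coordinate, and what
remains of the interaction is a nonpositive square and a constant. -/
theorem logWeight_eq {N : ℕ} (hN : 0 < N) (m : ℝ) (x : Fin N → ℝ) :
    logWeight H U N x = ∑ i, (U (x i) - H (x i) * m)
      - (N : ℝ) / 2 * (1 / (N : ℝ) * ∑ i, H (x i) - m) ^ 2 + (N : ℝ) * m ^ 2 / 2 := by
  have hN' : (N : ℝ) ≠ 0 := by positivity
  rw [logWeight, ← Finset.sum_mul_sum, Finset.sum_sub_distrib, ← Finset.sum_mul]
  field_simp
  ring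

theorem exp_logWeight_eq {N : ℕ} (hN : 0 < N) (hc : 0 < c) (x : Fin N → ℝ) :
    Real.exp (logWeight H U N x) =
      Real.exp ((N : ℝ) * (∫ z, H z ∂π) ^ 2 / 2) / c ^ N *
      ((∏ i, (c * Real.exp (psi H U π (x i)))) *
        Real.exp (-((N : ℝ) / 2 * (1 / (N : ℝ) * ∑ i, H (x i) - ∫ z, H z ∂π) ^ 2))) := by
  rw [logWeight_eq hN (∫ z, H z ∂π), Finset.prod_mul_distrib, Finset.prod_const, Finset.card_univ,
    Fintype.card_fin, ← Real.exp_sum, sub_add_eq_add_sub, sub_eq_add_neg, Real.exp_add,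
    Real.exp_add]
  have : c ^ N ≠ 0 := by positivity
  field_simp
  rfl

/-- Relative to the product law the density is `e^{-T} / D` with `T ≥ 0` and `D` the mean of
`e^{-T}`. Independence bounds the mean of `T`, half the variance of `H`, by `2C²`, so `D ≥ e^{-2C²}`
whatever `N` is. -/
theorem exists_post_le_pi [IsProbabilityMeasure π] (hH : Continuous H) (hU : Continuous U)
    (hC : ∀ x, |H x| ≤ C) (hc : 0 < c)
    (hπ : π = (volume : Measure ℝ).withDensity
        (fun x => ENNReal.ofReal (c * Real.exp (psi H U π x))))
    (hi : Integrable (fun x => Real.exp (psi H U π x))) {N : ℕ} (hN : 0 < N) :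
    (0 < ∫ z : Fin N → ℝ, Real.exp (logWeight H U N z)) ∧
    ∀ A : Set (Fin N → ℝ), MeasurableSet A →
      (post H U N).real A ≤ Real.exp (2 * C ^ 2) * (Measure.pi fun _ : Fin N => π).real A := by
  have hC0 : 0 ≤ C := (abs_nonneg _).trans (hC 0)
  have hN' : (0 : ℝ) < N := by positivity
  set m := ∫ z, H z ∂π with hm
  set ν : Measure (Fin N → ℝ) := Measure.pi fun _ => π with hν
  set g : ℝ → ℝ := fun x => c * Real.exp (psi H U π x) with hg
  have hgc : Continuous g := by
    have := continuous_psi hH hU π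
    fun_prop
  have hg0 : ∀ x, 0 ≤ g x := fun x => by positivity
  have hgi : Integrable g := hi.const_mul c
  have hνd : ν = (volume : Measure (Fin N → ℝ)).withDensity
      fun x => ENNReal.ofReal (∏ i, g (x i)) := by
    rw [← pi_withDensity_ofReal N hgi hg0, ← hπ]
  set T : (Fin N → ℝ) → ℝ := fun x =>
    (N : ℝ) / 2 * (1 / (N : ℝ) * ∑ i, H (x i) - m) ^ 2 with hT
  have hTc : Continuous T := by fun_prop
  have hT0 : ∀ x, 0 ≤ T x := fun x => by positivity
  set k : ℝ := Real.exp ((N : ℝ) * m ^ 2 / 2) / c ^ N with hk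
  have hk0 : 0 < k := by positivity
  have hW : ∀ x : Fin N → ℝ, Real.exp (logWeight H U N x)
      = k * ((∏ i, g (x i)) * Real.exp (-T x)) := fun x => exp_logWeight_eq hN hc x
  have hgprod : Continuous fun x : Fin N → ℝ => ∏ i, g (x i) := by fun_prop
  have hprodi : Integrable fun x : Fin N → ℝ => ∏ i, g (x i) :=
    Integrable.fintype_prod fun _ => hgi
  have hD1 : ∀ x, Real.exp (-T x) ≤ 1 := fun x => by
    rw [Real.exp_le_one_iff]; linarith [hT0 x]
  have hprod0 : ∀ x : Fin N → ℝ, 0 ≤ ∏ i, g (x i) := fun x =>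
    Finset.prod_nonneg fun i _ => hg0 _
  have hWi : Integrable fun x : Fin N → ℝ => (∏ i, g (x i)) * Real.exp (-T x) := by
    refine hprodi.mul_bdd (c := 1) (by fun_prop) (ae_of_all _ fun x => ?_)
    rw [Real.norm_eq_abs, abs_of_pos (Real.exp_pos _)]
    exact hD1 x
  have hLi : Integrable fun x : Fin N → ℝ => Real.exp (logWeight H U N x) := by
    simp_rw [hW]; exact hWi.const_mul k
  have hZpos : 0 < ∫ z : Fin N → ℝ, Real.exp (logWeight H U N z) := integral_exp_pos hLi
  set D : ℝ := ∫ x : Fin N → ℝ, (∏ i, g (x i)) * Real.exp (-T x) with hDdef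
  have hZ : ∫ z : Fin N → ℝ, Real.exp (logWeight H U N z) = k * D := by
    simp_rw [hW]; rw [integral_const_mul]
  have hDν : D = ∫ x, Real.exp (-T x) ∂ν := by
    rw [hνd, integral_withDensity_eq_integral_toReal_smul (by fun_prop)
      (ae_of_all _ fun x => ENNReal.ofReal_lt_top)]
    refine integral_congr_ae (ae_of_all _ fun x => ?_)
    simp only [smul_eq_mul]
    rw [ENNReal.toReal_ofReal (hprod0 x)]
  -- the partition function is bounded below
  have hTint : ∫ x, T x ∂ν ≤ 2 * C ^ 2 := by
    have hmC : |m| ≤ C := by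
      have := norm_integral_le_of_norm_le_const (μ := π) (f := H) (C := C) (ae_of_all _ hC)
      simpa using this
    have hX : ∀ z, |H z - m| ≤ 2 * C := fun z => by
      have := abs_sub (H z) m
      linarith [hC z]
    have hHi : Integrable H π := integrable_of_continuous_of_bdd hH hC
    have hmp : ∀ i : Fin N, MeasurePreserving (Function.eval i) ν π :=
      fun i => measurePreserving_eval _ i
    have hev : ∀ (i : Fin N) (h : ℝ → ℝ), Measurable h →
        ∫ w, h (w i) ∂ν = ∫ z, h z ∂π := by
      intro i h hh
      rw [← (hmp i).map_eq, integral_map (hmp i).measurable.aemeasurable hh.aestronglyMeasurable]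
    have hmeas : Measurable fun z => H z - m := (hH.sub continuous_const).measurable
    have hL : MemLp (fun z => H z - m) 4 π :=
      MemLp.of_bound hmeas.aestronglyMeasurable (2 * C) (ae_of_all _ hX)
    have hbk : ∀ j : ℕ, ∫ z, (H z - m) ^ j ∂π ≤ (2 * C) ^ j := by
      intro j
      have := norm_integral_le_of_norm_le_const (μ := π) (f := fun z => (H z - m) ^ j)
        (C := (2 * C) ^ j) (ae_of_all _ fun z => abs_pow_le_of_le (hX z) j)
      simp only [probReal_univ, mul_one] at this
      exact (le_abs_self _).trans this
    have hind : iIndepFun (fun (i : Fin N) (w : Fin N → ℝ) => H (w i) - m) ν :=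
      iIndepFun_pi (X := fun (_ : Fin N) z => H z - m) fun i => hmeas.aemeasurable
    obtain ⟨-, h2, -⟩ := moments_sum_le hind (fun i => hmeas.comp (measurable_pi_apply i))
      (fun i => hL.comp_measurePreserving (hmp i))
      (fun i => by
        rw [hev i _ hmeas, integral_sub hHi (integrable_const _)]; simp [hm])
      (A := (2 * C) ^ 2) (by positivity)
      (fun i => by rw [hev i (fun z => (H z - m) ^ 2) (hmeas.pow_const 2)]; exact hbk 2)
      (fun i => by
        rw [hev i (fun z => (H z - m) ^ 4) (hmeas.pow_const 4), ← pow_mul]; exact hbk 4)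
      Finset.univ
    have e : ∀ x, T x = 1 / (2 * (N : ℝ)) * (∑ i, (H (x i) - m)) ^ 2 := fun x => by
      simp only [hT]
      rw [Finset.sum_sub_distrib, Finset.sum_const, Finset.card_univ, Fintype.card_fin,
        nsmul_eq_mul]
      field_simp
    simp_rw [e]
    rw [integral_const_mul]
    simp only [Finset.card_univ, Fintype.card_fin] at h2
    calc _ ≤ 1 / (2 * (N : ℝ)) * (N * (2 * C) ^ 2) := by gcongr
      _ = 2 * C ^ 2 := by field_simp
  have hTi : Integrable T ν := by
    refine (integrable_const ((N : ℝ) / 2 * (C + |m|) ^ 2)).mono' hTc.aestronglyMeasurable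
      (ae_of_all _ fun x => ?_)
    rw [Real.norm_eq_abs, abs_of_nonneg (hT0 x)]
    simp only [hT]
    rw [← sq_abs (1 / (N : ℝ) * ∑ i, H (x i) - m)]
    gcongr
    refine (abs_sub _ _).trans ?_
    gcongr
    rw [abs_mul, abs_of_pos (by positivity)]
    calc 1 / (N : ℝ) * |∑ i, H (x i)| ≤ 1 / (N : ℝ) * ∑ _i : Fin N, C := by
          gcongr
          exact (Finset.abs_sum_le_sum_abs _ _).trans (Finset.sum_le_sum fun i _ => hC _)
      _ = C := by simp; field_simp
  have hDlow : Real.exp (-(2 * C ^ 2)) ≤ D := by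
    -- Jensen's inequality by hand: the tangent line of the exponential is placed at the bound `2 *
    -- C ^ 2` on the mean of `T`.
    have h1 : ∀ x, Real.exp (-(2 * C ^ 2)) * (1 + 2 * C ^ 2 - T x) ≤ Real.exp (-T x) := fun x => by
      have := Real.add_one_le_exp (2 * C ^ 2 - T x)
      calc _ ≤ Real.exp (-(2 * C ^ 2)) * Real.exp (2 * C ^ 2 - T x) := by gcongr; linarith
        _ = _ := by rw [← Real.exp_add]; ring_nf
    have h2 : ∫ x, Real.exp (-(2 * C ^ 2)) * (1 + 2 * C ^ 2 - T x) ∂ν ≤ D := by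
      rw [hDν]
      refine integral_mono (((integrable_const _).sub hTi).const_mul _) ?_ h1
      refine (integrable_const (1 : ℝ)).mono' (by fun_prop) (ae_of_all _ fun x => ?_)
      rw [Real.norm_eq_abs, abs_of_pos (Real.exp_pos _)]
      exact hD1 x
    rw [integral_const_mul, integral_sub (integrable_const _) hTi] at h2
    simp only [integral_const, probReal_univ, smul_eq_mul, one_mul] at h2
    refine le_trans ?_ h2
    have := Real.exp_pos (-(2 * C ^ 2))
    nlinarith
  refine ⟨hZpos, fun A hA => ?_⟩
  have hD0 : 0 < D := (Real.exp_pos _).trans_le hDlow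
  have hdens : ∀ x : Fin N → ℝ, postDensity H U N x ≤ Real.exp (2 * C ^ 2) * ∏ i, g (x i) := by
    intro x
    rw [postDensity, hZ, hW, mul_div_mul_left _ _ hk0.ne', div_le_iff₀ hD0]
    have h1 : 1 ≤ Real.exp (2 * C ^ 2) * D := by
      have := mul_le_mul_of_nonneg_left hDlow (Real.exp_pos (2 * C ^ 2)).le
      rw [← Real.exp_add, add_neg_cancel, Real.exp_zero] at this
      exact this
    have h2 := hprod0 x
    calc (∏ i, g (x i)) * Real.exp (-T x) ≤ (∏ i, g (x i)) * (Real.exp (2 * C ^ 2) * D) := by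
          gcongr; exact (hD1 x).trans h1
      _ = _ := by ring
  rw [measureReal_def, measureReal_def, ← ENNReal.toReal_ofReal (Real.exp_pos (2 * C ^ 2)).le,
    ← ENNReal.toReal_mul]
  refine ENNReal.toReal_mono (ENNReal.mul_ne_top ENNReal.ofReal_ne_top (measure_ne_top _ _)) ?_
  rw [post, hνd, withDensity_apply _ hA, withDensity_apply _ hA,
    ← lintegral_const_mul _ (by fun_prop)]
  refine lintegral_mono fun x => ?_
  rw [← ENNReal.ofReal_mul (Real.exp_pos _).le]
  exact ENNReal.ofReal_le_ofReal (hdens x)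

end Posterior

/-! ### Concentration of empirical means -/

/-- A variable in `[-C, C]` is sub-Gaussian with parameter `C²`; the two tails come from `f` and
`-f`. -/
theorem hoeffding_pi {π : Measure ℝ} [IsProbabilityMeasure π] {f : ℝ → ℝ} (hf : Measurable f)
    {C : ℝ} (hC : ∀ x, |f x| ≤ C) (N : ℕ) {t : ℝ} (ht : 0 ≤ t) :
    (Measure.pi fun _ : Fin N => π).real {x | t < |∑ i, f (x i) - N * ∫ z, f z ∂π|}
      ≤ 2 * Real.exp (-t ^ 2 / (2 * (N * C ^ 2))) := by
  have hC0 : 0 ≤ C := (abs_nonneg _).trans (hC 0)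
  have key : ∀ g : ℝ → ℝ, Measurable g → (∀ x, |g x| ≤ C) →
      (Measure.pi fun _ : Fin N => π).real {x | t ≤ ∑ i, (g (x i) - ∫ z, g z ∂π)}
        ≤ Real.exp (-t ^ 2 / (2 * (N * C ^ 2))) := by
    intro g hg hgC
    have hsub : HasSubgaussianMGF (fun z => g z - ∫ z, g z ∂π) ((‖C - (-C)‖₊ / 2) ^ 2) π :=
      hasSubgaussianMGF_of_mem_Icc hg.aemeasurable (ae_of_all _ fun x => abs_le.1 (hgC x))
    have hmp : ∀ i : Fin N,
        MeasurePreserving (Function.eval i) (Measure.pi fun _ : Fin N => π) π :=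
      fun i => measurePreserving_eval _ i
    have hind : iIndepFun (fun (i : Fin N) (w : Fin N → ℝ) => g (w i) - ∫ z, g z ∂π)
        (Measure.pi fun _ : Fin N => π) :=
      iIndepFun_pi (X := fun (_ : Fin N) z => g z - ∫ z, g z ∂π)
        fun i => (hg.sub_const _).aemeasurable
    have h := HasSubgaussianMGF.measure_sum_ge_le_of_iIndepFun hind
      (c := fun _ => (‖C - (-C)‖₊ / 2) ^ 2) (s := Finset.univ)
      (fun i _ => by
        have hs : HasSubgaussianMGF (fun z => g z - ∫ z, g z ∂π) ((‖C - (-C)‖₊ / 2) ^ 2)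
            ((Measure.pi fun _ : Fin N => π).map (Function.eval i)) := by
          rw [(hmp i).map_eq]; exact hsub
        exact HasSubgaussianMGF.of_map (hmp i).measurable.aemeasurable hs) ht
    refine h.trans (le_of_eq ?_)
    congr 2
    simp only [Finset.sum_const, Finset.card_univ, Fintype.card_fin, nsmul_eq_mul]
    push_cast
    rw [Real.norm_eq_abs, sub_neg_eq_add, abs_of_nonneg (by linarith)]
    ring
  have h1 := key f hf hC
  have h2 := key (fun x => -f x) hf.neg (fun x => by simpa using hC x)
  have hsub : {x : Fin N → ℝ | t < |∑ i, f (x i) - N * ∫ z, f z ∂π|} ⊆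
      {x | t ≤ ∑ i, (f (x i) - ∫ z, f z ∂π)} ∪ {x | t ≤ ∑ i, (-f (x i) - ∫ z, -f z ∂π)} := by
    intro x hx
    simp only [Set.mem_union, Set.mem_ofPred_eq, Finset.sum_sub_distrib, Finset.sum_neg_distrib,
      Finset.sum_const, Finset.card_univ, Fintype.card_fin, nsmul_eq_mul, integral_neg] at hx ⊢
    rcases lt_abs.1 hx with h | h
    · left; linarith
    · right; linarith
  refine (measureReal_mono hsub (measure_ne_top _ _)).trans
    ((measureReal_union_le _ _).trans ?_)
  linarith

/-! ### Low order Taylor expansions -/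

section Taylor

variable {Q : ℕ → ℝ → ℝ} {B : ℝ}

theorem abs_taylor_one_le (hQ : ∀ k x, HasDerivAt (Q k) (Q (k + 1) x) x) (k : ℕ)
    (hB : ∀ x, |Q (k + 1) x| ≤ B) (x δ : ℝ) : |Q k (x + δ) - Q k x| ≤ B * |δ| := by
  have := abs_taylor_remainder_le (n := 1) (F := fun j => Q (k + j)) (fun j x => hQ (k + j) x) hB x δ
  simpa [Finset.sum_range_succ] using this

theorem abs_taylor_two_le (hQ : ∀ k x, HasDerivAt (Q k) (Q (k + 1) x) x) (k : ℕ)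
    (hB : ∀ x, |Q (k + 2) x| ≤ B) (x δ : ℝ) :
    |Q k (x + δ) - (Q k x + Q (k + 1) x * δ)| ≤ B * |δ| ^ 2 := by
  have := abs_taylor_remainder_le (n := 2) (F := fun j => Q (k + j)) (fun j x => hQ (k + j) x) hB x δ
  simpa [Finset.sum_range_succ] using this

theorem abs_taylor_three_le (hQ : ∀ k x, HasDerivAt (Q k) (Q (k + 1) x) x) (k : ℕ)
    (hB : ∀ x, |Q (k + 3) x| ≤ B) (x δ : ℝ) :
    |Q k (x + δ) - (Q k x + Q (k + 1) x * δ + Q (k + 2) x * δ ^ 2 / 2)| ≤ B * |δ| ^ 3 := by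
  have := abs_taylor_remainder_le (n := 3) (F := fun j => Q (k + j)) (fun j x => hQ (k + j) x) hB x δ
  simpa [Finset.sum_range_succ, Nat.factorial] using this

theorem abs_taylor_four_le (hQ : ∀ k x, HasDerivAt (Q k) (Q (k + 1) x) x) (k : ℕ)
    (hB : ∀ x, |Q (k + 4) x| ≤ B) (x δ : ℝ) :
    |Q k (x + δ) - (Q k x + Q (k + 1) x * δ + Q (k + 2) x * δ ^ 2 / 2 + Q (k + 3) x * δ ^ 3 / 6)|
      ≤ B * |δ| ^ 4 := by
  have := abs_taylor_remainder_le (n := 4) (F := fun j => Q (k + j)) (fun j x => hQ (k + j) x) hB x δ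
  simpa [Finset.sum_range_succ, Nat.factorial] using this

theorem abs_taylor_mul_le {Q R : ℕ → ℝ → ℝ} (hQ : ∀ k x, HasDerivAt (Q k) (Q (k + 1) x) x)
    (hR : ∀ k x, HasDerivAt (R k) (R (k + 1) x) x) (bQ : ∀ k, 1 ≤ k → k ≤ 3 → ∀ x, |Q k x| ≤ B)
    (bR : ∀ k, 1 ≤ k → k ≤ 3 → ∀ x, |R k x| ≤ B) (x δ : ℝ) :
    |Q 1 (x + δ) * R 1 (x + δ) - (Q 1 x * R 1 x + (Q 2 x * R 1 x + Q 1 x * R 2 x) * δ)|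
      ≤ 3 * B ^ 2 * |δ| ^ 2 := by
  have h1 := abs_taylor_two_le hQ 1 (bQ 3 (by norm_num) le_rfl) x δ
  have h2 := abs_taylor_two_le hR 1 (bR 3 (by norm_num) le_rfl) x δ
  have h3 := abs_taylor_one_le hR 1 (bR 2 (by norm_num) (by norm_num)) x δ
  have e : Q 1 (x + δ) * R 1 (x + δ) - (Q 1 x * R 1 x + (Q 2 x * R 1 x + Q 1 x * R 2 x) * δ)
      = (Q 1 (x + δ) - (Q 1 x + Q 2 x * δ)) * R 1 (x + δ)
        + Q 1 x * (R 1 (x + δ) - (R 1 x + R 2 x * δ)) + Q 2 x * (δ * (R 1 (x + δ) - R 1 x)) := by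
    ring
  have t1 := abs_mul_le_of_le h1 (bR 1 le_rfl (by norm_num) (x + δ))
  have t2 := abs_mul_le_of_le (bQ 1 le_rfl (by norm_num) x) h2
  have t3 := abs_mul_le_of_le (bQ 2 (by norm_num) (by norm_num) x)
    (abs_mul_le_of_le (le_refl |δ|) h3)
  rw [e]
  refine (abs_add_three _ _ _).trans ?_
  nlinarith

end Taylor

/-! ### Increments of the proposal -/

/-- The increment of one coordinate of the proposal. -/
noncomputable def incr (σ d w : ℝ) : ℝ := σ * w + σ ^ 2 / 2 * d

theorem continuous_incr (σ d : ℝ) : Continuous (incr σ d) := by unfold incr; fun_prop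

theorem abs_incr_le {σ d D : ℝ} (h0 : 0 ≤ σ) (h1 : σ ≤ 1) (hD : 1 ≤ D) (hd : |d| ≤ D) (w : ℝ) :
    |incr σ d w| ≤ D * σ * (1 + |w|) := by
  have h2 : |incr σ d w| ≤ σ * |w| + σ ^ 2 / 2 * |d| := by
    refine (abs_add_le _ _).trans (le_of_eq ?_)
    rw [abs_mul, abs_mul, abs_of_nonneg h0, abs_of_nonneg (by positivity : 0 ≤ σ ^ 2 / 2)]
  have h3 : σ ^ 2 / 2 * |d| ≤ σ * D := by
    have : σ ^ 2 / 2 ≤ σ := by nlinarith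
    gcongr
  have h4 : σ * |w| ≤ D * (σ * |w|) := by
    have : 0 ≤ σ * |w| := by positivity
    nlinarith
  nlinarith

theorem abs_incr_pow_le {σ d D : ℝ} (h0 : 0 ≤ σ) (h1 : σ ≤ 1) (hD : 1 ≤ D) (hd : |d| ≤ D) {k : ℕ}
    (hk : k ≤ 4) (w : ℝ) : |incr σ d w| ^ k ≤ D ^ k * σ ^ k * wt w := by
  calc |incr σ d w| ^ k ≤ (D * σ * (1 + |w|)) ^ k := by
        gcongr; exact abs_incr_le h0 h1 hD hd w
    _ = D ^ k * σ ^ k * (1 + |w|) ^ k := by rw [mul_pow, mul_pow]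
    _ ≤ _ := by gcongr; exact one_add_abs_pow_le_wt hk w

theorem wt_nonneg (w : ℝ) : 0 ≤ wt w := zero_le_one.trans (one_le_wt w)

/-- The expected value of the weight `wt`. -/
noncomputable def wtMean : ℝ := ∫ w, wt w ∂(gaussianReal 0 1)

theorem one_le_wtMean : 1 ≤ wtMean := by
  have : ∫ z : ℝ, (1 : ℝ) ∂(gaussianReal 0 1) ≤ wtMean :=
    integral_mono (integrable_const _) integrable_wt one_le_wt
  simpa using this

theorem integrable_of_abs_le_wt {f : ℝ → ℝ} (hf : Continuous f) {c : ℝ}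
    (h : ∀ w, |f w| ≤ c * wt w) : Integrable f (gaussianReal 0 1) :=
  (integrable_wt.const_mul c).mono' hf.aestronglyMeasurable (ae_of_all _ h)

theorem abs_integral_le_of_abs_le_wt {f : ℝ → ℝ} {c : ℝ} (h : ∀ w, |f w| ≤ c * wt w) :
    |∫ w, f w ∂(gaussianReal 0 1)| ≤ c * wtMean := by
  rw [wtMean, ← integral_const_mul, ← Real.norm_eq_abs]
  exact norm_integral_le_of_norm_le (integrable_wt.const_mul c) (ae_of_all _ h)

theorem integral_cubic_gaussian (a b c d : ℝ) :
    Integrable (fun w : ℝ => a + b * w + c * w ^ 2 + d * w ^ 3) (gaussianReal 0 1) ∧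
    ∫ w : ℝ, (a + b * w + c * w ^ 2 + d * w ^ 3) ∂(gaussianReal 0 1) = a + c := by
  have i1 : Integrable (fun w : ℝ => w) (gaussianReal 0 1) := by
    simpa using integrable_pow_gaussian 1
  have j1 : Integrable (fun w : ℝ => a + b * w) (gaussianReal 0 1) :=
    (integrable_const a).fun_add (i1.const_mul b)
  have j2 : Integrable (fun w : ℝ => a + b * w + c * w ^ 2) (gaussianReal 0 1) :=
    j1.fun_add ((integrable_pow_gaussian 2).const_mul c)
  refine ⟨j2.fun_add ((integrable_pow_gaussian 3).const_mul d), ?_⟩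
  rw [integral_add j2 ((integrable_pow_gaussian 3).const_mul d),
    integral_add j1 ((integrable_pow_gaussian 2).const_mul c),
    integral_add (integrable_const a) (i1.const_mul b), integral_const_mul, integral_const_mul,
    integral_const_mul, integral_pow_one_gaussian, integral_pow_two_gaussian,
    integral_pow_three_gaussian]
  simp

/-- The mean and the size of a function that is a cubic polynomial in the increment up to an error
of fourth order. -/
theorem mean_and_size_of_expansion {a : ℝ → ℝ} (ha : Continuous a) {σ d D M c₀ c₁ c₂ c₃ : ℝ}
    (h0 : 0 ≤ σ) (h1 : σ ≤ 1) (hD : 1 ≤ D) (hd : |d| ≤ D) (hc₁ : |c₁| ≤ M) (hc₂ : |c₂| ≤ M)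
    (hc₃ : |c₃| ≤ M)
    (h : ∀ w, |a w - (c₀ + c₁ * incr σ d w + c₂ * incr σ d w ^ 2 + c₃ * incr σ d w ^ 3)|
      ≤ M * σ ^ 4 * wt w) :
    |∫ w, a w ∂(gaussianReal 0 1) - (c₀ + σ ^ 2 * (c₁ * d / 2 + c₂))|
        ≤ 4 * M * D ^ 3 * wtMean * σ ^ 4 ∧
      ∀ w, |a w - c₀| ≤ 4 * M * D ^ 3 * σ * wt w := by
  have hM : 0 ≤ M := (abs_nonneg _).trans hc₁
  have hW := one_le_wtMean
  have hD2 : D ≤ D ^ 3 := le_self_pow₀ hD (by norm_num)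
  have hD3 : D ^ 2 ≤ D ^ 3 := pow_le_pow_right₀ hD (by norm_num)
  have hD1 : 1 ≤ D ^ 3 := one_le_pow₀ hD
  constructor
  -- Writing the increment as `σ w + η` makes the approximation a cubic in `w`. Its odd powers have
  -- mean zero, so no terms of order `σ` or `σ³` remain, and the cubic term contributes only at
  -- order `σ⁴`.
  · set η := σ ^ 2 / 2 * d with hη
    set q : ℝ → ℝ := fun w => (c₀ + c₁ * η + c₂ * η ^ 2 + c₃ * η ^ 3)
      + (c₁ * σ + 2 * c₂ * σ * η + 3 * c₃ * σ * η ^ 2) * w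
      + (c₂ * σ ^ 2 + 3 * c₃ * σ ^ 2 * η) * w ^ 2 + (c₃ * σ ^ 3) * w ^ 3 with hq
    have hqe : ∀ w, c₀ + c₁ * incr σ d w + c₂ * incr σ d w ^ 2 + c₃ * incr σ d w ^ 3 = q w :=
      fun w => by simp only [hq, incr, ← hη]; ring
    obtain ⟨iq, eq⟩ := integral_cubic_gaussian (c₀ + c₁ * η + c₂ * η ^ 2 + c₃ * η ^ 3)
      (c₁ * σ + 2 * c₂ * σ * η + 3 * c₃ * σ * η ^ 2) (c₂ * σ ^ 2 + 3 * c₃ * σ ^ 2 * η) (c₃ * σ ^ 3)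
    simp_rw [hqe] at h
    have hqc : Continuous q := by fun_prop
    have hd' : Integrable (fun w => a w - q w) (gaussianReal 0 1) :=
      integrable_of_abs_le_wt (ha.sub hqc) h
    have h2 := abs_integral_le_of_abs_le_wt h
    have h3 : ∫ w, a w ∂(gaussianReal 0 1)
        = ∫ w, (a w - q w) ∂(gaussianReal 0 1) + ∫ w, q w ∂(gaussianReal 0 1) := by
      rw [← integral_add hd' iq]
      exact integral_congr_ae (ae_of_all _ fun w => (sub_add_cancel (a w) (q w)).symm)
    rw [h3, show ∫ w, q w ∂(gaussianReal 0 1) = _ from eq]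
    have h4 : ∫ w, (a w - q w) ∂(gaussianReal 0 1) + (c₀ + c₁ * η + c₂ * η ^ 2 + c₃ * η ^ 3
        + (c₂ * σ ^ 2 + 3 * c₃ * σ ^ 2 * η)) - (c₀ + σ ^ 2 * (c₁ * d / 2 + c₂))
        = ∫ w, (a w - q w) ∂(gaussianReal 0 1)
          + σ ^ 4 * (c₂ * (d ^ 2 / 4) + c₃ * (σ ^ 2 * d ^ 3 / 8 + 3 / 2 * d)) := by
      rw [hη]; ring
    rw [h4]
    have h5 : |c₂ * (d ^ 2 / 4) + c₃ * (σ ^ 2 * d ^ 3 / 8 + 3 / 2 * d)| ≤ 3 * M * D ^ 3 := by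
      have hσ2 : σ ^ 2 ≤ 1 := pow_le_one₀ h0 h1
      have b1 : |d ^ 2 / 4| ≤ D ^ 3 := by
        rw [abs_div, abs_of_pos (by norm_num : (0 : ℝ) < 4)]
        have := abs_pow_le_of_le hd 2
        linarith [abs_nonneg (d ^ 2)]
      have b2 : |σ ^ 2 * d ^ 3 / 8 + 3 / 2 * d| ≤ 2 * D ^ 3 := by
        have u1 := abs_pow_le_of_le hd 3
        have u2 : |σ ^ 2 * d ^ 3| ≤ 1 * D ^ 3 :=
          abs_mul_le_of_le (by rw [abs_of_nonneg (by positivity)]; exact hσ2) u1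
        rw [abs_le] at u2 hd ⊢
        constructor <;> linarith
      have b3 := abs_mul_le_of_le hc₂ b1
      have b4 := abs_mul_le_of_le hc₃ b2
      refine (abs_add_le _ _).trans ?_
      linarith
    refine (abs_add_le _ _).trans ?_
    rw [abs_mul, abs_of_nonneg (by positivity : 0 ≤ σ ^ 4)]
    have h6 : M * σ ^ 4 * wtMean ≤ M * D ^ 3 * wtMean * σ ^ 4 := by
      have : M * σ ^ 4 * wtMean * 1 ≤ M * σ ^ 4 * wtMean * D ^ 3 := by gcongr
      linarith
    have h7 : σ ^ 4 * |c₂ * (d ^ 2 / 4) + c₃ * (σ ^ 2 * d ^ 3 / 8 + 3 / 2 * d)|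
        ≤ σ ^ 4 * (3 * M * D ^ 3) * wtMean := by
      calc _ ≤ σ ^ 4 * (3 * M * D ^ 3) * 1 := by rw [mul_one]; gcongr
        _ ≤ _ := by gcongr
    linarith
  · intro w
    have hw := wt_nonneg w
    have p1 := abs_incr_pow_le h0 h1 hD hd (k := 1) (by norm_num) w
    have p2 := abs_incr_pow_le h0 h1 hD hd (k := 2) (by norm_num) w
    have p3 := abs_incr_pow_le h0 h1 hD hd (k := 3) (by norm_num) w
    have s2 : σ ^ 2 ≤ σ := pow_le_of_le_one h0 h1 (by norm_num)
    have s3 : σ ^ 3 ≤ σ := pow_le_of_le_one h0 h1 (by norm_num)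
    have s4 : σ ^ 4 ≤ σ := pow_le_of_le_one h0 h1 (by norm_num)
    have q1 : |incr σ d w| ≤ D ^ 3 * σ * wt w := by
      simp only [pow_one] at p1
      exact p1.trans (by gcongr)
    have q2 : |incr σ d w ^ 2| ≤ D ^ 3 * σ * wt w := by
      rw [abs_pow]; exact p2.trans (by gcongr)
    have q3 : |incr σ d w ^ 3| ≤ D ^ 3 * σ * wt w := by
      rw [abs_pow]; exact p3.trans (by gcongr)
    have r1 := abs_mul_le_of_le hc₁ q1
    have r2 := abs_mul_le_of_le hc₂ q2
    have r3 := abs_mul_le_of_le hc₃ q3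
    have r4 : M * σ ^ 4 * wt w ≤ M * (D ^ 3 * σ * wt w) := by
      calc M * σ ^ 4 * wt w ≤ M * σ * wt w * 1 := by rw [mul_one]; gcongr
        _ ≤ M * σ * wt w * D ^ 3 := by gcongr
        _ = _ := by ring
    have h' := h w
    rw [abs_le] at h' r1 r2 r3 ⊢
    constructor <;> linarith

/-! ### The one-dimensional log-acceptance ratio -/

/-- The error of the trapezoidal rule. -/
noncomputable def trap (Q : ℕ → ℝ → ℝ) (x δ : ℝ) : ℝ :=
  Q 0 (x + δ) - Q 0 x - δ / 2 * (Q 1 (x + δ) + Q 1 x)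

/-- The log-acceptance ratio of the one-dimensional chain with target `exp (P 0)`, as a function of
the increment of the proposal. -/
noncomputable def ratio (P : ℕ → ℝ → ℝ) (σ x δ : ℝ) : ℝ :=
  trap P x δ - σ ^ 2 / 8 * (P 1 (x + δ) ^ 2 - P 1 x ^ 2)

/-- The leading coefficient of the log-acceptance ratio. -/
noncomputable def lead (P : ℕ → ℝ → ℝ) (x w : ℝ) : ℝ :=
  P 3 x / 12 * w ^ 3 + P 1 x * P 2 x / 4 * w

/-- Antisymmetry under exchange of current and proposed state, one of the two inputs of the
reversibility identity. -/
theorem ratio_swap (P : ℕ → ℝ → ℝ) (σ x y : ℝ) : ratio P σ x (y - x) = -ratio P σ y (x - y) := by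
  simp only [ratio, trap, add_sub_cancel]
  ring

section Expansions

variable {H P : ℕ → ℝ → ℝ} {B σ : ℝ}

/-- In the trapezoidal error the terms up to second order cancel, and the cubic coefficient is `1/6
- 1/4 = -1/12`. -/
theorem abs_trap_add_le {Q : ℕ → ℝ → ℝ} (hQ : ∀ k x, HasDerivAt (Q k) (Q (k + 1) x) x)
    (hB : ∀ x, |Q 4 x| ≤ B) (x δ : ℝ) :
    |trap Q x δ + Q 3 x * δ ^ 3 / 12| ≤ 2 * B * |δ| ^ 4 := by
  have h4 := abs_taylor_four_le hQ 0 hB x δ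
  have h3 := abs_taylor_three_le hQ 1 hB x δ
  have h3' := abs_mul_le_of_le (le_refl |δ|) h3
  norm_num at h4 h3'
  have e : trap Q x δ + Q 3 x * δ ^ 3 / 12
      = (Q 0 (x + δ) - (Q 0 x + Q 1 x * δ + Q 2 x * δ ^ 2 / 2 + Q 3 x * δ ^ 3 / 6))
        - (δ * (Q 1 (x + δ) - (Q 1 x + Q 2 x * δ + Q 3 x * δ ^ 2 / 2))) / 2 := by
    rw [trap]; ring
  rw [e]
  have hp : |δ| * (B * |δ| ^ 3) = B * |δ| ^ 4 := by ring
  have h0 : 0 ≤ B * |δ| ^ 4 := by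
    have : 0 ≤ B := (abs_nonneg _).trans (hB 0)
    positivity
  rw [← abs_mul, hp] at h3'
  rw [abs_le] at h4 h3' ⊢
  constructor <;> linarith

/-- The trapezoidal error supplies the `w³` part of `lead`, and the first order change of `(ψ')²`
the linear part. The drift inside the increment only affects order `σ⁴`. -/
theorem Chain.abs_ratio_add_lead_le (h : Chain H P B) (h0 : 0 ≤ σ) (h1 : σ ≤ 1) (x w : ℝ) :
    |ratio P σ x (incr σ (P 1 x) w) + σ ^ 3 * lead P x w| ≤ 4 * B ^ 5 * σ ^ 4 * wt w := by
  have hB := h.one_le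
  have b1 := h.bP 1 le_rfl (by norm_num) x
  have b2 := h.bP 2 (by norm_num) (by norm_num) x
  have b3 := h.bP 3 (by norm_num) (by norm_num) x
  have hw := wt_nonneg w
  set δ := incr σ (P 1 x) w with hδ
  have t1 := abs_trap_add_le h.dP (h.bP 4 (by norm_num) le_rfl) x δ
  have t2 := abs_taylor_mul_le h.dP h.dP (fun k hk hk' => h.bP k hk (by omega))
    (fun k hk hk' => h.bP k hk (by omega)) x δ
  have p2 := abs_incr_pow_le h0 h1 hB b1 (k := 2) (by norm_num) w
  have p4 := abs_incr_pow_le h0 h1 hB b1 (k := 4) (by norm_num) w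
  rw [← hδ] at p2 p4
  have w1 : 1 ≤ wt w := one_le_wt w
  have w2 : |w| ^ 2 ≤ wt w :=
    (pow_le_pow_left₀ (abs_nonneg w) (by linarith) 2).trans (one_add_abs_pow_le_wt (by norm_num) w)
  have w3 : |w| ≤ wt w := by
    have := one_add_abs_pow_le_wt (k := 1) (by norm_num) w
    rw [pow_one] at this; linarith
  -- the cube of the increment
  have c3 : |δ ^ 3 - σ ^ 3 * w ^ 3| ≤ σ ^ 4 * (3 * B ^ 3 * wt w) := by
    have e : δ ^ 3 - σ ^ 3 * w ^ 3 = σ ^ 4 * (3 / 2 * (P 1 x * w ^ 2)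
        + 3 / 4 * (σ * (P 1 x ^ 2 * w)) + 1 / 8 * (σ ^ 2 * P 1 x ^ 3)) := by
      rw [hδ, incr]; ring
    rw [e, abs_mul, abs_of_nonneg (by positivity : 0 ≤ σ ^ 4)]
    gcongr
    have u1 : |P 1 x * w ^ 2| ≤ B ^ 3 * wt w :=
      abs_mul_le_of_le (b1.trans (le_self_pow₀ hB (by norm_num))) (by rwa [abs_pow])
    have u2 : |σ * (P 1 x ^ 2 * w)| ≤ 1 * (B ^ 3 * wt w) :=
      abs_mul_le_of_le (by rwa [abs_of_nonneg h0]) (abs_mul_le_of_le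
        ((abs_pow_le_of_le b1 2).trans (pow_le_pow_right₀ hB (by norm_num))) w3)
    have u3 : |σ ^ 2 * P 1 x ^ 3| ≤ 1 * (B ^ 3 * wt w) := by
      refine abs_mul_le_of_le ?_ ((abs_pow_le_of_le b1 3).trans ?_)
      · rw [abs_of_nonneg (by positivity)]; exact pow_le_one₀ h0 h1
      · exact le_mul_of_one_le_right (by positivity) w1
    rw [abs_le] at u1 u2 u3 ⊢
    constructor <;> linarith
  have v3 := abs_mul_le_of_le b3 c3
  have v1 : |P 1 x * P 2 x * P 1 x| ≤ B * B * B :=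
    abs_mul_le_of_le (abs_mul_le_of_le b1 b2) b1
  have e : ratio P σ x δ + σ ^ 3 * lead P x w
      = (trap P x δ + P 3 x * δ ^ 3 / 12) - P 3 x * (δ ^ 3 - σ ^ 3 * w ^ 3) / 12
        - σ ^ 2 / 8 * (P 1 (x + δ) * P 1 (x + δ) - (P 1 x * P 1 x
          + (P 2 x * P 1 x + P 1 x * P 2 x) * δ)) - σ ^ 4 / 8 * (P 1 x * P 2 x * P 1 x) := by
    have hδ' : δ = σ * w + σ ^ 2 / 2 * P 1 x := rfl
    rw [ratio, lead]
    have : σ ^ 2 * δ = σ ^ 3 * w + σ ^ 4 / 2 * P 1 x := by rw [hδ']; ring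
    linear_combination (-(P 1 x * P 2 x) / 4) * this
  have z1 : 2 * B * |δ| ^ 4 ≤ 2 * B ^ 5 * σ ^ 4 * wt w := by
    calc 2 * B * |δ| ^ 4 ≤ 2 * B * (B ^ 4 * σ ^ 4 * wt w) := by gcongr
      _ = _ := by ring
  have z2 : B * (σ ^ 4 * (3 * B ^ 3 * wt w)) ≤ 3 * (B ^ 5 * σ ^ 4 * wt w) := by
    have : B ^ 4 ≤ B ^ 5 := pow_le_pow_right₀ hB (by norm_num)
    calc B * (σ ^ 4 * (3 * B ^ 3 * wt w)) = 3 * (B ^ 4 * σ ^ 4 * wt w) := by ring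
      _ ≤ _ := by gcongr
  have z3 : |σ ^ 2 / 8 * (P 1 (x + δ) * P 1 (x + δ) - (P 1 x * P 1 x
          + (P 2 x * P 1 x + P 1 x * P 2 x) * δ))| ≤ 3 / 8 * (B ^ 5 * σ ^ 4 * wt w) := by
    rw [abs_mul, abs_of_nonneg (by positivity : 0 ≤ σ ^ 2 / 8)]
    have : B ^ 4 ≤ B ^ 5 := pow_le_pow_right₀ hB (by norm_num)
    calc _ ≤ σ ^ 2 / 8 * (3 * B ^ 2 * (B ^ 2 * σ ^ 2 * wt w)) := by
          gcongr; exact t2.trans (by gcongr)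
      _ = 3 / 8 * (B ^ 4 * σ ^ 4 * wt w) := by ring
      _ ≤ _ := by gcongr
  have z4 : |σ ^ 4 / 8 * (P 1 x * P 2 x * P 1 x)| ≤ 1 / 8 * (B ^ 5 * σ ^ 4 * wt w) := by
    rw [abs_mul, abs_of_nonneg (by positivity : 0 ≤ σ ^ 4 / 8)]
    have : B ^ 3 ≤ B ^ 5 := pow_le_pow_right₀ hB (by norm_num)
    calc _ ≤ σ ^ 4 / 8 * (B * B * B) := by gcongr
      _ = 1 / 8 * (B ^ 3 * σ ^ 4 * 1) := by ring
      _ ≤ _ := by gcongr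
  rw [e]
  have p0 : 0 ≤ B ^ 5 * σ ^ 4 * wt w := by positivity
  rw [abs_le] at t1 v3 z3 z4 ⊢
  constructor <;> linarith

theorem Chain.abs_lead_le (h : Chain H P B) (x w : ℝ) : |lead P x w| ≤ B ^ 5 * wt w := by
  have hB := h.one_le
  have b1 := h.bP 1 le_rfl (by norm_num) x
  have b2 := h.bP 2 (by norm_num) (by norm_num) x
  have b3 := h.bP 3 (by norm_num) (by norm_num) x
  have w1 : |w ^ 3| ≤ wt w := by
    rw [abs_pow]
    exact (pow_le_pow_left₀ (abs_nonneg w) (by linarith) 3).trans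
      (one_add_abs_pow_le_wt (by norm_num) w)
  have w3 : |w| ≤ wt w := by
    have := one_add_abs_pow_le_wt (k := 1) (by norm_num) w
    rw [pow_one] at this; linarith
  have u1 : |P 3 x * w ^ 3| ≤ B ^ 5 * wt w :=
    abs_mul_le_of_le (b3.trans (le_self_pow₀ hB (by norm_num))) w1
  have u2 : |P 1 x * P 2 x * w| ≤ B ^ 5 * wt w := by
    refine abs_mul_le_of_le ((abs_mul_le_of_le b1 b2).trans ?_) w3
    rw [← sq]; exact pow_le_pow_right₀ hB (by norm_num)
  have e : lead P x w = (P 3 x * w ^ 3) / 12 + (P 1 x * P 2 x * w) / 4 := by rw [lead]; ring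
  rw [e]
  rw [abs_le] at u1 u2 ⊢
  constructor <;> linarith

theorem Chain.abs_ratio_le (h : Chain H P B) (h0 : 0 ≤ σ) (h1 : σ ≤ 1) (x w : ℝ) :
    |ratio P σ x (incr σ (P 1 x) w)| ≤ 5 * B ^ 5 * σ ^ 3 * wt w := by
  have t1 := h.abs_ratio_add_lead_le h0 h1 x w
  have t2 := h.abs_lead_le x w
  have t3 : |σ ^ 3 * lead P x w| ≤ σ ^ 3 * (B ^ 5 * wt w) := by
    rw [abs_mul, abs_of_nonneg (by positivity : 0 ≤ σ ^ 3)]; gcongr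
  have hB := h.one_le
  have hw := wt_nonneg w
  have t4 : 4 * B ^ 5 * σ ^ 4 * wt w ≤ 4 * B ^ 5 * σ ^ 3 * wt w := by
    have : σ ^ 4 ≤ σ ^ 3 := pow_le_pow_of_le_one h0 h1 (by norm_num)
    gcongr
  rw [abs_le] at t1 t3 ⊢
  constructor <;> linarith

/-- The sharp bound in `σ` grows like `w⁴`, whose exponential is not Gaussian integrable. This
cruder bound, linear in `w`, is the one used inside exponentials. -/
theorem Chain.abs_ratio_le_linear (h : Chain H P B) (h0 : 0 ≤ σ) (h1 : σ ≤ 1) (x w : ℝ) :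
    |ratio P σ x (incr σ (P 1 x) w)| ≤ 3 * B ^ 2 * (1 + |w|) := by
  have hB := h.one_le
  have b1 := h.bP 1 le_rfl (by norm_num)
  set δ := incr σ (P 1 x) w with hδ
  have hi : |δ| ≤ B * (1 + |w|) := by
    refine (abs_incr_le h0 h1 hB (b1 x) w).trans ?_
    have : 0 ≤ B * (1 + |w|) := by positivity
    nlinarith
  have t1 := abs_taylor_one_le h.dP 0 b1 x δ
  have t2 : |δ * (P 1 (x + δ) + P 1 x)| ≤ |δ| * (2 * B) := by
    refine abs_mul_le_of_le le_rfl ((abs_add_le _ _).trans ?_)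
    linarith [b1 x, b1 (x + δ)]
  have t3 : |P 1 (x + δ) ^ 2 - P 1 x ^ 2| ≤ 2 * B ^ 2 := by
    refine (abs_sub _ _).trans ?_
    linarith [abs_pow_le_of_le (b1 x) 2, abs_pow_le_of_le (b1 (x + δ)) 2]
  have t4 : |σ ^ 2 * (P 1 (x + δ) ^ 2 - P 1 x ^ 2)| ≤ 1 * (2 * B ^ 2) := by
    refine abs_mul_le_of_le ?_ t3
    rw [abs_of_nonneg (by positivity)]; exact pow_le_one₀ h0 h1
  have t5 : B * |δ| ≤ B ^ 2 * (1 + |w|) := by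
    calc B * |δ| ≤ B * (B * (1 + |w|)) := by gcongr
      _ = _ := by ring
  have t6 : B ^ 2 ≤ B ^ 2 * (1 + |w|) := by
    have : 0 ≤ |w| := abs_nonneg w
    nlinarith [sq_nonneg B]
  have e : ratio P σ x δ = (P 0 (x + δ) - P 0 x) - (δ * (P 1 (x + δ) + P 1 x)) / 2
      - (σ ^ 2 * (P 1 (x + δ) ^ 2 - P 1 x ^ 2)) / 8 := by rw [ratio, trap]; ring
  rw [e]
  rw [abs_le] at t1 t2 t4 ⊢
  constructor <;> linarith

/-- The derivative of the trapezoidal error in the increment is quadratically small, so the ratio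
has Lipschitz constant of order `σ²` on the relevant ball. This allows the true drift to be replaced
by the mean-field drift. -/
theorem Chain.abs_ratio_sub_ratio_le (h : Chain H P B) {D : ℝ} (hD : 1 ≤ D)
    (x w δ δ' : ℝ) (hδ : |δ| ≤ D * σ * (1 + |w|)) (hδ' : |δ'| ≤ D * σ * (1 + |w|)) :
    |ratio P σ x δ' - ratio P σ x δ| ≤ 2 * B ^ 2 * D ^ 2 * σ ^ 2 * wt w * |δ' - δ| := by
  have hB := h.one_le
  have b1 := h.bP 1 le_rfl (by norm_num)
  have hd : ∀ t, HasDerivAt (trap P x) ((P 1 (x + t) - P 1 x - t * P 2 (x + t)) / 2) t := by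
    intro t
    have e0 : HasDerivAt (fun t => P 0 (x + t)) (P 1 (x + t)) t := by
      simpa using (h.dP 0 (x + t)).comp_const_add x t
    have e1 : HasDerivAt (fun t => P 1 (x + t)) (P 2 (x + t)) t := by
      simpa using (h.dP 1 (x + t)).comp_const_add x t
    have := (e0.sub_const (P 0 x)).sub
      (((hasDerivAt_id t).div_const 2).mul (e1.add_const (P 1 x)))
    refine this.congr_deriv ?_
    simp only [id]; ring
  have hbd : ∀ t ∈ Metric.closedBall (0 : ℝ) (D * σ * (1 + |w|)),
      ‖(P 1 (x + t) - P 1 x - t * P 2 (x + t)) / 2‖ ≤ B * D ^ 2 * σ ^ 2 * wt w := by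
    intro t ht
    have ht' : |t| ≤ D * σ * (1 + |w|) := by simpa [Real.norm_eq_abs] using ht
    -- The expansion is taken backwards from `x + t`, matching the form of the derivative, in which
    -- the second derivative is evaluated at the moved point.
    have t1 := abs_taylor_two_le h.dP 1 (h.bP 3 (by norm_num) (by norm_num)) (x + t) (-t)
    rw [add_neg_cancel_right, abs_neg] at t1
    have t2 : |t| ^ 2 ≤ D ^ 2 * σ ^ 2 * wt w := by
      calc |t| ^ 2 ≤ (D * σ * (1 + |w|)) ^ 2 := by gcongr
        _ = D ^ 2 * σ ^ 2 * (1 + |w|) ^ 2 := by ring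
        _ ≤ _ := by gcongr; exact one_add_abs_pow_le_wt (by norm_num) w
    have t3 : B * |t| ^ 2 ≤ B * D ^ 2 * σ ^ 2 * wt w := by
      calc _ ≤ B * (D ^ 2 * σ ^ 2 * wt w) := by gcongr
        _ = _ := by ring
    have t4 : 0 ≤ B * |t| ^ 2 := by positivity
    rw [Real.norm_eq_abs]
    rw [sq_abs] at t3 t4
    norm_num at t1
    rw [abs_le] at t1 ⊢
    constructor <;> linarith
  have m1 := (convex_closedBall (0 : ℝ) (D * σ * (1 + |w|))).norm_image_sub_le_of_norm_hasDerivWithin_le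
    (fun t _ => (hd t).hasDerivWithinAt) hbd (x := δ) (y := δ') (by simpa using hδ)
    (by simpa using hδ')
  simp only [Real.norm_eq_abs] at m1
  have m2 : |P 1 (x + δ') ^ 2 - P 1 (x + δ) ^ 2| ≤ 2 * B * (B * |δ' - δ|) := by
    have e : P 1 (x + δ') ^ 2 - P 1 (x + δ) ^ 2
        = (P 1 (x + δ') + P 1 (x + δ)) * (P 1 (x + δ') - P 1 (x + δ)) := by ring
    rw [e]
    refine abs_mul_le_of_le ((abs_add_le _ _).trans ?_) ?_
    · linarith [b1 (x + δ), b1 (x + δ')]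
    · have := abs_taylor_one_le h.dP 1 (h.bP 2 (by norm_num) (by norm_num)) (x + δ) (δ' - δ)
      rwa [show x + δ + (δ' - δ) = x + δ' by ring] at this
  have m3 : |σ ^ 2 * (P 1 (x + δ') ^ 2 - P 1 (x + δ) ^ 2)| ≤ 2 * (B ^ 2 * σ ^ 2 * |δ' - δ|) := by
    rw [abs_mul, abs_of_nonneg (by positivity : 0 ≤ σ ^ 2)]
    calc _ ≤ σ ^ 2 * (2 * B * (B * |δ' - δ|)) := by gcongr
      _ = _ := by ring
  have hw := one_le_wt w
  have hw0 := wt_nonneg w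
  have hD2 : 1 ≤ D ^ 2 := one_le_pow₀ hD
  have m4 : B ^ 2 * σ ^ 2 * |δ' - δ| ≤ B ^ 2 * D ^ 2 * σ ^ 2 * wt w * |δ' - δ| := by
    calc B ^ 2 * σ ^ 2 * |δ' - δ| = B ^ 2 * 1 * σ ^ 2 * 1 * |δ' - δ| := by ring
      _ ≤ _ := by gcongr
  have m5 : B * D ^ 2 * σ ^ 2 * wt w * |δ' - δ| ≤ B ^ 2 * D ^ 2 * σ ^ 2 * wt w * |δ' - δ| := by
    have : B ≤ B ^ 2 := le_self_pow₀ hB (by norm_num)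
    gcongr
  have e : ratio P σ x δ' - ratio P σ x δ = (trap P x δ' - trap P x δ)
      - (σ ^ 2 * (P 1 (x + δ') ^ 2 - P 1 (x + δ) ^ 2)) / 8 := by rw [ratio, ratio]; ring
  rw [e]
  have m6 : 0 ≤ B ^ 2 * D ^ 2 * σ ^ 2 * wt w * |δ' - δ| := by positivity
  rw [abs_le] at m1 m3 ⊢
  constructor <;> linarith

end Expansions

/-! ### Reversibility and the mean of the one-dimensional log-acceptance ratio -/

theorem toNNReal_sq_ne_zero {σ : ℝ} (h0 : 0 < σ) : Real.toNNReal (σ ^ 2) ≠ 0 := by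
  have : 0 < Real.toNNReal (σ ^ 2) := Real.toNNReal_pos.2 (by positivity)
  exact this.ne'

theorem map_add_incr_gaussian {σ : ℝ} (x d : ℝ) :
    (gaussianReal 0 1).map (fun w => x + incr σ d w)
      = gaussianReal (x + σ ^ 2 / 2 * d) (Real.toNNReal (σ ^ 2)) := by
  have e : (fun w => x + incr σ d w) = (fun w => (x + σ ^ 2 / 2 * d) + w) ∘ fun w => σ * w := by
    ext w; simp only [incr, Function.comp]; ring
  rw [e, ← Measure.map_map (by fun_prop) (by fun_prop), gaussianReal_map_const_mul,
    gaussianReal_map_const_add]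
  congr 1
  · ring
  · ext; simp [Real.coe_toNNReal _ (sq_nonneg σ)]

theorem integral_add_incr_gaussian {σ : ℝ} (h0 : 0 < σ) (x d : ℝ) {F : ℝ → ℝ} (hF : Continuous F) :
    ∫ w, F (x + incr σ d w) ∂(gaussianReal 0 1) =
      ∫ y, gaussianPDFReal (x + σ ^ 2 / 2 * d) (Real.toNNReal (σ ^ 2)) y * F y := by
  have hc := continuous_incr σ d
  rw [← integral_map (φ := fun w => x + incr σ d w) (by fun_prop) hF.aestronglyMeasurable,
    map_add_incr_gaussian, integral_gaussianReal_eq_integral_smul (toNNReal_sq_ne_zero h0)]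
  rfl

theorem integrable_add_incr_gaussian {σ : ℝ} (h0 : 0 < σ) (x d : ℝ) {F : ℝ → ℝ}
    (hF : Continuous F) (hi : Integrable (fun w => F (x + incr σ d w)) (gaussianReal 0 1)) :
    Integrable fun y =>
      gaussianPDFReal (x + σ ^ 2 / 2 * d) (Real.toNNReal (σ ^ 2)) y * F y := by
  have hc := continuous_incr σ d
  have h1 : Integrable F ((gaussianReal 0 1).map (fun w => x + incr σ d w)) :=
    (integrable_map_measure hF.aestronglyMeasurable (by fun_prop)).2 hi
  rw [map_add_incr_gaussian, gaussianReal_of_var_ne_zero _ (toNNReal_sq_ne_zero h0),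
    integrable_withDensity_iff_integrable_smul' (measurable_gaussianPDF _ _)
      (ae_of_all _ fun _ => gaussianPDF_lt_top)] at h1
  simpa [toReal_gaussianPDF] using h1

theorem abs_exp_sub_one_sub_le (t : ℝ) : |Real.exp t - 1 - t| ≤ |t| ^ 2 * Real.exp |t| := by
  have h := Complex.norm_exp_sub_sum_le_norm_mul_exp (t : ℂ) 2
  have e : Complex.exp (t : ℂ) - ∑ m ∈ Finset.range 2, (t : ℂ) ^ m / (m.factorial : ℂ)
      = ((Real.exp t - 1 - t : ℝ) : ℂ) := by
    simp [Finset.sum_range_succ]; ring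
  rw [e, Complex.norm_real, Complex.norm_real] at h
  exact h

section Mean

variable {H P : ℕ → ℝ → ℝ} {B c σ : ℝ} {π : Measure ℝ}

theorem Chain.continuous_ratio (h : Chain H P B) (σ : ℝ) :
    Continuous fun p : ℝ × ℝ => ratio P σ p.1 p.2 := by
  have c0 := h.continuous_P 0
  have c1 := h.continuous_P 1
  unfold ratio trap
  fun_prop

theorem Chain.continuous_ratio_incr (h : Chain H P B) (σ : ℝ) :
    Continuous fun p : ℝ × ℝ => ratio P σ p.1 (incr σ (P 1 p.1) p.2) := by
  have c1 := h.continuous_P 1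
  have hc : Continuous fun p : ℝ × ℝ => (p.1, incr σ (P 1 p.1) p.2) := by
    unfold incr; fun_prop
  exact (h.continuous_ratio σ).comp hc

/-- This identifies the exponential of `ratio` with the Metropolis–Hastings ratio of the
one-dimensional Langevin proposal for the target `e^ψ`. -/
theorem detailed_balance (P : ℕ → ℝ → ℝ) (h0 : 0 < σ) (x y : ℝ) :
    Real.exp (P 0 x) * gaussianPDFReal (x + σ ^ 2 / 2 * P 1 x) (Real.toNNReal (σ ^ 2)) y
        * Real.exp (ratio P σ x (y - x))
      = Real.exp (P 0 y) * gaussianPDFReal (y + σ ^ 2 / 2 * P 1 y) (Real.toNNReal (σ ^ 2)) x := by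
  simp only [gaussianPDFReal_def]
  have e : ∀ a b c k : ℝ, Real.exp a * (k * Real.exp b) * Real.exp c = k * Real.exp (a + b + c) :=
    fun a b c k => by rw [Real.exp_add, Real.exp_add]; ring
  have e' : ∀ a b k : ℝ, Real.exp a * (k * Real.exp b) = k * Real.exp (a + b) :=
    fun a b k => by rw [Real.exp_add]; ring
  rw [e, e', Real.coe_toNNReal _ (sq_nonneg σ)]
  congr 2
  simp only [ratio, trap, add_sub_cancel]
  field_simp
  ring

/-- Written over pairs of current and proposed state, detailed balance moves the factor `e^g` into
an exchange of the two states, under which `g` changes sign; Fubini concludes. -/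
theorem Chain.integral_reversible (h : Chain H P B) (h0 : 0 < σ) (h1 : σ ≤ 1)
    (hi : Integrable fun x => Real.exp (P 0 x))
    (hg : ∀ g : ℝ → ℝ, ∫ x, g x ∂π = c * ∫ x, Real.exp (P 0 x) * g x) :
    ∫ x, ∫ w, ratio P σ x (incr σ (P 1 x) w) * Real.exp (ratio P σ x (incr σ (P 1 x) w))
        ∂(gaussianReal 0 1) ∂π
      = -∫ x, ∫ w, ratio P σ x (incr σ (P 1 x) w) ∂(gaussianReal 0 1) ∂π := by
  have hc0 := h.continuous_P 0
  have hc1 := h.continuous_P 1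
  set q : ℝ → ℝ → ℝ := fun x y =>
    gaussianPDFReal (x + σ ^ 2 / 2 * P 1 x) (Real.toNNReal (σ ^ 2)) y with hq
  have hqc : Continuous fun p : ℝ × ℝ => q p.1 p.2 := by
    simp only [hq, gaussianPDFReal_def]
    fun_prop
  have hr : Continuous fun p : ℝ × ℝ => ratio P σ p.1 (p.2 - p.1) := by
    have hc : Continuous fun p : ℝ × ℝ => (p.1, p.2 - p.1) := by fun_prop
    exact (h.continuous_ratio σ).comp hc
  have hrx : ∀ x, Continuous fun y => ratio P σ x (y - x) := fun x => by
    have hc : Continuous fun y : ℝ => (x, y) := by fun_prop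
    exact hr.comp hc
  set K : ℝ → ℝ → ℝ := fun x y => Real.exp (P 0 x) * (q x y * ratio P σ x (y - x)) with hK
  have hKc : Continuous (Function.uncurry K) := by
    have : Continuous fun p : ℝ × ℝ => Real.exp (P 0 p.1) * (q p.1 p.2 * ratio P σ p.1 (p.2 - p.1)) := by
      fun_prop
    exact this
  have hin : ∀ x, Integrable (fun w => ratio P σ x (incr σ (P 1 x) w)) (gaussianReal 0 1) :=
    fun x => integrable_of_abs_le_wt (by
      have hc : Continuous fun w : ℝ => (x, w) := by fun_prop
      exact (h.continuous_ratio_incr σ).comp hc) (h.abs_ratio_le h0.le h1 x)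
  have e1 : ∀ x, ∫ w, ratio P σ x (incr σ (P 1 x) w) ∂(gaussianReal 0 1)
      = ∫ y, q x y * ratio P σ x (y - x) := fun x => by
    rw [← integral_add_incr_gaussian h0 x (P 1 x) (hrx x)]
    simp
  have e2 : ∀ x, ∫ w, ratio P σ x (incr σ (P 1 x) w)
        * Real.exp (ratio P σ x (incr σ (P 1 x) w)) ∂(gaussianReal 0 1)
      = ∫ y, q x y * (ratio P σ x (y - x) * Real.exp (ratio P σ x (y - x))) := fun x => by
    rw [← integral_add_incr_gaussian h0 x (P 1 x)
      (F := fun y => ratio P σ x (y - x) * Real.exp (ratio P σ x (y - x)))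
      ((hrx x).mul (Real.continuous_exp.comp (hrx x)))]
    simp
  have e3 : ∀ x y, Real.exp (P 0 x) * (q x y * (ratio P σ x (y - x)
      * Real.exp (ratio P σ x (y - x)))) = -K y x := fun x y => by
    have := detailed_balance P h0 x y
    simp only [hK]
    rw [ratio_swap P σ x y] at this ⊢
    simp only [hq] at this ⊢
    linear_combination (-ratio P σ y (x - y)) * this
  -- Joint integrability for Fubini: the Gaussian mean of the absolute ratio is bounded uniformly in
  -- `x`, and `e^ψ` is integrable.
  have hKi : Integrable (Function.uncurry K) (volume.prod volume) := by
    rw [integrable_prod_iff hKc.aestronglyMeasurable]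
    constructor
    · refine ae_of_all _ fun x => ?_
      exact (integrable_add_incr_gaussian h0 x (P 1 x) (hrx x)
        (by simpa using hin x)).const_mul (Real.exp (P 0 x))
    · refine (hi.mul_const (5 * B ^ 5 * σ ^ 3 * wtMean)).mono'
        (hKc.aestronglyMeasurable.norm.integral_prod_right') (ae_of_all _ fun x => ?_)
      have e : ∀ y, ‖Function.uncurry K (x, y)‖ = Real.exp (P 0 x) * (q x y * |ratio P σ x (y - x)|) := by
        intro y
        simp only [Function.uncurry, hK, Real.norm_eq_abs, abs_mul]
        rw [abs_of_pos (Real.exp_pos _), abs_of_nonneg (gaussianPDFReal_nonneg _ _ _)]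
      simp_rw [e]
      rw [integral_const_mul, ← integral_add_incr_gaussian h0 x (P 1 x) (hrx x).abs,
        Real.norm_eq_abs, abs_mul, abs_of_pos (Real.exp_pos _)]
      gcongr
      refine abs_integral_le_of_abs_le_wt fun w => ?_
      rw [abs_abs]
      simpa using h.abs_ratio_le h0.le h1 x w
  have e4 : ∀ x, Real.exp (P 0 x) * ∫ w, ratio P σ x (incr σ (P 1 x) w)
      * Real.exp (ratio P σ x (incr σ (P 1 x) w)) ∂(gaussianReal 0 1) = -∫ y, K y x := fun x => by
    rw [e2, ← integral_const_mul, ← integral_neg]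
    exact integral_congr_ae (ae_of_all _ (e3 x))
  have e5 : ∀ x, Real.exp (P 0 x) * ∫ w, ratio P σ x (incr σ (P 1 x) w) ∂(gaussianReal 0 1)
      = ∫ y, K x y := fun x => by
    rw [e1, ← integral_const_mul]
  rw [hg, hg]
  simp_rw [e4, e5]
  rw [integral_neg, integral_integral_swap hKi, mul_neg]

/-- The conditional mean of the one-dimensional log-acceptance ratio. -/
noncomputable def ratioMean (P : ℕ → ℝ → ℝ) (σ x : ℝ) : ℝ :=
  ∫ w, ratio P σ x (incr σ (P 1 x) w) ∂(gaussianReal 0 1)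

theorem Chain.measurable_ratioMean (h : Chain H P B) (σ : ℝ) : Measurable (ratioMean P σ) :=
  (StronglyMeasurable.integral_prod_right' (ν := gaussianReal 0 1)
    (h.continuous_ratio_incr σ).stronglyMeasurable).measurable

theorem integral_lead (P : ℕ → ℝ → ℝ) (x : ℝ) : ∫ w, lead P x w ∂(gaussianReal 0 1) = 0 := by
  have := (integral_cubic_gaussian 0 (P 1 x * P 2 x / 4) 0 (P 3 x / 12)).2
  simp only [zero_mul, add_zero, zero_add] at this
  refine Eq.trans (integral_congr_ae (ae_of_all _ fun w => ?_)) this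
  simp only [lead]; ring

theorem integral_lead_sq (P : ℕ → ℝ → ℝ) (x : ℝ) :
    ∫ w, lead P x w ^ 2 ∂(gaussianReal 0 1) = varTerm P x := by
  have e : ∀ w, lead P x w ^ 2 = P 3 x ^ 2 / 144 * w ^ 6 + (P 1 x * P 2 x * P 3 x / 24 * w ^ 4
      + P 1 x ^ 2 * P 2 x ^ 2 / 16 * w ^ 2) := fun w => by rw [lead]; ring
  simp_rw [e]
  have i := fun (k : ℕ) (a : ℝ) => (integrable_pow_gaussian k).const_mul a
  rw [integral_add (i 6 _) ((i 4 _).fun_add (i 2 _)), integral_add (i 4 _) (i 2 _),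
    integral_const_mul, integral_const_mul, integral_const_mul, integral_pow_six_gaussian,
    integral_pow_four_gaussian, integral_pow_two_gaussian, varTerm]
  ring

theorem continuous_lead (P : ℕ → ℝ → ℝ) (x : ℝ) : Continuous (lead P x) := by
  unfold lead; fun_prop

theorem Chain.continuous_ratio_incr_right (h : Chain H P B) (σ x : ℝ) :
    Continuous fun w => ratio P σ x (incr σ (P 1 x) w) := by
  have hc : Continuous fun w : ℝ => (x, w) := by fun_prop
  exact (h.continuous_ratio_incr σ).comp hc

theorem Chain.abs_ratioMean_le (h : Chain H P B) (h0 : 0 ≤ σ) (h1 : σ ≤ 1) (x : ℝ) :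
    |ratioMean P σ x| ≤ 4 * B ^ 5 * wtMean * σ ^ 4 := by
  have i1 := integrable_of_abs_le_wt (h.continuous_ratio_incr_right σ x) (h.abs_ratio_le h0 h1 x)
  have i2 := integrable_of_abs_le_wt (continuous_lead P x) (h.abs_lead_le x)
  have e : ratioMean P σ x = ∫ w, (ratio P σ x (incr σ (P 1 x) w) + σ ^ 3 * lead P x w)
      ∂(gaussianReal 0 1) := by
    rw [integral_add i1 (i2.const_mul _), integral_const_mul, integral_lead, mul_zero, add_zero,
      ratioMean]
  rw [e]
  refine (abs_integral_le_of_abs_le_wt (h.abs_ratio_add_lead_le h0 h1 x)).trans (le_of_eq ?_)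
  ring

/-- The bound on the pointwise mean is only `O(σ⁴)`; its average over `π` is smaller. Reversibility
expresses it as minus half the second moment up to third order terms, and the second moment is `σ⁶
varTerm + O(σ⁷)`. -/
theorem Chain.exists_mean_bound [IsProbabilityMeasure π] (h : Chain H P B)
    (hi : Integrable fun x => Real.exp (P 0 x))
    (hg : ∀ g : ℝ → ℝ, ∫ x, g x ∂π = c * ∫ x, Real.exp (P 0 x) * g x) :
    ∃ K : ℝ, 0 ≤ K ∧ ∀ σ : ℝ, 0 < σ → σ ≤ 1 →
      |∫ x, ratioMean P σ x ∂π + σ ^ 6 / 2 * ∫ x, varTerm P x ∂π| ≤ K * σ ^ 7 := by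
  have hB := h.one_le
  -- the dominating function for the third order term
  have hE : Integrable (fun w => wt w ^ 3 * Real.exp (3 * B ^ 2 * (1 + |w|))) (gaussianReal 0 1) := by
    have := (integrable_pow_mul_exp_gaussian 12 (3 * B ^ 2)).mul_const (Real.exp (3 * B ^ 2))
    refine this.congr (ae_of_all _ fun w => ?_)
    simp only [wt]
    rw [← pow_mul, mul_assoc, ← Real.exp_add]
    ring_nf
  set K₁ : ℝ := ∫ w, wt w ^ 3 * Real.exp (3 * B ^ 2 * (1 + |w|)) ∂(gaussianReal 0 1) with hK₁
  set K₂ : ℝ := ∫ w, wt w ^ 2 ∂(gaussianReal 0 1) with hK₂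
  have hK₁0 : 0 ≤ K₁ := integral_nonneg fun w => by have := wt_nonneg w; positivity
  have hK₂0 : 0 ≤ K₂ := integral_nonneg fun w => by have := wt_nonneg w; positivity
  refine ⟨(5 * B ^ 5) ^ 3 * K₁ + 24 * B ^ 10 * K₂, by positivity, fun σ h0 h1 => ?_⟩
  set g : ℝ → ℝ → ℝ := fun x w => ratio P σ x (incr σ (P 1 x) w) with hgdef
  have hgc : ∀ x, Continuous (g x) := h.continuous_ratio_incr_right σ
  have hgb : ∀ x w, |g x w| ≤ 5 * B ^ 5 * σ ^ 3 * wt w := h.abs_ratio_le h0.le h1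
  have ig : ∀ x, Integrable (g x) (gaussianReal 0 1) := fun x =>
    integrable_of_abs_le_wt (hgc x) (hgb x)
  have ig2 : ∀ x, Integrable (fun w => g x w ^ 2) (gaussianReal 0 1) := fun x =>
    MemLp.integrable_pow_le_four (memLp_of_abs_le_wt (hgc x).measurable (hgb x)) (by norm_num)
  -- The cube is estimated by the bound of order `σ³`, the exponential by the linear bound.
  have hcub : ∀ x w, |g x w * Real.exp (g x w) - g x w - g x w ^ 2| ≤
      (5 * B ^ 5) ^ 3 * σ ^ 9 * (wt w ^ 3 * Real.exp (3 * B ^ 2 * (1 + |w|))) := by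
    intro x w
    have e : g x w * Real.exp (g x w) - g x w - g x w ^ 2
        = g x w * (Real.exp (g x w) - 1 - g x w) := by ring
    rw [e, abs_mul]
    have t1 := abs_exp_sub_one_sub_le (g x w)
    have t2 : |g x w| ≤ 3 * B ^ 2 * (1 + |w|) := h.abs_ratio_le_linear h0.le h1 x w
    have hw := wt_nonneg w
    calc |g x w| * |Real.exp (g x w) - 1 - g x w|
        ≤ |g x w| * (|g x w| ^ 2 * Real.exp |g x w|) := by gcongr
      _ = |g x w| ^ 3 * Real.exp |g x w| := by ring
      _ ≤ (5 * B ^ 5 * σ ^ 3 * wt w) ^ 3 * Real.exp (3 * B ^ 2 * (1 + |w|)) := by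
          gcongr; exact hgb x w
      _ = _ := by ring
  have icub : ∀ x, Integrable (fun w => g x w * Real.exp (g x w) - g x w - g x w ^ 2)
      (gaussianReal 0 1) := fun x =>
    (hE.const_mul ((5 * B ^ 5) ^ 3 * σ ^ 9)).mono'
      (by have := hgc x; fun_prop) (ae_of_all _ (hcub x))
  set M : ℝ → ℝ := ratioMean P σ with hM
  set S : ℝ → ℝ := fun x => ∫ w, g x w ^ 2 ∂(gaussianReal 0 1) with hS
  set R : ℝ → ℝ := fun x => ∫ w, g x w * Real.exp (g x w) ∂(gaussianReal 0 1) with hR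
  have hRMS : ∀ x, |R x - M x - S x| ≤ (5 * B ^ 5) ^ 3 * K₁ * σ ^ 9 := by
    intro x
    have i3 : Integrable (fun w => g x w * Real.exp (g x w)) (gaussianReal 0 1) := by
      have := ((icub x).add (ig x)).add (ig2 x)
      refine this.congr (ae_of_all _ fun w => ?_)
      simp only [Pi.add_apply]; ring
    have e : R x - M x - S x
        = ∫ w, (g x w * Real.exp (g x w) - g x w - g x w ^ 2) ∂(gaussianReal 0 1) := by
      have i4 : Integrable (fun w => g x w * Real.exp (g x w) - g x w) (gaussianReal 0 1) :=
        i3.sub (ig x)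
      rw [integral_sub i4 (ig2 x), integral_sub i3 (ig x)]
      rfl
    rw [e, ← Real.norm_eq_abs]
    refine (norm_integral_le_of_norm_le (hE.const_mul _) (ae_of_all _ (hcub x))).trans (le_of_eq ?_)
    rw [integral_const_mul]; ring
  have hSv : ∀ x, |S x - σ ^ 6 * varTerm P x| ≤ 24 * B ^ 10 * K₂ * σ ^ 7 := by
    intro x
    have il : Integrable (fun w => lead P x w ^ 2) (gaussianReal 0 1) :=
      MemLp.integrable_pow_le_four (memLp_of_abs_le_wt (continuous_lead P x).measurable
        (h.abs_lead_le x)) (by norm_num)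
    have e : S x - σ ^ 6 * varTerm P x
        = ∫ w, (g x w ^ 2 - σ ^ 6 * lead P x w ^ 2) ∂(gaussianReal 0 1) := by
      rw [integral_sub (ig2 x) (il.const_mul _), integral_const_mul, integral_lead_sq]
    rw [e, ← Real.norm_eq_abs]
    have hb : ∀ w, ‖g x w ^ 2 - σ ^ 6 * lead P x w ^ 2‖ ≤ 24 * B ^ 10 * σ ^ 7 * wt w ^ 2 := by
      intro w
      have hw := wt_nonneg w
      have t1 : |g x w + σ ^ 3 * lead P x w| ≤ 4 * B ^ 5 * σ ^ 4 * wt w :=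
        h.abs_ratio_add_lead_le h0.le h1 x w
      have t2 : |g x w - σ ^ 3 * lead P x w| ≤ 6 * B ^ 5 * σ ^ 3 * wt w := by
        refine (abs_sub _ _).trans ?_
        have t3 := hgb x w
        have t4 : |σ ^ 3 * lead P x w| ≤ σ ^ 3 * (B ^ 5 * wt w) := by
          rw [abs_mul, abs_of_nonneg (by positivity : 0 ≤ σ ^ 3)]
          gcongr; exact h.abs_lead_le x w
        linarith
      rw [Real.norm_eq_abs, show g x w ^ 2 - σ ^ 6 * lead P x w ^ 2
        = (g x w + σ ^ 3 * lead P x w) * (g x w - σ ^ 3 * lead P x w) by ring]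
      refine (abs_mul_le_of_le t1 t2).trans (le_of_eq ?_)
      ring
    refine (norm_integral_le_of_norm_le ((integrable_wt_pow 2).const_mul _)
      (ae_of_all _ hb)).trans (le_of_eq ?_)
    rw [integral_const_mul]; ring
  -- Hence the integral of `R - M` is twice minus the mean, which produces the factor `1/2` in front
  -- of the variance.
  have hrev : ∫ x, R x ∂π = -∫ x, M x ∂π := h.integral_reversible h0 h1 hi hg
  have hMm : Measurable M := h.measurable_ratioMean σ
  have hMi : Integrable M π := (integrable_const (4 * B ^ 5 * wtMean * σ ^ 4)).mono'
    hMm.aestronglyMeasurable (ae_of_all _ (h.abs_ratioMean_le h0.le h1))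
  have hRm : Measurable R := by
    have hc : Continuous fun p : ℝ × ℝ => g p.1 p.2 * Real.exp (g p.1 p.2) := by
      have := h.continuous_ratio_incr σ
      exact this.mul (Real.continuous_exp.comp this)
    exact (hc.stronglyMeasurable.integral_prod_right').measurable
  have hvi : Integrable (varTerm P) π :=
    integrable_of_continuous_of_bdd h.continuous_varTerm h.abs_varTerm_le
  have htot : ∀ x, |R x - M x - σ ^ 6 * varTerm P x| ≤
      ((5 * B ^ 5) ^ 3 * K₁ + 24 * B ^ 10 * K₂) * σ ^ 7 := by
    intro x
    have t1 := hRMS x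
    have t2 := hSv x
    have t3 : (5 * B ^ 5) ^ 3 * K₁ * σ ^ 9 ≤ (5 * B ^ 5) ^ 3 * K₁ * σ ^ 7 := by
      have : σ ^ 9 ≤ σ ^ 7 := pow_le_pow_of_le_one h0.le h1 (by norm_num)
      gcongr
    rw [abs_le] at t1 t2 ⊢
    constructor <;> linarith
  have hRi : Integrable R π := by
    have hdi : Integrable (fun x => R x - M x - σ ^ 6 * varTerm P x) π :=
      (integrable_const (((5 * B ^ 5) ^ 3 * K₁ + 24 * B ^ 10 * K₂) * σ ^ 7)).mono'
        (by have := h.continuous_varTerm.measurable; fun_prop) (ae_of_all _ htot)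
    have := (hdi.add hMi).add (hvi.const_mul (σ ^ 6))
    refine this.congr (ae_of_all _ fun x => ?_)
    simp only [Pi.add_apply]; ring
  have hfin : |∫ x, (R x - M x - σ ^ 6 * varTerm P x) ∂π| ≤
      ((5 * B ^ 5) ^ 3 * K₁ + 24 * B ^ 10 * K₂) * σ ^ 7 := by
    have := norm_integral_le_of_norm_le_const (μ := π)
      (f := fun x => R x - M x - σ ^ 6 * varTerm P x) (ae_of_all _ htot)
    simpa using this
  have i5 : Integrable (fun x => R x - M x) π := hRi.sub hMi
  rw [integral_sub i5 (hvi.const_mul _), integral_sub hRi hMi, integral_const_mul, hrev] at hfin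
  have hpos : 0 ≤ ((5 * B ^ 5) ^ 3 * K₁ + 24 * B ^ 10 * K₂) * σ ^ 7 := by positivity
  rw [abs_le] at hfin ⊢
  constructor <;> linarith

end Mean

/-! ### Decomposition of the log-acceptance ratio -/

section Decomposition

variable {H U : ℝ → ℝ} {N : ℕ} {σ : ℝ}

theorem logAccept_eq_sub (h0 : 0 < σ) (hZ : 0 < ∫ z : Fin N → ℝ, Real.exp (logWeight H U N z))
    (x w : Fin N → ℝ) :
    logAccept H U N σ x w =
      logWeight H U N (proposal H U N σ x w) - logWeight H U N x
      + ∑ i, ((proposal H U N σ x w i - (x i + σ ^ 2 / 2 * drift H U N x i)) ^ 2 / (2 * σ ^ 2)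
        - (x i - (proposal H U N σ x w i + σ ^ 2 / 2 * drift H U N (proposal H U N σ x w) i)) ^ 2
          / (2 * σ ^ 2)) := by
  set y := proposal H U N σ x w with hy
  have hq : ∀ a b : Fin N → ℝ, Real.log (proposalDensity H U N σ a b)
      = ∑ i, (Real.log (Real.sqrt (2 * Real.pi * σ ^ 2))⁻¹
        - (b i - (a i + σ ^ 2 / 2 * drift H U N a i)) ^ 2 / (2 * σ ^ 2)) := by
    intro a b
    rw [proposalDensity, Real.log_prod (fun i _ =>
      (gaussianPDFReal_pos _ _ _ (toNNReal_sq_ne_zero h0)).ne')]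
    refine Finset.sum_congr rfl fun i _ => ?_
    rw [gaussianPDFReal_def]
    simp only
    rw [Real.coe_toNNReal _ (sq_nonneg σ), Real.log_mul (by positivity) (Real.exp_pos _).ne',
      Real.log_exp]
    ring
  have hq0 : ∀ a b : Fin N → ℝ, proposalDensity H U N σ a b ≠ 0 := fun a b =>
    Finset.prod_ne_zero_iff.2 fun i _ => (gaussianPDFReal_pos _ _ _ (toNNReal_sq_ne_zero h0)).ne'
  have hp : ∀ a : Fin N → ℝ, Real.log (postDensity H U N a)
      = logWeight H U N a - Real.log (∫ z : Fin N → ℝ, Real.exp (logWeight H U N z)) := fun a => by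
    rw [postDensity, Real.log_div (Real.exp_pos _).ne' hZ.ne', Real.log_exp]
  have hp0 : ∀ a : Fin N → ℝ, postDensity H U N a ≠ 0 := fun a =>
    (div_pos (Real.exp_pos _) hZ).ne'
  rw [logAccept, ← hy, Real.log_div (mul_ne_zero (hp0 _) (hq0 _ _)) (mul_ne_zero (hp0 _) (hq0 _ _)),
    Real.log_mul (hp0 _) (hq0 _ _), Real.log_mul (hp0 _) (hq0 _ _), hp, hp, hq, hq,
    Finset.sum_sub_distrib, Finset.sum_sub_distrib, Finset.sum_sub_distrib]
  ring

end Decomposition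

/-! ### Exact separation of the mean-field part and the interaction. -/

/-- The deviation of the empirical mean of `f` from `m`. -/
noncomputable def dev (f : ℝ → ℝ) (m : ℝ) {N : ℕ} (x : Fin N → ℝ) : ℝ :=
  1 / (N : ℝ) * ∑ i, f (x i) - m

/-- The increment of the `i`-th coordinate of the proposal, in terms of the mean-field potential. -/
noncomputable def fieldIncr (H P : ℕ → ℝ → ℝ) (m σ : ℝ) {N : ℕ} (x w : Fin N → ℝ) (i : Fin N) : ℝ :=
  incr σ (P 1 (x i) - H 1 (x i) * dev (H 0) m x) (w i)

/-- The contribution of the interaction to the log-acceptance ratio. -/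
noncomputable def interaction (H P : ℕ → ℝ → ℝ) (m σ : ℝ) {N : ℕ} (x w : Fin N → ℝ) : ℝ :=
  let δ := fieldIncr H P m σ x w
  let e := dev (H 0) m x
  let e' := dev (H 0) m (fun i => x i + δ i)
  1 / 4 * (e' - e) * ∑ i, (δ i * (H 1 (x i + δ i) - H 1 (x i))
      + σ ^ 2 * (P 1 (x i + δ i) * H 1 (x i + δ i)))
    + 1 / 4 * e * ∑ i, σ ^ 2 * (P 1 (x i + δ i) * H 1 (x i + δ i) - P 1 (x i) * H 1 (x i))
    - σ ^ 2 / 8 * ∑ i, (H 1 (x i + δ i) ^ 2 * e' ^ 2 - H 1 (x i) ^ 2 * e ^ 2)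
    - 1 / 2 * (e + e') * ∑ i, trap H (x i) (δ i)

/-- The drift is the mean-field drift minus `H'` times the deviation of the empirical mean of `H`.
With the two deviations `e` and `e'` treated as numbers, the identity holds coordinate by
coordinate, apart from the quadratic term `(N/2)(e'² - e²)`. -/
theorem logAccept_eq_ratio_add_interaction {H U : ℝ → ℝ} {π : Measure ℝ} {B σ : ℝ} {N : ℕ}
    (hN : 0 < N) (h0 : 0 < σ) (hZ : 0 < ∫ z : Fin N → ℝ, Real.exp (logWeight H U N z))
    (h : Chain (fun k => iteratedDeriv k H) (fun k => iteratedDeriv k (psi H U π)) B)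
    (x w : Fin N → ℝ) :
    logAccept H U N σ x w =
      ∑ i, ratio (fun k => iteratedDeriv k (psi H U π)) σ (x i)
        (fieldIncr (fun k => iteratedDeriv k H) (fun k => iteratedDeriv k (psi H U π))
          (∫ z, H z ∂π) σ x w i)
      + interaction (fun k => iteratedDeriv k H) (fun k => iteratedDeriv k (psi H U π))
          (∫ z, H z ∂π) σ x w := by
  set H' : ℕ → ℝ → ℝ := fun k => iteratedDeriv k H with hH'
  set P : ℕ → ℝ → ℝ := fun k => iteratedDeriv k (psi H U π) with hP
  set m := ∫ z, H z ∂π with hm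
  have hH0 : H' 0 = H := by simp [hH']
  have hP0 : ∀ z, P 0 z = U z - H z * m := fun z => by simp [hP, psi, hm]
  have hdH : ∀ z, deriv H z = H' 1 z := fun z => by simp [hH', iteratedDeriv_one]
  have hdU : ∀ z, deriv U z = P 1 z + H' 1 z * m := fun z => by
    have h1 : HasDerivAt (fun z => P 0 z + H' 0 z * m) (P 1 z + H' 1 z * m) z :=
      (h.dP 0 z).add ((h.dH 0 z).mul_const m)
    have h2 : (fun z => P 0 z + H' 0 z * m) = U := by
      ext z; rw [hP0, hH0]; ring
    rw [h2] at h1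
    exact h1.deriv
  have hdrift : ∀ (a : Fin N → ℝ) i, drift H U N a i = P 1 (a i) - H' 1 (a i) * dev (H' 0) m a := by
    intro a i
    rw [drift, hdU, hdH, dev, hH0]; ring
  have hlog : ∀ a : Fin N → ℝ, logWeight H U N a = ∑ i, P 0 (a i)
      - (N : ℝ) / 2 * dev (H' 0) m a ^ 2 + (N : ℝ) * m ^ 2 / 2 := fun a => by
    rw [logWeight_eq hN m, dev, hH0]
    simp_rw [hP0]
  set δ := fieldIncr H' P m σ x w with hδ
  have hprop : proposal H U N σ x w = fun i => x i + δ i := by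
    ext i
    rw [proposal, hdrift, hδ, fieldIncr, incr]; ring
  rw [logAccept_eq_sub h0 hZ, hprop, hlog, hlog]
  simp_rw [hdrift]
  simp only [interaction, ← hδ]
  set e := dev (H' 0) m x with he
  set e' := dev (H' 0) m (fun i => x i + δ i) with he'
  have hN' : (N : ℝ) ≠ 0 := by positivity
  have hA1 : (N : ℝ) * (e' - e) = ∑ i, (H' 0 (x i + δ i) - H' 0 (x i)) := by
    rw [he', he, dev, dev, Finset.sum_sub_distrib]
    field_simp
    ring
  -- Factoring the difference of squares distributes the only nonlocal term over the coordinates,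
  -- since `N (e' - e)` is the sum of the increments of `H`.
  have hsq : (N : ℝ) / 2 * e' ^ 2 - (N : ℝ) / 2 * e ^ 2
      = 1 / 2 * (e + e') * ∑ i, (H' 0 (x i + δ i) - H' 0 (x i)) := by
    rw [← hA1]; ring
  have hcoord : ∀ i, P 0 (x i + δ i) - P 0 (x i)
      - 1 / 2 * (e + e') * (H' 0 (x i + δ i) - H' 0 (x i))
      + ((x i + δ i - (x i + σ ^ 2 / 2 * (P 1 (x i) - H' 1 (x i) * e))) ^ 2 / (2 * σ ^ 2)
        - (x i - (x i + δ i + σ ^ 2 / 2 * (P 1 (x i + δ i) - H' 1 (x i + δ i) * e'))) ^ 2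
          / (2 * σ ^ 2))
      = ratio P σ (x i) (δ i) - 1 / 2 * (e + e') * trap H' (x i) (δ i)
        + 1 / 4 * (e' - e) * (δ i * (H' 1 (x i + δ i) - H' 1 (x i))
          + σ ^ 2 * (P 1 (x i + δ i) * H' 1 (x i + δ i)))
        + 1 / 4 * e * (σ ^ 2 * (P 1 (x i + δ i) * H' 1 (x i + δ i) - P 1 (x i) * H' 1 (x i)))
        - σ ^ 2 / 8 * (H' 1 (x i + δ i) ^ 2 * e' ^ 2 - H' 1 (x i) ^ 2 * e ^ 2) := by
    intro i
    rw [ratio, trap, trap]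
    field_simp
    ring
  have hsum := Finset.sum_congr (rfl : (Finset.univ : Finset (Fin N)) = Finset.univ)
    fun i _ => hcoord i
  simp only [Finset.sum_add_distrib, Finset.sum_sub_distrib, mul_add, mul_sub, Finset.mul_sum]
    at hsum hsq ⊢
  linarith

/-! ### Expansions of the coordinates of the interaction -/

section Coordinates

variable {H P : ℕ → ℝ → ℝ} {B D σ d : ℝ}

/-- The constant in the coordinatewise expansions. -/
noncomputable def coordConst (B D : ℝ) : ℝ := 16 * B ^ 2 * D ^ 7 * wtMean

theorem mean_and_size_of_coord {a : ℝ → ℝ} (ha : Continuous a) {c₀ c₁ c₂ c₃ : ℝ} (hB : 1 ≤ B)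
    (h0 : 0 ≤ σ) (h1 : σ ≤ 1) (hD : 1 ≤ D) (hd : |d| ≤ D) (hc₁ : |c₁| ≤ 2 * B ^ 2)
    (hc₂ : |c₂| ≤ 2 * B ^ 2) (hc₃ : |c₃| ≤ 2 * B ^ 2)
    (h : ∀ w, |a w - (c₀ + c₁ * incr σ d w + c₂ * incr σ d w ^ 2 + c₃ * incr σ d w ^ 3)|
      ≤ 4 * B ^ 2 * D ^ 4 * σ ^ 4 * wt w) :
    |∫ w, a w ∂(gaussianReal 0 1) - (c₀ + σ ^ 2 * (c₁ * d / 2 + c₂))| ≤ coordConst B D * σ ^ 4 ∧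
      ∀ w, |a w - c₀| ≤ coordConst B D * σ * wt w := by
  have hM : 2 * B ^ 2 ≤ 4 * B ^ 2 * D ^ 4 := by
    have : 1 ≤ D ^ 4 := one_le_pow₀ hD
    nlinarith [sq_nonneg B]
  obtain ⟨r1, r2⟩ := mean_and_size_of_expansion (M := 4 * B ^ 2 * D ^ 4) ha h0 h1 hD hd
    (hc₁.trans hM) (hc₂.trans hM) (hc₃.trans hM) h
  have e : 4 * (4 * B ^ 2 * D ^ 4) * D ^ 3 * wtMean = coordConst B D := by
    rw [coordConst]; ring
  refine ⟨by rwa [e] at r1, fun w => (r2 w).trans ?_⟩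
  have hw := wt_nonneg w
  have hW := one_le_wtMean
  calc 4 * (4 * B ^ 2 * D ^ 4) * D ^ 3 * σ * wt w
      = 4 * (4 * B ^ 2 * D ^ 4) * D ^ 3 * 1 * σ * wt w := by ring
    _ ≤ 4 * (4 * B ^ 2 * D ^ 4) * D ^ 3 * wtMean * σ * wt w := by gcongr
    _ = _ := by rw [e]

theorem Chain.incr_pow_four_le (h : Chain H P B) (h0 : 0 ≤ σ) (h1 : σ ≤ 1) (hD : 1 ≤ D)
    (hd : |d| ≤ D) (w : ℝ) :
    B * |incr σ d w| ^ 4 ≤ B ^ 2 * D ^ 4 * σ ^ 4 * wt w := by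
  have hB := h.one_le
  have p4 := abs_incr_pow_le h0 h1 hD hd (k := 4) le_rfl w
  have hw := wt_nonneg w
  have : B ≤ B ^ 2 := le_self_pow₀ hB (by norm_num)
  calc B * |incr σ d w| ^ 4 ≤ B ^ 2 * (D ^ 4 * σ ^ 4 * wt w) := by gcongr
    _ = _ := by ring

theorem incr_pow_two_le (h0 : 0 ≤ σ) (h1 : σ ≤ 1) (hD : 1 ≤ D)
    (hd : |d| ≤ D) (w : ℝ) :
    σ ^ 2 * (3 * B ^ 2 * |incr σ d w| ^ 2) ≤ 3 * (B ^ 2 * D ^ 4 * σ ^ 4 * wt w) := by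
  have p2 := abs_incr_pow_le h0 h1 hD hd (k := 2) (by norm_num) w
  have hw := wt_nonneg w
  have : D ^ 2 ≤ D ^ 4 := pow_le_pow_right₀ hD (by norm_num)
  calc σ ^ 2 * (3 * B ^ 2 * |incr σ d w| ^ 2) ≤ σ ^ 2 * (3 * B ^ 2 * (D ^ 2 * σ ^ 2 * wt w)) := by
        gcongr
    _ = 3 * (B ^ 2 * D ^ 2 * σ ^ 4 * wt w) := by ring
    _ ≤ _ := by gcongr

/-- First of four expansions for the sums that control `interaction`. What matters is the mean at
order `σ²`: here and in `coord_drift` it is `H'' + H'ψ'`, up to a factor and the deviation in the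
drift; in `coord_trap` and `coord_product` it vanishes. -/
theorem Chain.coord_value (h : Chain H P B) (h0 : 0 ≤ σ) (h1 : σ ≤ 1) (hD : 1 ≤ D)
    (hd : |d| ≤ D) (x : ℝ) :
    |∫ w, (H 0 (x + incr σ d w) - H 0 x) ∂(gaussianReal 0 1)
        - (0 + σ ^ 2 * (H 1 x * d / 2 + H 2 x / 2))| ≤ coordConst B D * σ ^ 4 ∧
      ∀ w, |(H 0 (x + incr σ d w) - H 0 x) - 0| ≤ coordConst B D * σ * wt w := by
  have hB := h.one_le
  have hB2 : B ≤ B ^ 2 := le_self_pow₀ hB (by norm_num)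
  have c0 := h.continuous_H 0
  have ci := continuous_incr σ d
  have b1 := h.bH 1 (by norm_num) x
  have b2 := h.bH 2 (by norm_num) x
  have b3 := h.bH 3 (by norm_num) x
  refine mean_and_size_of_coord (c₃ := H 3 x / 6) (by fun_prop) hB h0 h1 hD hd (by linarith)
    ?_ ?_ fun w => ?_
  · rw [abs_div, abs_of_pos (by norm_num : (0 : ℝ) < 2)]; linarith [abs_nonneg (H 2 x)]
  · rw [abs_div, abs_of_pos (by norm_num : (0 : ℝ) < 6)]; linarith [abs_nonneg (H 3 x)]
  · have t := abs_taylor_four_le h.dH 0 (h.bH 4 le_rfl) x (incr σ d w)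
    norm_num only at t
    have t' := h.incr_pow_four_le h0 h1 hD hd w
    have hp : 0 ≤ B ^ 2 * D ^ 4 * σ ^ 4 * wt w := by have := wt_nonneg w; positivity
    rw [abs_le] at t ⊢
    constructor <;> linarith

theorem Chain.coord_trap (h : Chain H P B) (h0 : 0 ≤ σ) (h1 : σ ≤ 1) (hD : 1 ≤ D)
    (hd : |d| ≤ D) (x : ℝ) :
    |∫ w, trap H x (incr σ d w) ∂(gaussianReal 0 1)
        - (0 + σ ^ 2 * (0 * d / 2 + 0))| ≤ coordConst B D * σ ^ 4 ∧
      ∀ w, |trap H x (incr σ d w) - 0| ≤ coordConst B D * σ * wt w := by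
  have hB := h.one_le
  have hB2 : B ≤ B ^ 2 := le_self_pow₀ hB (by norm_num)
  have c0 := h.continuous_H 0
  have c1 := h.continuous_H 1
  have ci := continuous_incr σ d
  have b3 := h.bH 3 (by norm_num) x
  refine mean_and_size_of_coord (c₃ := -(H 3 x / 12)) (by unfold trap; fun_prop) hB h0 h1 hD hd
    (by simp; positivity) (by simp; positivity) ?_ fun w => ?_
  · rw [abs_neg, abs_div, abs_of_pos (by norm_num : (0 : ℝ) < 12)]; linarith [abs_nonneg (H 3 x)]
  · have t := abs_trap_add_le h.dH (h.bH 4 le_rfl) x (incr σ d w)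
    have t' := h.incr_pow_four_le h0 h1 hD hd w
    have hp : 0 ≤ B ^ 2 * D ^ 4 * σ ^ 4 * wt w := by have := wt_nonneg w; positivity
    rw [abs_le] at t ⊢
    constructor <;> linarith

theorem Chain.coord_drift (h : Chain H P B) (h0 : 0 ≤ σ) (h1 : σ ≤ 1) (hD : 1 ≤ D)
    (hd : |d| ≤ D) (x : ℝ) :
    |∫ w, (incr σ d w * (H 1 (x + incr σ d w) - H 1 x)
          + σ ^ 2 * (P 1 (x + incr σ d w) * H 1 (x + incr σ d w))) ∂(gaussianReal 0 1)
        - (σ ^ 2 * (P 1 x * H 1 x)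
          + σ ^ 2 * (σ ^ 2 * (P 2 x * H 1 x + P 1 x * H 2 x) * d / 2 + H 2 x))|
        ≤ coordConst B D * σ ^ 4 ∧
      ∀ w, |(incr σ d w * (H 1 (x + incr σ d w) - H 1 x)
          + σ ^ 2 * (P 1 (x + incr σ d w) * H 1 (x + incr σ d w))) - σ ^ 2 * (P 1 x * H 1 x)|
        ≤ coordConst B D * σ * wt w := by
  have hB := h.one_le
  have hB2 : B ≤ B ^ 2 := le_self_pow₀ hB (by norm_num)
  have c1 := h.continuous_H 1
  have cP := h.continuous_P 1
  have ci := continuous_incr σ d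
  have a1 := h.bH 1 (by norm_num) x
  have a2 := h.bH 2 (by norm_num) x
  have a3 := h.bH 3 (by norm_num) x
  have b1 := h.bP 1 (by norm_num) (by norm_num) x
  have b2 := h.bP 2 (by norm_num) (by norm_num) x
  refine mean_and_size_of_coord (c₃ := H 3 x / 2) (by fun_prop) hB h0 h1 hD hd ?_
    (by linarith) ?_ fun w => ?_
  · have u : |P 2 x * H 1 x + P 1 x * H 2 x| ≤ 2 * B ^ 2 := by
      refine (abs_add_le _ _).trans ?_
      linarith [abs_mul_le_of_le b2 a1, abs_mul_le_of_le b1 a2]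
    have := abs_mul_le_of_le (a := σ ^ 2) (A := 1)
      (by rw [abs_of_nonneg (by positivity)]; exact pow_le_one₀ h0 h1) u
    linarith
  · rw [abs_div, abs_of_pos (by norm_num : (0 : ℝ) < 2)]; linarith [abs_nonneg (H 3 x)]
  · set δ := incr σ d w with hδ
    have t1 := abs_taylor_three_le h.dH 1 (h.bH 4 le_rfl) x δ
    have t1' := abs_mul_le_of_le (le_refl |δ|) t1
    have t2 := abs_taylor_mul_le h.dP h.dH (fun k hk hk' => h.bP k hk (by omega))
      (fun k hk hk' => h.bH k (by omega)) x δ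
    have t2' := abs_mul_le_of_le (a := σ ^ 2) (A := σ ^ 2) (abs_of_nonneg (by positivity)).le t2
    have s1 := h.incr_pow_four_le h0 h1 hD hd w
    have s2 := incr_pow_two_le (B := B) h0 h1 hD hd w
    rw [← hδ] at s1 s2
    have hp : |δ| * (B * |δ| ^ 3) = B * |δ| ^ 4 := by ring
    rw [hp] at t1'
    norm_num only at t1'
    rw [abs_le] at t1' t2' ⊢
    constructor <;> linarith

theorem Chain.coord_product (h : Chain H P B) (h0 : 0 ≤ σ) (h1 : σ ≤ 1) (hD : 1 ≤ D)
    (hd : |d| ≤ D) (x : ℝ) :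
    |∫ w, (σ ^ 2 * (P 1 (x + incr σ d w) * H 1 (x + incr σ d w) - P 1 x * H 1 x))
          ∂(gaussianReal 0 1)
        - (0 + σ ^ 2 * (σ ^ 2 * (P 2 x * H 1 x + P 1 x * H 2 x) * d / 2 + 0))|
        ≤ coordConst B D * σ ^ 4 ∧
      ∀ w, |(σ ^ 2 * (P 1 (x + incr σ d w) * H 1 (x + incr σ d w) - P 1 x * H 1 x)) - 0|
        ≤ coordConst B D * σ * wt w := by
  have hB := h.one_le
  have c1 := h.continuous_H 1
  have cP := h.continuous_P 1
  have ci := continuous_incr σ d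
  have a1 := h.bH 1 (by norm_num) x
  have a2 := h.bH 2 (by norm_num) x
  have b1 := h.bP 1 (by norm_num) (by norm_num) x
  have b2 := h.bP 2 (by norm_num) (by norm_num) x
  refine mean_and_size_of_coord (c₃ := 0) (by fun_prop) hB h0 h1 hD hd ?_
    (by simp; positivity) (by simp; positivity) fun w => ?_
  · have u : |P 2 x * H 1 x + P 1 x * H 2 x| ≤ 2 * B ^ 2 := by
      refine (abs_add_le _ _).trans ?_
      linarith [abs_mul_le_of_le b2 a1, abs_mul_le_of_le b1 a2]
    have := abs_mul_le_of_le (a := σ ^ 2) (A := 1)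
      (by rw [abs_of_nonneg (by positivity)]; exact pow_le_one₀ h0 h1) u
    linarith
  · set δ := incr σ d w with hδ
    have t2 := abs_taylor_mul_le h.dP h.dH (fun k hk hk' => h.bP k hk (by omega))
      (fun k hk hk' => h.bH k (by omega)) x δ
    have t2' := abs_mul_le_of_le (a := σ ^ 2) (A := σ ^ 2) (abs_of_nonneg (by positivity)).le t2
    have s2 := incr_pow_two_le (B := B) h0 h1 hD hd w
    rw [← hδ] at s2
    have hp : 0 ≤ B ^ 2 * D ^ 4 * σ ^ 4 * wt w := by have := wt_nonneg w; positivity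
    rw [abs_le] at t2' ⊢
    constructor <;> linarith

end Coordinates

/-! ### Estimates on the scale `N = n ^ 36` -/

instance (N : ℕ) : IsProbabilityMeasure (stdGaussian N) := by unfold stdGaussian; infer_instance

/-- The fourth moment bound at level `c n¹⁹` with `N = n³⁶` gives `n^{72 - 76}`. -/
theorem exists_scaled_deviation_bound : ∃ K : ℝ, 0 < K ∧ ∀ (N : ℕ) (n : ℝ) (f : Fin N → ℝ → ℝ)
    (a : Fin N → ℝ) (c : ℝ), 1 ≤ n → n ^ 36 = N → (∀ i, Measurable (f i)) → 0 < c →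
    (∀ i w, |f i w - a i| ≤ c * wt w) →
    (stdGaussian N).real
      {w | c * n ^ 19 < |∑ i, f i (w i) - ∑ i, ∫ z, f i z ∂(gaussianReal 0 1)|} ≤ K / n ^ 4 := by
  obtain ⟨K, hK, h⟩ := exists_deviation_bound
  refine ⟨K, hK, fun N n f a c hn hN hf hc hb => (h N f a c (c * n ^ 19) hf hc.le hb
    (by positivity)).trans (le_of_eq ?_)⟩
  have : n ≠ 0 := by positivity
  rw [← hN]
  field_simp

/-- Three contributions: fluctuations `σ n¹⁹`, of order `n¹³`; the second order mean `σ² n¹⁹`, of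
order `n⁷`; and the mean error `N σ⁴`, of order `n¹²`. The first dominates. -/
theorem exists_scaled_sum_bound : ∃ K : ℝ, 0 < K ∧ ∀ (N : ℕ) (n : ℝ) (f : Fin N → ℝ → ℝ)
    (a g : Fin N → ℝ) (C G ℓ σ : ℝ), 1 ≤ n → n ^ 36 = N → (∀ i, Measurable (f i)) → 0 < C →
    0 ≤ G → 0 < ℓ → σ * n ^ 6 = ℓ → (∀ i w, |f i w - a i| ≤ C * σ * wt w) →
    (∀ i, |∫ z, f i z ∂(gaussianReal 0 1) - σ ^ 2 * g i| ≤ C * σ ^ 4) → |∑ i, g i| ≤ G * n ^ 19 →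
    (stdGaussian N).real {w | (C * ℓ + G * ℓ ^ 2 + C * ℓ ^ 4) * n ^ 13 < |∑ i, f i (w i)|}
      ≤ K / n ^ 4 := by
  obtain ⟨K, hK, h⟩ := exists_scaled_deviation_bound
  refine ⟨K, hK, fun N n f a g C G ℓ σ hn hN hf hC hG hℓ hσ hb hm hg => ?_⟩
  have hn0 : 0 < n := by positivity
  have hσ0 : 0 < σ := by
    by_contra! hneg
    have : σ * n ^ 6 ≤ 0 := mul_nonpos_of_nonpos_of_nonneg hneg (by positivity)
    linarith
  refine (measureReal_mono ?_).trans (h N n f a (C * σ) hn hN hf (by positivity) hb)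
  intro w hw
  simp only [Set.mem_ofPred_eq] at hw ⊢
  set E := ∑ i, ∫ z, f i z ∂(gaussianReal 0 1) with hE
  have hE' : |E| ≤ G * ℓ ^ 2 * n ^ 13 + C * ℓ ^ 4 * n ^ 13 := by
    have e1 : E = ∑ i, (∫ z, f i z ∂(gaussianReal 0 1) - σ ^ 2 * g i) + σ ^ 2 * ∑ i, g i := by
      rw [Finset.sum_sub_distrib, ← Finset.mul_sum]; ring
    have e2 : |∑ i, (∫ z, f i z ∂(gaussianReal 0 1) - σ ^ 2 * g i)| ≤ N * (C * σ ^ 4) := by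
      refine (Finset.abs_sum_le_sum_abs _ _).trans ((Finset.sum_le_sum fun i _ => hm i).trans ?_)
      simp
    have e3 : |σ ^ 2 * ∑ i, g i| ≤ σ ^ 2 * (G * n ^ 19) := by
      rw [abs_mul, abs_of_nonneg (by positivity)]; gcongr
    have e4 : (N : ℝ) * (C * σ ^ 4) = C * ℓ ^ 4 * n ^ 12 := by rw [← hN, ← hσ]; ring
    have e5 : σ ^ 2 * (G * n ^ 19) = G * ℓ ^ 2 * n ^ 7 := by rw [← hσ]; ring
    have e6 : C * ℓ ^ 4 * n ^ 12 ≤ C * ℓ ^ 4 * n ^ 13 := by gcongr; norm_num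
    have e7 : G * ℓ ^ 2 * n ^ 7 ≤ G * ℓ ^ 2 * n ^ 13 := by gcongr; norm_num
    have e8 := abs_add_le (∑ i, (∫ z, f i z ∂(gaussianReal 0 1) - σ ^ 2 * g i)) (σ ^ 2 * ∑ i, g i)
    rw [← e1] at e8
    linarith
  have e1 : C * σ * n ^ 19 = C * ℓ * n ^ 13 := by rw [← hσ]; ring
  have e2 := abs_sub_abs_le_abs_sub (∑ i, f i (w i)) E
  rw [e1]
  linarith

section Deterministic

variable {H P : ℕ → ℝ → ℝ} {B m σ ℓ n K : ℝ} {N : ℕ} {x w : Fin N → ℝ}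

theorem abs_dev_le (hn : 1 ≤ n) (hN : n ^ 36 = N) {f : ℝ → ℝ}
    (hx : |∑ i, f (x i) - N * m| ≤ n ^ 19) : |dev f m x| ≤ 1 / n ^ 17 := by
  have hn0 : 0 < n := by positivity
  have e : dev f m x = (∑ i, f (x i) - N * m) / n ^ 36 := by
    rw [dev, ← hN]; field_simp
  rw [e, abs_div, abs_of_pos (by positivity : 0 < n ^ 36)]
  calc |∑ i, f (x i) - N * m| / n ^ 36 ≤ n ^ 19 / n ^ 36 := by gcongr
    _ = _ := by field_simp

/-- Counting powers with `e` of order `n⁻¹⁷` and `e' - e` of order `n⁻²³`: the four terms have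
orders `n⁻¹⁰`, `n⁻⁴`, `n⁻¹⁰` and `n⁻⁴`. -/
theorem Chain.abs_interaction_le (h : Chain H P B) (hn : 1 ≤ n) (hN : n ^ 36 = N)
    (hσ : σ * n ^ 6 = ℓ) (hK : 0 ≤ K) (he : |dev (H 0) m x| ≤ 1 / n ^ 17)
    (h1 : |∑ i, (H 0 (x i + fieldIncr H P m σ x w i) - H 0 (x i))| ≤ K * n ^ 13)
    (h2 : |∑ i, trap H (x i) (fieldIncr H P m σ x w i)| ≤ K * n ^ 13)
    (h3 : |∑ i, (fieldIncr H P m σ x w i * (H 1 (x i + fieldIncr H P m σ x w i) - H 1 (x i))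
      + σ ^ 2 * (P 1 (x i + fieldIncr H P m σ x w i) * H 1 (x i + fieldIncr H P m σ x w i)))|
        ≤ K * n ^ 13)
    (h4 : |∑ i, σ ^ 2 * (P 1 (x i + fieldIncr H P m σ x w i) * H 1 (x i + fieldIncr H P m σ x w i)
      - P 1 (x i) * H 1 (x i))| ≤ K * n ^ 13) :
    |interaction H P m σ x w| ≤ (K ^ 2 + K + (2 + K) * K + ℓ ^ 2 * B ^ 2 * (2 + K) ^ 2) / n ^ 4 := by
  have hB := h.one_le
  have hn0 : 0 < n := by positivity
  simp only [interaction]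
  set δ := fieldIncr H P m σ x w with hδ
  set e := dev (H 0) m x with hee
  set e' := dev (H 0) m (fun i => x i + δ i) with hee'
  have hΔ : |e' - e| ≤ K / n ^ 23 := by
    have e1 : e' - e = (∑ i, (H 0 (x i + δ i) - H 0 (x i))) / n ^ 36 := by
      rw [hee', hee, dev, dev, Finset.sum_sub_distrib, hN]; ring
    rw [e1, abs_div, abs_of_pos (by positivity : 0 < n ^ 36)]
    calc _ ≤ K * n ^ 13 / n ^ 36 := by gcongr
      _ = _ := by field_simp
  have hle : ∀ {a b : ℕ}, a ≤ b → 1 / n ^ b ≤ 1 / n ^ a := fun hab => by gcongr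
  have he' : |e'| ≤ (1 + K) / n ^ 17 := by
    have := abs_add_le (e' - e) e
    rw [sub_add_cancel] at this
    have h5 : K / n ^ 23 ≤ K / n ^ 17 := by gcongr; norm_num
    rw [add_div]; linarith
  have hs : |e + e'| ≤ (2 + K) / n ^ 17 := by
    refine (abs_add_le _ _).trans ?_
    have : (2 + K) / n ^ 17 = 1 / n ^ 17 + (1 + K) / n ^ 17 := by ring
    linarith
  have hsq : ∀ z, |z| ≤ (1 + K) / n ^ 17 → z ^ 2 ≤ (2 + K) ^ 2 / n ^ 34 := fun z hz => by
    rw [← sq_abs]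
    calc |z| ^ 2 ≤ ((1 + K) / n ^ 17) ^ 2 := by gcongr
      _ ≤ ((2 + K) / n ^ 17) ^ 2 := by gcongr; norm_num
      _ = _ := by rw [div_pow, ← pow_mul]
  have he1 : |e| ≤ (1 + K) / n ^ 17 := he.trans (by gcongr; linarith)
  have t1 : |1 / 4 * (e' - e) * ∑ i, (δ i * (H 1 (x i + δ i) - H 1 (x i))
      + σ ^ 2 * (P 1 (x i + δ i) * H 1 (x i + δ i)))| ≤ K ^ 2 / n ^ 4 := by
    rw [abs_mul, abs_mul, abs_of_pos (by norm_num : (0 : ℝ) < 1 / 4)]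
    calc _ ≤ 1 / 4 * (K / n ^ 23) * (K * n ^ 13) := by gcongr
      _ = 1 / 4 * K ^ 2 * (1 / n ^ 10) := by field_simp
      _ ≤ 1 * K ^ 2 * (1 / n ^ 4) := by
        have := hle (show 4 ≤ 10 by norm_num)
        gcongr; norm_num
      _ = _ := by ring
  have t2 : |1 / 4 * e * ∑ i, σ ^ 2 * (P 1 (x i + δ i) * H 1 (x i + δ i) - P 1 (x i) * H 1 (x i))|
      ≤ K / n ^ 4 := by
    rw [abs_mul, abs_mul, abs_of_pos (by norm_num : (0 : ℝ) < 1 / 4)]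
    calc _ ≤ 1 / 4 * (1 / n ^ 17) * (K * n ^ 13) := by gcongr
      _ = 1 / 4 * (K / n ^ 4) := by field_simp
      _ ≤ 1 * (K / n ^ 4) := by gcongr; norm_num
      _ = _ := by ring
  have t3 : |1 / 2 * (e + e') * ∑ i, trap H (x i) (δ i)| ≤ (2 + K) * K / n ^ 4 := by
    rw [abs_mul, abs_mul, abs_of_pos (by norm_num : (0 : ℝ) < 1 / 2)]
    calc _ ≤ 1 / 2 * ((2 + K) / n ^ 17) * (K * n ^ 13) := by gcongr
      _ = 1 / 2 * ((2 + K) * K / n ^ 4) := by field_simp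
      _ ≤ 1 * ((2 + K) * K / n ^ 4) := by gcongr; norm_num
      _ = _ := by ring
  have hH : ∀ z, H 1 z ^ 2 ≤ B ^ 2 := fun z => by
    rw [← sq_abs]; have := h.bH 1 (by norm_num) z; gcongr
  have t4 : |σ ^ 2 / 8 * ∑ i, (H 1 (x i + δ i) ^ 2 * e' ^ 2 - H 1 (x i) ^ 2 * e ^ 2)|
      ≤ ℓ ^ 2 * B ^ 2 * (2 + K) ^ 2 / n ^ 4 := by
    rw [abs_mul, abs_of_nonneg (by positivity : 0 ≤ σ ^ 2 / 8)]
    have b : |∑ i, (H 1 (x i + δ i) ^ 2 * e' ^ 2 - H 1 (x i) ^ 2 * e ^ 2)|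
        ≤ N * (B ^ 2 * ((2 + K) ^ 2 / n ^ 34)) := by
      refine (Finset.abs_sum_le_sum_abs _ _).trans ((Finset.sum_le_sum
        (g := fun _ => B ^ 2 * ((2 + K) ^ 2 / n ^ 34)) fun i _ => ?_).trans (by simp))
      have u1 : H 1 (x i + δ i) ^ 2 * e' ^ 2 ≤ B ^ 2 * ((2 + K) ^ 2 / n ^ 34) :=
        mul_le_mul (hH _) (hsq _ he') (by positivity) (by positivity)
      have u2 : H 1 (x i) ^ 2 * e ^ 2 ≤ B ^ 2 * ((2 + K) ^ 2 / n ^ 34) :=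
        mul_le_mul (hH _) (hsq _ he1) (by positivity) (by positivity)
      have u3 : 0 ≤ H 1 (x i + δ i) ^ 2 * e' ^ 2 := by positivity
      have u4 : 0 ≤ H 1 (x i) ^ 2 * e ^ 2 := by positivity
      rw [abs_le]; constructor <;> linarith
    calc _ ≤ σ ^ 2 / 8 * (N * (B ^ 2 * ((2 + K) ^ 2 / n ^ 34))) := by gcongr
      _ = 1 / 8 * (ℓ ^ 2 * B ^ 2 * (2 + K) ^ 2) * (1 / n ^ 10) := by
        rw [← hN, ← hσ]; field_simp
      _ ≤ 1 * (ℓ ^ 2 * B ^ 2 * (2 + K) ^ 2) * (1 / n ^ 4) := by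
        have := hle (show 4 ≤ 10 by norm_num)
        gcongr; norm_num
      _ = _ := by ring
  rw [add_div, add_div, add_div]
  rw [abs_le] at t1 t2 t3 t4 ⊢
  constructor <;> linarith

theorem Chain.abs_drift_le (h : Chain H P B) {e : ℝ} (he : |e| ≤ 1) (z : ℝ) :
    |P 1 z - H 1 z * e| ≤ 2 * B := by
  refine (abs_sub _ _).trans ?_
  have := abs_mul_le_of_le (h.bH 1 (by norm_num) z) he
  linarith [h.bP 1 le_rfl (by norm_num) z]

/-- The two increments differ by order `σ² n⁻¹⁷` and the ratio has Lipschitz constant of order `σ²`;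
summing over `n³⁶` coordinates leaves `n⁻⁵`. -/
theorem Chain.abs_sum_ratio_sub_le (h : Chain H P B) (hn : 1 ≤ n) (h0 : 0 ≤ σ) (h1 : σ ≤ 1) (hσ : σ * n ^ 6 = ℓ) (he : |dev (H 0) m x| ≤ 1 / n ^ 17)
    (hw : ∑ i, wt (w i) ≤ K * n ^ 36) :
    |∑ i, ratio P σ (x i) (fieldIncr H P m σ x w i)
      - ∑ i, ratio P σ (x i) (incr σ (P 1 (x i)) (w i))| ≤ 4 * B ^ 5 * ℓ ^ 4 * K / n ^ 4 := by
  have hB := h.one_le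
  have hn0 : 0 < n := by positivity
  have he1 : |dev (H 0) m x| ≤ 1 :=
    he.trans (by rw [div_le_one (by positivity)]; exact one_le_pow₀ hn)
  have hD : 1 ≤ 2 * B := by linarith
  rw [← Finset.sum_sub_distrib]
  have hi : ∀ i, |ratio P σ (x i) (fieldIncr H P m σ x w i)
      - ratio P σ (x i) (incr σ (P 1 (x i)) (w i))|
        ≤ 4 * B ^ 5 * σ ^ 4 * (1 / n ^ 17) * wt (w i) := by
    intro i
    refine (h.abs_ratio_sub_ratio_le hD (x i) (w i) _ _
      (abs_incr_le h0 h1 hD ((h.bP 1 le_rfl (by norm_num) _).trans (by linarith)) _)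
      (abs_incr_le h0 h1 hD (h.abs_drift_le he1 _) _)).trans ?_
    have e1 : fieldIncr H P m σ x w i - incr σ (P 1 (x i)) (w i)
        = - (σ ^ 2 / 2) * (H 1 (x i) * dev (H 0) m x) := by
      rw [fieldIncr, incr, incr]; ring
    have e2 : |fieldIncr H P m σ x w i - incr σ (P 1 (x i)) (w i)|
        ≤ σ ^ 2 / 2 * (B * (1 / n ^ 17)) := by
      rw [e1, abs_mul, abs_neg, abs_of_nonneg (by positivity : 0 ≤ σ ^ 2 / 2)]
      have := abs_mul_le_of_le (h.bH 1 (by norm_num) (x i)) he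
      gcongr
    have hw := wt_nonneg (w i)
    unfold fieldIncr at e2
    calc _ ≤ 2 * B ^ 2 * (2 * B) ^ 2 * σ ^ 2 * wt (w i) * (σ ^ 2 / 2 * (B * (1 / n ^ 17))) := by
          gcongr
      _ = _ := by ring
  refine (Finset.abs_sum_le_sum_abs _ _).trans ((Finset.sum_le_sum fun i _ => hi i).trans ?_)
  rw [← Finset.mul_sum]
  have hK : 0 ≤ K := by
    by_contra! hneg
    have h5 : K * n ^ 36 < 0 := mul_neg_of_neg_of_pos hneg (by positivity)
    have h6 : 0 ≤ ∑ i, wt (w i) := Finset.sum_nonneg fun i _ => wt_nonneg _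
    linarith
  calc _ ≤ 4 * B ^ 5 * σ ^ 4 * (1 / n ^ 17) * (K * n ^ 36) := by gcongr
    _ = 4 * B ^ 5 * ℓ ^ 4 * K / n ^ 5 := by rw [← hσ]; field_simp
    _ ≤ _ := by gcongr; norm_num

end Deterministic

/-- Outside six exceptional events, each of probability `O(n⁻⁴)`, the log-acceptance ratio is the
leading Gaussian functional plus the sum of the conditional means. Four events control the
interaction, one the Taylor remainder, one the total weight of the noise. -/
theorem Chain.exists_remainder_bound {H P : ℕ → ℝ → ℝ} {B ℓ : ℝ} (h : Chain H P B) (hℓ : 0 < ℓ) :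
    ∃ C : ℝ, 0 ≤ C ∧ ∀ (N : ℕ) (n m σ : ℝ) (x : Fin N → ℝ), 1 ≤ n → n ^ 36 = N → σ * n ^ 6 = ℓ →
      σ ≤ 1 → |∑ i, H 0 (x i) - N * m| ≤ n ^ 19 →
      |∑ i, (H 2 (x i) + H 1 (x i) * P 1 (x i))| ≤ n ^ 19 →
      (stdGaussian N).real {w | C / n ^ 4 <
        |∑ i, ratio P σ (x i) (fieldIncr H P m σ x w i) + interaction H P m σ x w
          + σ ^ 3 * ∑ i, lead P (x i) (w i) - ∑ i, ratioMean P σ (x i)|} ≤ C / n ^ 4 := by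
  obtain ⟨K₁, hK₁, dev1⟩ := exists_scaled_deviation_bound
  obtain ⟨K₂, hK₂, dev2⟩ := exists_scaled_sum_bound
  have hB := h.one_le
  have hW := one_le_wtMean
  have hB3 : 1 ≤ B ^ 3 := one_le_pow₀ hB
  have hc0 : 0 < coordConst B (2 * B) := by unfold coordConst; positivity
  -- The extra `2 * B ^ 3` absorbs the `σ⁴` term in the means of `coord_drift` and `coord_product`,
  -- whose linear coefficient already carries `σ²`.
  set C₁ : ℝ := coordConst B (2 * B) + 2 * B ^ 3 with hC₁
  have hC₁0 : 0 < C₁ := by positivity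
  set K : ℝ := C₁ * ℓ + (1 + B ^ 2) * ℓ ^ 2 + C₁ * ℓ ^ 4 with hK
  have hK0 : 0 < K := by positivity
  set C : ℝ := (K ^ 2 + K + (2 + K) * K + ℓ ^ 2 * B ^ 2 * (2 + K) ^ 2)
    + 4 * B ^ 5 * ℓ ^ 4 * (wtMean + 1) + 4 * B ^ 5 * ℓ ^ 4 + 2 * K₁ + 4 * K₂ with hC
  refine ⟨C, by positivity, fun N n m σ x hn hN hσ hσ1 hx1 hx2 => ?_⟩
  have hn0 : 0 < n := by positivity
  have hσ0 : 0 < σ := by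
    by_contra! hneg
    have : σ * n ^ 6 ≤ 0 := mul_nonpos_of_nonpos_of_nonneg hneg (by positivity)
    linarith
  have he := abs_dev_le hn hN hx1
  set e := dev (H 0) m x with hee
  have he1 : |e| ≤ 1 := he.trans (by rw [div_le_one (by positivity)]; exact one_le_pow₀ hn)
  have hD : 1 ≤ 2 * B := by linarith
  set d : Fin N → ℝ := fun i => P 1 (x i) - H 1 (x i) * e with hd
  have hdD : ∀ i, |d i| ≤ 2 * B := fun i => h.abs_drift_le he1 _
  have hfi : ∀ w i, fieldIncr H P m σ x w i = incr σ (d i) (w i) := fun w i => rfl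
  have hle : ∀ z w : ℝ, z ≤ coordConst B (2 * B) * σ * wt w → z ≤ C₁ * σ * wt w := fun z w hz =>
    hz.trans (by have := wt_nonneg w; gcongr; rw [hC₁]; linarith)
  have hle4 : coordConst B (2 * B) * σ ^ 4 ≤ C₁ * σ ^ 4 := by gcongr; rw [hC₁]; linarith
  have cH := h.continuous_H
  have cP := h.continuous_P
  have ci := fun i => continuous_incr σ (d i)
  have hprod : ∀ i, |(P 2 (x i) * H 1 (x i) + P 1 (x i) * H 2 (x i)) * d i / 2| ≤ 2 * B ^ 3 := by
    intro i
    have u : |P 2 (x i) * H 1 (x i) + P 1 (x i) * H 2 (x i)| ≤ 2 * B ^ 2 := by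
      refine (abs_add_le _ _).trans ?_
      linarith [abs_mul_le_of_le (h.bP 2 (by norm_num) (by norm_num) (x i))
        (h.bH 1 (by norm_num) (x i)), abs_mul_le_of_le (h.bP 1 (by norm_num) (by norm_num) (x i))
        (h.bH 2 (by norm_num) (x i))]
    have := abs_mul_le_of_le u (hdD i)
    rw [abs_div, abs_of_pos (by norm_num : (0 : ℝ) < 2)]
    linarith
  have hg0 : (0 : ℝ) ≤ (1 + B ^ 2) * n ^ 19 := by positivity
  have hgs : |∑ i, (H 2 (x i) + H 1 (x i) * P 1 (x i))| ≤ (1 + B ^ 2) * n ^ 19 :=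
    hx2.trans (by nlinarith [pow_pos hn0 19, sq_nonneg B])
  have S1 := dev2 N n (fun i w => H 0 (x i + incr σ (d i) w) - H 0 (x i)) (fun _ => 0)
    (fun i => H 1 (x i) * d i / 2 + H 2 (x i) / 2) C₁ (1 + B ^ 2) ℓ σ hn hN
    (fun i => by have := cH 0; have := ci i; fun_prop) hC₁0 (by positivity) hℓ hσ
    (fun i w => hle _ _ ((h.coord_value hσ0.le hσ1 hD (hdD i) (x i)).2 w))
    (fun i => by
      have := (h.coord_value hσ0.le hσ1 hD (hdD i) (x i)).1
      rw [zero_add] at this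
      exact this.trans hle4) (by
      -- The drift contains the deviation `e`. Besides half the centred sum this leaves `e / 2`
      -- times a sum of squares, again of order `n⁻¹⁷ n³⁶ = n¹⁹`.
      have e1 : ∑ i, (H 1 (x i) * d i / 2 + H 2 (x i) / 2)
          = 1 / 2 * ∑ i, (H 2 (x i) + H 1 (x i) * P 1 (x i)) - e / 2 * ∑ i, H 1 (x i) ^ 2 := by
        rw [Finset.mul_sum, Finset.mul_sum, ← Finset.sum_sub_distrib]
        refine Finset.sum_congr rfl fun i _ => ?_
        simp only [hd]; ring
      have e2 : |∑ i, H 1 (x i) ^ 2| ≤ n ^ 36 * B ^ 2 := by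
        refine (Finset.abs_sum_le_sum_abs _ _).trans ((Finset.sum_le_sum
          (g := fun _ => B ^ 2) fun i _ => ?_).trans (by simp [hN]))
        exact abs_pow_le_of_le (h.bH 1 (by norm_num) _) 2
      have e3 := abs_mul_le_of_le he e2
      have e4 : 1 / n ^ 17 * (n ^ 36 * B ^ 2) = B ^ 2 * n ^ 19 := by field_simp
      rw [e4, abs_le] at e3
      rw [abs_le] at hx2
      rw [e1, abs_le]
      constructor <;> linarith)
  have S2 := dev2 N n (fun i w => trap H (x i) (incr σ (d i) w)) (fun _ => 0) (fun _ => 0)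
    C₁ (1 + B ^ 2) ℓ σ hn hN
    (fun i => by have := cH 0; have := cH 1; have := ci i; unfold trap; fun_prop) hC₁0
    (by positivity) hℓ hσ
    (fun i w => hle _ _ ((h.coord_trap hσ0.le hσ1 hD (hdD i) (x i)).2 w))
    (fun i => by
      have := (h.coord_trap hσ0.le hσ1 hD (hdD i) (x i)).1
      simp only [zero_mul, zero_div, add_zero, mul_zero] at this ⊢
      exact this.trans hle4) (by simpa using hg0)
  have S3 := dev2 N n (fun i w => incr σ (d i) w * (H 1 (x i + incr σ (d i) w) - H 1 (x i))
      + σ ^ 2 * (P 1 (x i + incr σ (d i) w) * H 1 (x i + incr σ (d i) w)))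
    (fun i => σ ^ 2 * (P 1 (x i) * H 1 (x i))) (fun i => H 2 (x i) + H 1 (x i) * P 1 (x i))
    C₁ (1 + B ^ 2) ℓ σ hn hN
    (fun i => by have := cP 1; have := cH 1; have := ci i; fun_prop) hC₁0 (by positivity) hℓ hσ
    (fun i w => hle _ _ ((h.coord_drift hσ0.le hσ1 hD (hdD i) (x i)).2 w))
    (fun i => by
      have u := (h.coord_drift hσ0.le hσ1 hD (hdD i) (x i)).1
      have v := abs_mul_le_of_le (a := σ ^ 4) (A := σ ^ 4) (abs_of_nonneg (by positivity)).le
        (hprod i)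
      have : C₁ * σ ^ 4 = coordConst B (2 * B) * σ ^ 4 + σ ^ 4 * (2 * B ^ 3) := by rw [hC₁]; ring
      rw [this]
      rw [abs_le] at u v ⊢
      constructor <;> linarith) hgs
  have S4 := dev2 N n (fun i w => σ ^ 2 * (P 1 (x i + incr σ (d i) w) * H 1 (x i + incr σ (d i) w)
      - P 1 (x i) * H 1 (x i))) (fun _ => 0) (fun _ => 0)
    C₁ (1 + B ^ 2) ℓ σ hn hN
    (fun i => by have := cP 1; have := cH 1; have := ci i; fun_prop) hC₁0 (by positivity) hℓ hσ
    (fun i w => hle _ _ ((h.coord_product hσ0.le hσ1 hD (hdD i) (x i)).2 w))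
    (fun i => by
      have u := (h.coord_product hσ0.le hσ1 hD (hdD i) (x i)).1
      have v := abs_mul_le_of_le (a := σ ^ 4) (A := σ ^ 4) (abs_of_nonneg (by positivity)).le
        (hprod i)
      have : C₁ * σ ^ 4 = coordConst B (2 * B) * σ ^ 4 + σ ^ 4 * (2 * B ^ 3) := by rw [hC₁]; ring
      rw [this]
      rw [abs_le] at u v ⊢
      constructor <;> linarith) (by simpa using hg0)
  -- Once the leading term is removed the summands are of size `σ⁴`, so they deviate by order `n⁻⁵`
  -- from the sum of the conditional means; `lead` is centred and does not change these.
  have S5 := dev1 N n (fun i w => ratio P σ (x i) (incr σ (P 1 (x i)) w) + σ ^ 3 * lead P (x i) w)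
    (fun _ => 0) (4 * B ^ 5 * σ ^ 4) hn hN
    (fun i => by
      have := h.continuous_ratio_incr_right σ (x i)
      have := continuous_lead P (x i)
      fun_prop) (by positivity)
    (fun i w => by rw [sub_zero]; exact h.abs_ratio_add_lead_le hσ0.le hσ1 (x i) w)
  have S6 := dev1 N n (fun _ => wt) (fun _ => 0) 1 hn hN (fun _ => continuous_wt.measurable)
    one_pos (fun i w => by rw [sub_zero, one_mul, abs_of_nonneg (wt_nonneg w)])
  have hmean : ∀ i, ∫ w, (ratio P σ (x i) (incr σ (P 1 (x i)) w) + σ ^ 3 * lead P (x i) w)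
      ∂(gaussianReal 0 1) = ratioMean P σ (x i) := fun i => by
    have i1 := integrable_of_abs_le_wt (h.continuous_ratio_incr_right σ (x i))
      (h.abs_ratio_le hσ0.le hσ1 (x i))
    have i2 := integrable_of_abs_le_wt (continuous_lead P (x i)) (h.abs_lead_le (x i))
    rw [integral_add i1 (i2.const_mul _), integral_const_mul, integral_lead, mul_zero, add_zero,
      ratioMean]
  simp only [hmean] at S5
  simp only [← hK] at S1 S2 S3 S4
  set A1 := {w : Fin N → ℝ | K * n ^ 13 < |∑ i, (H 0 (x i + incr σ (d i) (w i)) - H 0 (x i))|}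
  set A2 := {w : Fin N → ℝ | K * n ^ 13 < |∑ i, trap H (x i) (incr σ (d i) (w i))|}
  set A3 := {w : Fin N → ℝ | K * n ^ 13 < |∑ i, (incr σ (d i) (w i)
      * (H 1 (x i + incr σ (d i) (w i)) - H 1 (x i))
      + σ ^ 2 * (P 1 (x i + incr σ (d i) (w i)) * H 1 (x i + incr σ (d i) (w i))))|}
  set A4 := {w : Fin N → ℝ | K * n ^ 13 < |∑ i, σ ^ 2 * (P 1 (x i + incr σ (d i) (w i))
      * H 1 (x i + incr σ (d i) (w i)) - P 1 (x i) * H 1 (x i))|}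
  set A5 := {w : Fin N → ℝ | 4 * B ^ 5 * σ ^ 4 * n ^ 19 < |∑ i, (ratio P σ (x i)
      (incr σ (P 1 (x i)) (w i)) + σ ^ 3 * lead P (x i) (w i)) - ∑ i, ratioMean P σ (x i)|}
  set A6 := {w : Fin N → ℝ | 1 * n ^ 19 < |∑ i, wt (w i)
      - ∑ _i : Fin N, ∫ z, wt z ∂(gaussianReal 0 1)|}
  have hsub : {w | C / n ^ 4 <
        |∑ i, ratio P σ (x i) (fieldIncr H P m σ x w i) + interaction H P m σ x w
          + σ ^ 3 * ∑ i, lead P (x i) (w i) - ∑ i, ratioMean P σ (x i)|}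
      ⊆ A1 ∪ (A2 ∪ (A3 ∪ (A4 ∪ (A5 ∪ A6)))) := by
    intro w hw
    by_contra hcon
    simp only [A1, A2, A3, A4, A5, A6, Set.mem_union, Set.mem_ofPred_eq, not_or, not_lt] at hcon
    rw [Set.mem_ofPred_eq] at hw
    obtain ⟨q1, q2, q3, q4, q5, q6⟩ := hcon
    refine absurd hw (not_lt.2 ?_)
    have r := h.abs_interaction_le (w := w) hn hN hσ hK0.le he q1 q2
      q3 q4
    have q6' : ∑ i, wt (w i) ≤ (wtMean + 1) * n ^ 36 := by
      have u := (abs_le.1 q6).2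
      have v : ∑ _i : Fin N, ∫ z, wt z ∂(gaussianReal 0 1) = wtMean * n ^ 36 := by
        simp [wtMean, hN, mul_comm]
      have hp : n ^ 19 ≤ n ^ 36 := by gcongr; norm_num
      rw [v] at u
      linarith
    have s := h.abs_sum_ratio_sub_le (w := w) hn hσ0.le hσ1 hσ he q6'
    have t := q5
    rw [Finset.sum_add_distrib, ← Finset.mul_sum] at t
    have t' : 4 * B ^ 5 * σ ^ 4 * n ^ 19 ≤ 4 * B ^ 5 * ℓ ^ 4 / n ^ 4 := by
      calc 4 * B ^ 5 * σ ^ 4 * n ^ 19 = 4 * B ^ 5 * ℓ ^ 4 / n ^ 5 := by rw [← hσ]; field_simp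
        _ ≤ _ := by gcongr; norm_num
    have tot : C / n ^ 4 = (K ^ 2 + K + (2 + K) * K + ℓ ^ 2 * B ^ 2 * (2 + K) ^ 2) / n ^ 4
        + 4 * B ^ 5 * ℓ ^ 4 * (wtMean + 1) / n ^ 4 + 4 * B ^ 5 * ℓ ^ 4 / n ^ 4
        + (2 * K₁ + 4 * K₂) / n ^ 4 := by rw [hC]; ring
    have hp : 0 ≤ (2 * K₁ + 4 * K₂) / n ^ 4 := by positivity
    rw [tot]
    rw [abs_le] at r s t ⊢
    constructor <;> linarith
  refine (measureReal_mono hsub).trans ?_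
  have hU : (stdGaussian N).real (A1 ∪ (A2 ∪ (A3 ∪ (A4 ∪ (A5 ∪ A6))))) ≤
      K₂ / n ^ 4 + (K₂ / n ^ 4 + (K₂ / n ^ 4 + (K₂ / n ^ 4 + (K₁ / n ^ 4 + K₁ / n ^ 4)))) :=
    (measureReal_union_le _ _).trans (add_le_add S1 ((measureReal_union_le _ _).trans
      (add_le_add S2 ((measureReal_union_le _ _).trans (add_le_add S3
        ((measureReal_union_le _ _).trans (add_le_add S4 ((measureReal_union_le _ _).trans
          (add_le_add S5 S6)))))))))
  have hp : 0 ≤ ((K ^ 2 + K + (2 + K) * K + ℓ ^ 2 * B ^ 2 * (2 + K) ^ 2)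
    + 4 * B ^ 5 * ℓ ^ 4 * (wtMean + 1) + 4 * B ^ 5 * ℓ ^ 4) / n ^ 4 := by positivity
  have tot : C / n ^ 4 = ((K ^ 2 + K + (2 + K) * K + ℓ ^ 2 * B ^ 2 * (2 + K) ^ 2)
    + 4 * B ^ 5 * ℓ ^ 4 * (wtMean + 1) + 4 * B ^ 5 * ℓ ^ 4) / n ^ 4
    + (2 * (K₁ / n ^ 4) + 4 * (K₂ / n ^ 4)) := by rw [hC]; ring
  linarith

/-! ### Typical configurations -/

/-- The configurations whose empirical sums of the functions `f k` are close to their means. -/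
def typicalSet {ι : Type*} (f : ι → ℝ → ℝ) (π : Measure ℝ) (r : ℝ) (N : ℕ) : Set (Fin N → ℝ) :=
  {x | ∀ k, |∑ i, f k (x i) - N * ∫ z, f k z ∂π| ≤ r}

theorem measurableSet_typicalSet {ι : Type*} [Countable ι] {f : ι → ℝ → ℝ}
    (hf : ∀ k, Measurable (f k)) (π : Measure ℝ) (r : ℝ) (N : ℕ) :
    MeasurableSet (typicalSet f π r N) := by
  have : typicalSet f π r N = ⋂ k, {x | |∑ i, f k (x i) - N * ∫ z, f k z ∂π| ≤ r} := by
    ext x; simp [typicalSet]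
  rw [this]
  refine MeasurableSet.iInter fun k => measurableSet_le ?_ measurable_const
  have := hf k
  exact measurable_norm.comp ((Finset.measurable_sum _ fun i _ =>
    this.comp (measurable_pi_apply i)).sub_const _)

theorem real_compl_typicalSet_le {ι : Type*} [Fintype ι] {f : ι → ℝ → ℝ} {π : Measure ℝ}
    [IsProbabilityMeasure π] {C r : ℝ} (hf : ∀ k, Measurable (f k)) (hC : ∀ k x, |f k x| ≤ C)
    (hr : 0 ≤ r) (N : ℕ) :
    (Measure.pi fun _ : Fin N => π).real (typicalSet f π r N)ᶜ
      ≤ Fintype.card ι * (2 * Real.exp (-r ^ 2 / (2 * (N * C ^ 2)))) := by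
  have : (typicalSet f π r N)ᶜ = ⋃ k, {x | r < |∑ i, f k (x i) - N * ∫ z, f k z ∂π|} := by
    ext x; simp [typicalSet]
  rw [this]
  refine (measureReal_iUnion_fintype_le _).trans ((Finset.sum_le_sum fun k _ =>
    hoeffding_pi (hf k) (hC k) N hr).trans ?_)
  simp

/-- The functions whose empirical means determine the acceptance ratio. -/
noncomputable def observables (H P : ℕ → ℝ → ℝ) (σ : ℝ) : Fin 4 → ℝ → ℝ :=
  ![H 0, fun z => H 2 z + H 1 z * P 1 z, varTerm P, fun z => ratioMean P σ z / σ ^ 4]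

section Observables

variable {H P : ℕ → ℝ → ℝ} {B σ : ℝ}

theorem Chain.measurable_observables (h : Chain H P B) (σ : ℝ) (k : Fin 4) :
    Measurable (observables H P σ k) := by
  have h1 := h.continuous_H 1
  have h2 := h.continuous_H 2
  have h3 := h.continuous_P 1
  fin_cases k
  · exact (h.continuous_H 0).measurable
  · exact (by fun_prop : Continuous fun z => H 2 z + H 1 z * P 1 z).measurable
  · exact h.continuous_varTerm.measurable
  · exact (h.measurable_ratioMean σ).div_const _

/-- Division of the conditional mean by `σ⁴` gives a bound uniform in `σ`, so Hoeffding's inequality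
applies with one constant although this observable varies with `N`. -/
theorem Chain.abs_observables_le (h : Chain H P B) (h0 : 0 < σ) (h1 : σ ≤ 1) (k : Fin 4) (x : ℝ) :
    |observables H P σ k x| ≤ 4 * B ^ 5 * wtMean := by
  have hB := h.one_le
  have hW := one_le_wtMean
  have hp : ∀ j ≤ 5, B ^ j ≤ B ^ 5 := fun j hj => pow_le_pow_right₀ hB hj
  have hb : B ^ 5 ≤ B ^ 5 * wtMean := le_mul_of_one_le_right (by positivity) hW
  have p1 := hp 1 (by norm_num)
  have p2 := hp 2 (by norm_num)
  have p4 := hp 4 (by norm_num)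
  have p0 : 0 ≤ B ^ 5 := by positivity
  rw [pow_one] at p1
  fin_cases k
  · refine (h.bH 0 (by norm_num) x).trans ?_
    linarith
  · refine (abs_add_le _ _).trans ?_
    have := abs_mul_le_of_le (h.bH 1 (by norm_num) x) (h.bP 1 le_rfl (by norm_num) x)
    linarith [h.bH 2 (by norm_num) x]
  · refine (h.abs_varTerm_le x).trans ?_
    linarith
  · change |ratioMean P σ x / σ ^ 4| ≤ _
    rw [abs_div, abs_of_pos (by positivity : 0 < σ ^ 4), div_le_iff₀ (by positivity)]
    exact h.abs_ratioMean_le h0.le h1 x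

end Observables

/-! ### The central limit theorem on the typical set -/

/-- The normalised leading sum is compared with the normal law, the conditional means sum to
`-ℓ⁶τ²/2` up to `n⁻⁴`, and everything else is a perturbation small in probability. The shift by
`ℓ³τ/2` cancels exactly the limiting mean. -/
theorem Chain.exists_cdf_bound {H P : ℕ → ℝ → ℝ} {B c ℓ τ : ℝ} {π : Measure ℝ}
    [IsProbabilityMeasure π] (h : Chain H P B) (hi : Integrable fun x => Real.exp (P 0 x))
    (hg : ∀ g : ℝ → ℝ, ∫ x, g x ∂π = c * ∫ x, Real.exp (P 0 x) * g x) (hℓ : 0 < ℓ) (hτ : 0 < τ)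
    (hτ2 : τ ^ 2 = ∫ x, varTerm P x ∂π) :
    ∃ C : ℝ, 0 ≤ C ∧ ∀ (N : ℕ) (n σ : ℝ) (x : Fin N → ℝ), 1 ≤ n → n ^ 36 = N → σ * n ^ 6 = ℓ →
      σ ≤ 1 → x ∈ typicalSet (observables H P σ) π (n ^ 19) N → ∀ u,
      |(stdGaussian N).real {w | (∑ i, ratio P σ (x i) (fieldIncr H P (∫ z, H 0 z ∂π) σ x w i)
          + interaction H P (∫ z, H 0 z ∂π) σ x w) / (ℓ ^ 3 * τ) + ℓ ^ 3 * τ / 2 ≤ u}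
        - cdf (gaussianReal 0 1) u| ≤ C / n ^ 4 := by
  obtain ⟨K₀, hK₀, hclt⟩ := exists_kolmogorov_bound
  obtain ⟨C₀, hC₀, hrem⟩ := h.exists_remainder_bound hℓ
  obtain ⟨K₁, hK₁, hmean⟩ := h.exists_mean_bound (π := π) (c := c) hi hg
  have hB := h.one_le
  set T := ℓ ^ 3 * τ with hT
  have hT0 : 0 < T := by positivity
  refine ⟨K₀ * (1 + ℓ ^ 9 * B ^ 15 / T ^ 3 + 1 / τ ^ 2) + (C₀ + ℓ ^ 4 + K₁ * ℓ ^ 7) / T + C₀,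
    by positivity, fun N n σ x hn hN hσ hσ1 hx u => ?_⟩
  have hn0 : 0 < n := by positivity
  have hσ0 : 0 < σ := by
    by_contra! hneg
    have : σ * n ^ 6 ≤ 0 := mul_nonpos_of_nonpos_of_nonneg hneg (by positivity)
    linarith
  have hx0 : |∑ i, H 0 (x i) - N * ∫ z, H 0 z ∂π| ≤ n ^ 19 := hx 0
  have hx1 : |∑ i, (H 2 (x i) + H 1 (x i) * P 1 (x i))
      - N * ∫ z, (H 2 z + H 1 z * P 1 z) ∂π| ≤ n ^ 19 := hx 1
  have hx2 : |∑ i, varTerm P (x i) - N * ∫ z, varTerm P z ∂π| ≤ n ^ 19 := hx 2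
  have hx3 : |∑ i, ratioMean P σ (x i) / σ ^ 4 - N * ∫ z, ratioMean P σ z / σ ^ 4 ∂π| ≤ n ^ 19 :=
    hx 3
  rw [h.integral_ibp_eq_zero hi hg, mul_zero, sub_zero] at hx1
  rw [← hτ2] at hx2
  have hσe : σ = ℓ / n ^ 6 := by rw [← hσ]; field_simp
  have hT2 : T ^ 2 = n ^ 36 * σ ^ 6 * τ ^ 2 := by rw [hT, ← hσ]; ring
  set m := ∫ z, H 0 z ∂π with hm
  -- the Gaussian approximation of the leading term
  have hS : ∀ u, |(stdGaussian N).real {w | ∑ i, -(σ ^ 3 / T) * lead P (x i) (w i) ≤ u}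
      - cdf (gaussianReal 0 1) u| ≤
      K₀ * (1 + ℓ ^ 9 * B ^ 15 / T ^ 3 + 1 / τ ^ 2) / n ^ 4 := by
    intro u
    -- The smoothing width is the target rate `n⁻⁴`. With summands of size `n⁻¹⁸` the Lindeberg term
    -- is then `n^{36 - 54 + 12} = n⁻⁶`, and the variance error `n⁻¹⁷` becomes `n⁻¹³`.
    have b := hclt N (fun i w => -(σ ^ 3 / T) * lead P (x i) w) (σ ^ 3 / T * B ^ 5) (1 / n ^ 4)
      (σ ^ 6 / T ^ 2 * ∑ i, varTerm P (x i)) u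
      (fun i => ((continuous_lead P (x i)).const_mul _).measurable) (by positivity)
      (fun i w => by
        rw [abs_mul, abs_neg, abs_of_pos (by positivity : 0 < σ ^ 3 / T), mul_assoc]
        have := h.abs_lead_le (x i) w
        gcongr)
      (fun i => by rw [integral_const_mul, integral_lead, mul_zero])
      (by
        rw [Finset.mul_sum]
        refine Finset.sum_congr rfl fun i _ => ?_
        simp_rw [mul_pow]
        rw [integral_const_mul, integral_lead_sq]
        ring) (by positivity)
    refine b.trans ?_
    have v1 : (N : ℝ) * (σ ^ 3 / T * B ^ 5) ^ 3 / (1 / n ^ 4) ^ 3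
        ≤ ℓ ^ 9 * B ^ 15 / T ^ 3 / n ^ 4 := by
      calc (N : ℝ) * (σ ^ 3 / T * B ^ 5) ^ 3 / (1 / n ^ 4) ^ 3
          = ℓ ^ 9 * B ^ 15 / T ^ 3 / n ^ 6 := by rw [← hN, hσe]; field_simp
        _ ≤ _ := by gcongr; norm_num
    have v2 : |σ ^ 6 / T ^ 2 * ∑ i, varTerm P (x i) - 1| / (1 / n ^ 4) ≤ 1 / τ ^ 2 / n ^ 4 := by
      have e1 : σ ^ 6 / T ^ 2 * ∑ i, varTerm P (x i) - 1
          = σ ^ 6 / T ^ 2 * (∑ i, varTerm P (x i) - N * τ ^ 2) := by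
        rw [mul_sub, ← hN, hT2]
        congr 1
        field_simp
      rw [e1, abs_mul, abs_of_pos (by positivity : 0 < σ ^ 6 / T ^ 2)]
      calc _ ≤ σ ^ 6 / T ^ 2 * n ^ 19 / (1 / n ^ 4) := by gcongr
        _ = 1 / τ ^ 2 / n ^ 13 := by rw [hT2]; field_simp
        _ ≤ _ := by gcongr; norm_num
    calc _ ≤ K₀ * (1 / n ^ 4 + ℓ ^ 9 * B ^ 15 / T ^ 3 / n ^ 4 + 1 / τ ^ 2 / n ^ 4) := by gcongr
      _ = _ := by ring
  have hmeans : |∑ i, ratioMean P σ (x i) + T ^ 2 / 2| ≤ (ℓ ^ 4 + K₁ * ℓ ^ 7) / n ^ 4 := by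
    have a1 := hmean σ hσ0 hσ1
    rw [← hτ2] at a1
    -- Undoing the normalisation by `σ⁴` turns the deviation `n¹⁹` of the fourth observable into
    -- order `n⁻⁵`.
    have a2 : ∑ i, ratioMean P σ (x i) - N * ∫ z, ratioMean P σ z ∂π = σ ^ 4 *
        (∑ i, ratioMean P σ (x i) / σ ^ 4 - N * ∫ z, ratioMean P σ z / σ ^ 4 ∂π) := by
      rw [integral_div, ← Finset.sum_div]
      field_simp
    have a3 : |∑ i, ratioMean P σ (x i) - N * ∫ z, ratioMean P σ z ∂π| ≤ ℓ ^ 4 / n ^ 4 := by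
      rw [a2, abs_mul, abs_of_pos (by positivity : 0 < σ ^ 4)]
      calc _ ≤ σ ^ 4 * n ^ 19 := by gcongr
        _ = ℓ ^ 4 / n ^ 5 := by rw [hσe]; field_simp
        _ ≤ _ := by gcongr; norm_num
    have a4 : |N * ∫ z, ratioMean P σ z ∂π + T ^ 2 / 2| ≤ K₁ * ℓ ^ 7 / n ^ 4 := by
      have e1 : N * ∫ z, ratioMean P σ z ∂π + T ^ 2 / 2
          = n ^ 36 * (∫ z, ratioMean P σ z ∂π + σ ^ 6 / 2 * τ ^ 2) := by
        rw [hT2, ← hN]; ring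
      rw [e1, abs_mul, abs_of_pos (by positivity : 0 < n ^ 36)]
      calc _ ≤ n ^ 36 * (K₁ * σ ^ 7) := by gcongr
        _ = K₁ * ℓ ^ 7 / n ^ 6 := by rw [hσe]; field_simp
        _ ≤ _ := by gcongr; norm_num
    rw [add_div]
    rw [abs_le] at a3 a4 ⊢
    constructor <;> linarith
  have hfin := abs_real_sub_cdf_le_of_perturbation (μ := stdGaussian N)
    (T := fun w => (∑ i, ratio P σ (x i) (fieldIncr H P m σ x w i)
          + interaction H P m σ x w) / T + T / 2)
    (η := (C₀ + ℓ ^ 4 + K₁ * ℓ ^ 7) / T / n ^ 4) (θ := C₀ / n ^ 4) (by positivity) hS (by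
      refine (measureReal_mono ?_).trans (hrem N n m σ x hn hN hσ hσ1 hx0 hx1)
      intro w hw
      simp only [Set.mem_ofPred_eq] at hw ⊢
      set G := ∑ i, ratio P σ (x i) (fieldIncr H P m σ x w i) + interaction H P m σ x w with hG
      set L := ∑ i, lead P (x i) (w i) with hL
      have e1 : G / T + T / 2 - ∑ i, -(σ ^ 3 / T) * lead P (x i) (w i)
          = (G + σ ^ 3 * L - ∑ i, ratioMean P σ (x i)
            + (∑ i, ratioMean P σ (x i) + T ^ 2 / 2)) / T := by
        rw [← Finset.mul_sum, ← hL]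
        field_simp
        ring
      rw [e1, abs_div, abs_of_pos hT0, div_right_comm, div_lt_div_iff_of_pos_right hT0] at hw
      have e2 := abs_add_le (G + σ ^ 3 * L - ∑ i, ratioMean P σ (x i))
        (∑ i, ratioMean P σ (x i) + T ^ 2 / 2)
      have e3 : (C₀ + ℓ ^ 4 + K₁ * ℓ ^ 7) / n ^ 4
        = C₀ / n ^ 4 + (ℓ ^ 4 + K₁ * ℓ ^ 7) / n ^ 4 := by ring
      linarith) u
  refine hfin.trans (le_of_eq ?_)
  ring

/-! ### Asymptotics -/

theorem isLittleO_rpow_of_le_exp {f : ℕ → ℝ} {A a s : ℝ} (ha : 0 < a) (hs : 0 < s)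
    (h0 : ∀ N, 0 ≤ f N) (h : ∀ᶠ N : ℕ in atTop, f N ≤ A * Real.exp (-a * (N : ℝ) ^ s)) (t : ℝ) :
    f =o[atTop] fun N : ℕ => (N : ℝ) ^ (-t) := by
  have h1 := (isLittleO_exp_neg_mul_rpow_atTop ha (-t / s)).comp_tendsto
    ((tendsto_rpow_atTop hs).comp tendsto_natCast_atTop_atTop)
  have h2 : (fun N : ℕ => A * Real.exp (-a * (N : ℝ) ^ s)) =o[atTop]
      fun N : ℕ => (N : ℝ) ^ (-t) := by
    refine Asymptotics.IsLittleO.const_mul_left (h1.congr (fun N => rfl) fun N => ?_) A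
    simp only [Function.comp]
    rw [← Real.rpow_mul (Nat.cast_nonneg N)]
    congr 1
    field_simp
  refine Asymptotics.IsBigO.trans_isLittleO (Asymptotics.IsBigO.of_bound 1 ?_) h2
  filter_upwards [h] with N hN
  rw [one_mul, Real.norm_of_nonneg (h0 N)]
  exact hN.trans (le_abs_self _)

theorem tendsto_rpow_mul_of_isBigO {f : ℕ → ℝ} {α β : ℝ} (hβ : β < α)
    (h : f =O[atTop] fun N : ℕ => (N : ℝ) ^ (-α)) :
    Tendsto (fun N : ℕ => (N : ℝ) ^ β * f N) atTop (𝓝 0) := by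
  refine ((Asymptotics.isBigO_refl (fun N : ℕ => (N : ℝ) ^ β) atTop).mul h).trans_tendsto ?_
  have h1 : Tendsto (fun N : ℕ => (N : ℝ) ^ (-(α - β))) atTop (𝓝 0) :=
    (tendsto_rpow_neg_atTop (sub_pos.2 hβ)).comp tendsto_natCast_atTop_atTop
  refine h1.congr' ?_
  filter_upwards [eventually_gt_atTop 0] with N hN
  rw [← Real.rpow_add (by positivity)]
  congr 1; ring

/-- The natural scale `n = N ^ (1 / 36)` of the error terms. -/
noncomputable def scale (N : ℕ) : ℝ := (N : ℝ) ^ ((1 : ℝ) / 36)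

theorem scale_pow (N k : ℕ) : scale N ^ k = (N : ℝ) ^ ((k : ℝ) / 36) := by
  rw [scale, ← Real.rpow_natCast, ← Real.rpow_mul (Nat.cast_nonneg N)]
  congr 1; ring

theorem one_le_scale {N : ℕ} (hN : 0 < N) : 1 ≤ scale N :=
  Real.one_le_rpow (by exact_mod_cast hN) (by norm_num)

theorem sigmaN_mul_scale_pow (ℓ : ℝ) {N : ℕ} (hN : 0 < N) : sigmaN ℓ N * scale N ^ 6 = ℓ := by
  have : (0 : ℝ) < (N : ℝ) ^ ((1 : ℝ) / 6) := by positivity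
  rw [scale_pow, sigmaN, show ((6 : ℕ) : ℝ) / 36 = 1 / 6 by norm_num]
  field_simp

theorem eventually_sigmaN_le_one (ℓ : ℝ) : ∀ᶠ N : ℕ in atTop, sigmaN ℓ N ≤ 1 := by
  have h : Tendsto (fun N : ℕ => (N : ℝ) ^ ((1 : ℝ) / 6)) atTop atTop :=
    (tendsto_rpow_atTop (by norm_num)).comp tendsto_natCast_atTop_atTop
  filter_upwards [h.eventually_ge_atTop ℓ, eventually_gt_atTop 0] with N hN hN0
  rw [sigmaN, div_le_one (by positivity)]
  exact hN

theorem tendsto_psi {H U : ℝ → ℝ} (h : HP H U) (π : Measure ℝ) :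
    Tendsto (psi H U π) (cocompact ℝ) atBot := by
  obtain ⟨C, hC⟩ := h.H_bdd
  refine tendsto_atBot_mono (fun x => ?_) (tendsto_atBot_add_const_right _
    (C * |∫ z, H z ∂π|) h.U_tendsto)
  have := abs_mul_le_of_le (hC x) (le_refl |∫ z, H z ∂π|)
  rw [psi]
  linarith [(abs_le.1 this).1]

end MALA

/-! ### Assembly of the main theorem. -/

theorem proposition2 (y : ℝ) (H p : ℝ → ℝ) (hp_pos : ∀ x, 0 < p x) (hp_int : ∫ x, p x = 1)
    (hHP : MALA.HP H (MALA.potential y H p)) :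
    ∃ π : Measure ℝ,
      MALA.IsLimitLaw H (MALA.potential y H p) π ∧
      (∀ π' : Measure ℝ, MALA.IsLimitLaw H (MALA.potential y H p) π' → π' = π) ∧
      0 < MALA.tau H (MALA.potential y H p) π ∧
      ∀ ℓ : ℝ, 0 < ℓ →
        ∃ F : (N : ℕ) → Set (Fin N → ℝ),
          (∀ N, MeasurableSet (F N)) ∧
          (∀ t : ℝ, 0 < t →
            (fun N : ℕ => (MALA.post H (MALA.potential y H p) N).real (F N)ᶜ)
              =o[atTop] fun N : ℕ => (N : ℝ) ^ (-t)) ∧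
          (∀ β : ℝ, 0 < β → β < 1 / 9 →
            Tendsto (fun N : ℕ => (N : ℝ) ^ β *
              ⨆ x : F N, MALA.kolmDist H (MALA.potential y H p)
                (MALA.tau H (MALA.potential y H p) π) ℓ N x) atTop (𝓝 0)) ∧
          (fun N : ℕ => ⨆ x : F N, MALA.kolmDist H (MALA.potential y H p)
              (MALA.tau H (MALA.potential y H p) π) ℓ N x)
            =O[atTop] fun N : ℕ => (N : ℝ) ^ (-(1 / 9 : ℝ)) := by
  have hI := MALA.integrable_exp_potential hp_pos hp_int hHP
  set U := MALA.potential y H p with hU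
  have hHc := hHP.smooth_H.continuous
  have hUc := hHP.smooth_U.continuous
  obtain ⟨C, hC⟩ := hHP.H_bdd
  obtain ⟨π, hπ⟩ := MALA.exists_isLimitLaw hHc hUc hC hI
  have : IsProbabilityMeasure π := hπ.1
  obtain ⟨c, hc, hdens, hi, -, hg⟩ := hπ.exists_density hHc hUc hC hI
  obtain ⟨B, hB⟩ := hHP.exists_chain (∫ z, H z ∂π)
  replace hB : MALA.Chain (fun k => iteratedDeriv k H)
    (fun k => iteratedDeriv k (MALA.psi H U π)) B := hB
  have hB1 := hB.one_le
  have hi' : Integrable fun x => Real.exp (iteratedDeriv 0 (MALA.psi H U π) x) := by simpa using hi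
  have hg' : ∀ g : ℝ → ℝ, ∫ x, g x ∂π
      = c * ∫ x, Real.exp (iteratedDeriv 0 (MALA.psi H U π) x) * g x := by simpa using hg
  have hpos := hB.integral_varTerm_pos (π := π)
    (by simpa using MALA.tendsto_psi hHP π) hc hi' hg'
  have hτeq := hB.tauSq_eq hi hg
  rw [← hτeq] at hpos
  have hτ : 0 < MALA.tau H U π := Real.sqrt_pos.2 hpos
  refine ⟨π, hπ, fun π' h' => hπ.unique hHc hUc hC hI h', hτ, fun ℓ hℓ => ?_⟩
  obtain ⟨K, hK, hcdf⟩ := hB.exists_cdf_bound (π := π) (c := c) hi' hg' hℓ hτ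
    (by rw [MALA.tau, Real.sq_sqrt hpos.le, hτeq])
  set f : ℕ → Fin 4 → ℝ → ℝ := fun N => MALA.observables (fun k => iteratedDeriv k H)
    (fun k => iteratedDeriv k (MALA.psi H U π)) (MALA.sigmaN ℓ N) with hf
  have hfm : ∀ N k, Measurable (f N k) := fun N => hB.measurable_observables _
  -- The radius `N^{19/36}` exceeds `√N` by `N^{1/36}`: enough for superpolynomially small
  -- exceptional probability, and small enough for the error `N^{-1/9}`.
  set F : (N : ℕ) → Set (Fin N → ℝ) := fun N =>
    MALA.typicalSet (f N) π (MALA.scale N ^ 19) N with hF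
  have hFm : ∀ N, MeasurableSet (F N) := fun N => MALA.measurableSet_typicalSet (hfm N) _ _ _
  have hO : (fun N : ℕ => ⨆ x : F N, MALA.kolmDist H U (MALA.tau H U π) ℓ N x)
      =O[atTop] fun N : ℕ => (N : ℝ) ^ (-(1 / 9 : ℝ)) := by
    refine Asymptotics.IsBigO.of_bound K ?_
    filter_upwards [eventually_gt_atTop 0, MALA.eventually_sigmaN_le_one ℓ] with N hN hσ1
    have hn := MALA.one_le_scale hN
    have hn36 : MALA.scale N ^ 36 = N := by rw [MALA.scale_pow]; norm_num
    have hσ := MALA.sigmaN_mul_scale_pow ℓ hN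
    have hσ0 : 0 < MALA.sigmaN ℓ N := div_pos hℓ (by positivity)
    have hZ := (MALA.exists_post_le_pi hHc hUc hC hc hdens hi hN).1
    have hr : K * ‖(N : ℝ) ^ (-(1 / 9 : ℝ))‖ = K / MALA.scale N ^ 4 := by
      rw [Real.norm_of_nonneg (by positivity), Real.rpow_neg (by positivity), MALA.scale_pow,
        show ((4 : ℕ) : ℝ) / 36 = 1 / 9 by norm_num, ← div_eq_mul_inv]
    have hb : 0 ≤ K / MALA.scale N ^ 4 := by positivity
    have hnonneg : 0 ≤ ⨆ x : F N, MALA.kolmDist H U (MALA.tau H U π) ℓ N x :=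
      Real.iSup_nonneg fun x => Real.iSup_nonneg fun u => abs_nonneg _
    rw [hr, Real.norm_of_nonneg hnonneg]
    -- Nonnegativity of the bound also covers an empty `F N`, where the real supremum is 0 by
    -- convention.
    refine Real.iSup_le (fun x => Real.iSup_le (fun u => ?_) hb) hb
    have := hcdf N (MALA.scale N) (MALA.sigmaN ℓ N) x hn hn36 hσ hσ1 x.2 u
    simp only [iteratedDeriv_zero] at this
    simp_rw [MALA.logAccept_eq_ratio_add_interaction hN hσ0 hZ hB]
    exact this
  refine ⟨F, hFm, fun t _ => ?_, fun β _ hβ => MALA.tendsto_rpow_mul_of_isBigO hβ hO, hO⟩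
  set C₀ : ℝ := 4 * B ^ 5 * MALA.wtMean with hC₀
  have hC₀0 : 0 < C₀ := by have := MALA.one_le_wtMean; positivity
  -- The factor `e^{2C²}` is the cost of comparison with the product law, 4 counts observables and 2
  -- tails. The exponent `1 / 18` comes from `(n¹⁹)² / N = n²`.
  refine MALA.isLittleO_rpow_of_le_exp (A := Real.exp (2 * C ^ 2) * (4 * 2))
    (a := 1 / (2 * C₀ ^ 2)) (s := 1 / 18) (by positivity) (by norm_num)
    (fun N => measureReal_nonneg) ?_ t
  filter_upwards [eventually_gt_atTop 0, MALA.eventually_sigmaN_le_one ℓ] with N hN hσ1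
  have hn := MALA.one_le_scale hN
  have hn36 : MALA.scale N ^ 36 = N := by rw [MALA.scale_pow]; norm_num
  have hσ0 : 0 < MALA.sigmaN ℓ N := div_pos hℓ (by positivity)
  refine ((MALA.exists_post_le_pi hHc hUc hC hc hdens hi hN).2 _ (hFm N).compl).trans ?_
  have h1 := MALA.real_compl_typicalSet_le (π := π) (r := MALA.scale N ^ 19) (hfm N)
    (hB.abs_observables_le hσ0 hσ1) (by positivity) N
  have h2 : -(MALA.scale N ^ 19) ^ 2 / (2 * (N * C₀ ^ 2))
      = -(1 / (2 * C₀ ^ 2)) * (N : ℝ) ^ ((1 : ℝ) / 18) := by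
    rw [show (1 : ℝ) / 18 = ((2 : ℕ) : ℝ) / 36 by norm_num, ← MALA.scale_pow, ← hn36]
    have : MALA.scale N ≠ 0 := by positivity
    field_simp
  rw [h2] at h1
  calc _ ≤ Real.exp (2 * C ^ 2) * (Fintype.card (Fin 4) *
        (2 * Real.exp (-(1 / (2 * C₀ ^ 2)) * (N : ℝ) ^ ((1 : ℝ) / 18)))) := by gcongr
    _ = _ := by rw [Fintype.card_fin]; push_cast; ring
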